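/- **Setting.** Let $n\ge 2$ and $T>0$. Let $\mathcal Z_n$ be the set of $(\mathbf x,\mathbf b)\in\mathbb R^n\times\{-1,0,1\}^n$ such that $x_i>x_j$ whenever $i>j$ and $b_ib_j\ne0$. Particle $i$ is *charged* if $b_i\neq 0$ and *neutral* if $b_i=0$. A map $(\mathbf x,\mathbf b):[0,T]\to\mathcal Z_n$ is a *solution of $(P_n)$* with initial datum $(\mathbf x^\circ,\mathbf b^\circ)\in\mathcal Z_n$ if there is a finite set $S\subset(0,T]$ such that: 1. each $x_i$ is in $C([0,T])\cap C^1([0,T]\setminus S)$ and each $b_i$ is right-continuous; 2. $(\mathbf x(0),\mathbf b(0))=(\mathbf x^\circ,\mathbf b^\circ)$; 3. each $b_i$ jumps at most once, and if $b_i$ jumps at $t$, then $t\in S$, $|b_i(t-)|=1$ and $b_i(t)=0$; moreover $\sum_{i:\,x_i(\tau)=y}\big(b_i(\tau)-b_i(\tau-)\big)=0$ for all $(\tau,y)\in S\times\mathbb R$; 4. $\dfrac{dx_i}{dt}=\dfrac1n\sum_{j\ne i}\dfrac{b_ib_j}{x_i-x_j}$ on $(0,T)\setminus S$ for every $i$ (terms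 with $b_ib_j=0$ are zero). A point $(\tau,y)\in S\times\mathbb R$ is an *annihilation point* if $b_i(\tau)\ne b_i(\tau-)$ for some $i$ with $x_i(\tau)=y$. Particles $i<j$ are *neighbors* if both are charged and all particles $k$ with $i<k<j$ are neutral. Let $d^{+}$ (resp. $d^-$) $\in(0,\infty]$ be the smallest distance between two neighbors that both have charge $+1$ (resp. $-1$), with $\inf\emptyset=\infty$. Put $M_k(\mathbf x)=\frac1k\sum_{i=1}^n x_i^k$, $\mathbf M=(M_1,\dots,M_n)$ and $d_{\mathbf M}(\mathbf x,\mathbf y)=\|\mathbf M(\mathbf x)-\mathbf M(\mathbf y)\|_2$. **Theorem.** Let $n\ge2$, $T>0$ and $(\mathbf x^\circ,\mathbf b^\circ)\in\mathcal Z_n$. Then $(P_n)$ has a solution $(\mathbf x,\mathbf b)$ on $[0,T]$ with initial datum $(\mathbf x^\circ,\mathbf b^\circ)$. Among the sets $S$ admissible in the definition of this solution there is a smallest one, again denoted $S$. The solution is unique modulo relabeling: every solution $(\hat{\mathbf x},\hat{\mathbf b})$ with the same initial datum has the same smallest set $S$, and there are permutations $\sigma_t$ of $\{1,\dots,n\}$,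 with $\sigma_r=\sigma_s$ whenever $0\le s\le r\le T$ and $(s,r]\cap S=\emptyset$, such that $\hat x_{\sigma_t(i)}(t)=x_i(t)$ and $\hat b_{\sigma_t(i)}(t)=b_i(t)$ for all $t\in[0,T]$ and all $i$. Moreover, every solution satisfies: (i) $d_{\mathbf M}(\mathbf x(t),\mathbf x(s))\le C|t-s|$ for all $0\le s<t\le T$, where $C>0$ depends only on $n$, $T$ and $\mathbf M(\mathbf x^\circ)$. (ii) $d^\pm(t)\ge\sqrt{\gamma_n t+d^\pm(0)^2}$ for all $t\in[0,T]$, where $\gamma_n=\frac{8}{n^2-1}$ if $n$ is odd and $\gamma_n=\frac8{n^2}$ if $n$ is even. (iii) If $i<j$ are neighbors at time $t_0\in[0,T]$, then, with $c_0:=\min(d^+,d^-,x_j-x_i)(t_0)$, $$x_j(t)-x_i(t)\ge\sqrt{c_0^2-8\tfrac{\log n+1}{n}(t-t_0)}$$ for all $t\in[t_0,T]$ for which the expression under the root is nonnegative. (iv) For every $\tau\in S$ and every $i$ there is $C\ge0$ such that $|x_i(t)-x_i(\tau)|\le C\sqrt{\tau-t}$ for all $t\in[0,\tau]$. (v) For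 every annihilation point $(\tau,y)$ there are $c>0$ and indices $i,j$ with $x_i(\tau)=x_j(\tau)=y$, $b_i(\tau-)\ne0$, $b_j(\tau-)\neq0$, and $x_i(t)-y>c\sqrt{\tau-t}$, $x_j(t)-y<-c\sqrt{\tau-t}$ for all $t<\tau$ close enough to $\tau$. (vi) Let $(\mathbf x_m^\circ,\mathbf b^\circ)\in\mathcal Z_n$ with $\mathbf x^\circ_m\to\mathbf x^\circ$ as $m\to\infty$, and let $(\mathbf x_m,\mathbf b_m)$ be solutions on $[0,T]$ with initial data $(\mathbf x^\circ_m,\mathbf b^\circ)$. Then $\sup_{t\in[0,T]}d_{\mathbf M}(\mathbf x_m(t),\mathbf x(t))\to0$, and $\mathbf b_m\to\mathbf b$ locally uniformly on $[0,T]\setminus S$ modulo relabeling: for every compact $K\subset[0,T]\setminus S$ and every $\varepsilon>0$ there is $m_0$ such that for all $m\ge m_0$ and $t\in K$ there is a permutation $\sigma$ with $b_{m,\sigma(i)}(t)=b_i(t)$ and $|x_{m,\sigma(i)}(t)-x_i(t)|<\varepsilon$ for all $i$. -/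

import Mathlib

open Set Filter Topology
open scoped ENNReal

namespace AnnihilatingParticles

/-- The state space: positions `x` and charges `b` (with values in `SignType = {-1, 0, 1}`) of `n`
particles such that the charged particles are strictly ordered from left to right by their index.
Nothing is required of the positions of neutral particles. -/
def stateSpace (n : ℕ) : Set ((Fin n → ℝ) × (Fin n → SignType)) :=
  {p | ∀ i j : Fin n, j < i → p.2 i * p.2 j ≠ 0 → p.1 j < p.1 i}

/-- The velocity `(1/n) ∑_{j ≠ i} b_i b_j / (x_i - x_j)` of the `i`-th particle. Terms with
`b_i b_j = 0` vanish, also if `x_i = x_j`. -/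
noncomputable def velocity {n : ℕ} (x : Fin n → ℝ) (b : Fin n → SignType) (i : Fin n) : ℝ :=
  (1 / (n : ℝ)) * ∑ j ∈ Finset.univ.erase i, ((b i : ℝ) * (b j : ℝ)) / (x i - x j)

/-- The charge `b_i`, as a function on `[0, T]`, is discontinuous at `t`. -/
def JumpsAt {n : ℕ} (T : ℝ) (b : ℝ → Fin n → SignType) (i : Fin n) (t : ℝ) : Prop :=
  ¬ ContinuousWithinAt (fun s => b s i) (Icc 0 T) t

/-- The left limit `b_i(t-)`. -/
noncomputable def chargeBefore {n : ℕ} (b : ℝ → Fin n → SignType) (i : Fin n) (t : ℝ) : SignType :=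
  Function.leftLim (fun s => b s i) t

/-- The jump `⟦b_i⟧(t) = b_i(t) - b_i(t-)` of the right-continuous function `b_i`. -/
noncomputable def jump {n : ℕ} (b : ℝ → Fin n → SignType) (i : Fin n) (t : ℝ) : ℤ :=
  (b t i : ℤ) - (chargeBefore b i t : ℤ)

/-- `(x, b)`, considered on `[0, T]`, is a solution of the annihilating particle system with initial
datum `(x₀, b₀)`, and the finite set `S` of exceptional times is a possible choice in the definition
of a solution. Values of `x` and `b` outside of `[0, T]` are irrelevant. -/
structure IsSolutionWith {n : ℕ} (T : ℝ) (x₀ : Fin n → ℝ) (b₀ : Fin n → SignType)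
    (x : ℝ → Fin n → ℝ) (b : ℝ → Fin n → SignType) (S : Finset ℝ) : Prop where
  times_mem : ∀ τ ∈ S, τ ∈ Ioc 0 T
  mem_stateSpace : ∀ t ∈ Icc 0 T, (x t, b t) ∈ stateSpace n
  continuousOn : ∀ i, ContinuousOn (fun t => x t i) (Icc 0 T)
  contDiffOn : ∀ i, ContDiffOn ℝ 1 (fun t => x t i) (Icc 0 T \ (S : Set ℝ))
  rightContinuous : ∀ i, ∀ t ∈ Ico 0 T, ContinuousWithinAt (fun s => b s i) (Ici t) t
  initial_position : x 0 = x₀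
  initial_charge : b 0 = b₀
  jumps_at_most_once : ∀ i, {t | t ∈ Icc 0 T ∧ JumpsAt T b i t}.Subsingleton
  jump_to_neutral : ∀ i, ∀ t ∈ Icc 0 T, JumpsAt T b i t →
    t ∈ S ∧ chargeBefore b i t ≠ 0 ∧ b t i = 0
  annihilation_rule : ∀ τ ∈ S, ∀ y : ℝ,
    ∑ i ∈ Finset.univ.filter (fun i => x τ i = y), jump b i τ = 0
  ode : ∀ t ∈ Ioo 0 T \ (S : Set ℝ), ∀ i,
    HasDerivAt (fun s => x s i) (velocity (x t) (b t) i) t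

/-- `(x, b)` is a solution on `[0, T]` with initial datum `(x₀, b₀)`. -/
def IsSolution {n : ℕ} (T : ℝ) (x₀ : Fin n → ℝ) (b₀ : Fin n → SignType)
    (x : ℝ → Fin n → ℝ) (b : ℝ → Fin n → SignType) : Prop :=
  ∃ S : Finset ℝ, IsSolutionWith T x₀ b₀ x b S

/-- `S` is the smallest set that can be chosen in the definition of the solution `(x, b)`. -/
def IsMinimalTimeSet {n : ℕ} (T : ℝ) (x₀ : Fin n → ℝ) (b₀ : Fin n → SignType)
    (x : ℝ → Fin n → ℝ) (b : ℝ → Fin n → SignType) (S : Finset ℝ) : Prop :=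
  IsLeast {S' : Finset ℝ | IsSolutionWith T x₀ b₀ x b S'} S

/-- `(x, b)` and `(x', b')` agree on `[0, T]` modulo relabeling: at each time they describe the same
collection of points with charges, and the relabeling only changes at the times in `S`. -/
def EqModRelabeling {n : ℕ} (T : ℝ) (S : Finset ℝ)
    (x : ℝ → Fin n → ℝ) (b : ℝ → Fin n → SignType)
    (x' : ℝ → Fin n → ℝ) (b' : ℝ → Fin n → SignType) : Prop :=
  ∃ σ : ℝ → Equiv.Perm (Fin n),
    (∀ s ∈ Icc 0 T, ∀ t ∈ Icc s T, (∀ τ ∈ S, τ ∉ Ioc s t) → σ t = σ s) ∧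
    ∀ t ∈ Icc 0 T, ∀ i, x' t (σ t i) = x t i ∧ b' t (σ t i) = b t i

/-- The particles `i < j` are neighbors: both are charged, and the particles between them are
neutral. -/
def Neighbors {n : ℕ} (b : Fin n → SignType) (i j : Fin n) : Prop :=
  i < j ∧ b i ≠ 0 ∧ b j ≠ 0 ∧ ∀ k, i < k → k < j → b k = 0

/-- The smallest distance between two neighbors which both have the charge `s`, with value `∞` if
there are no such neighbors: `d^+` for `s = 1` and `d^-` for `s = -1`. -/
noncomputable def minDist {n : ℕ} (s : SignType) (x : Fin n → ℝ) (b : Fin n → SignType) : ℝ≥0∞ :=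
  ⨅ (i : Fin n) (j : Fin n) (_ : Neighbors b i j ∧ b i = s ∧ b j = s), ENNReal.ofReal (x j - x i)

/-- The minimum of `d^+`, `d^-` and the distance `x_j - x_i`. -/
noncomputable def localGap {n : ℕ} (x : Fin n → ℝ) (b : Fin n → SignType) (i j : Fin n) : ℝ :=
  (min (min (minDist 1 x b) (minDist (-1) x b)) (ENNReal.ofReal (x j - x i))).toReal

/-- The moments `M_k(x) = (1/k) ∑_i x_i ^ k` for `k = 1, …, n`, as a vector of Euclidean space. -/
noncomputable def moments {n : ℕ} (x : Fin n → ℝ) : EuclideanSpace ℝ (Fin n) :=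
  WithLp.toLp 2 (fun k : Fin n => (1 / ((k : ℕ) + 1 : ℝ)) * ∑ i, x i ^ ((k : ℕ) + 1))

/-- The moment distance `d_M(x, y) = ‖M(x) - M(y)‖₂`. -/
noncomputable def momentDist {n : ℕ} (x y : Fin n → ℝ) : ℝ :=
  ‖moments x - moments y‖

/-- The growth rate of the square of the minimal distance between neighbors of equal sign:
`8 / (n² - 1)` for odd `n` and `8 / n²` for even `n`. -/
noncomputable def separationRate (n : ℕ) : ℝ :=
  if Odd n then 8 / ((n : ℝ) ^ 2 - 1) else 8 / (n : ℝ) ^ 2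

end AnnihilatingParticles

/-! The kernel `1 / (x i - x j)` is antisymmetric. Hence in `n * ∑ a k * velocity x b k` the
interactions combine in pairs to `b k * b l * (a k - a l) / (x k - x l)` (`sum_mul_velocity`), which
stays bounded at collisions if `a` is a Lipschitz function of the position. So `∑ f (x k)` is
Lipschitz in time, through all collisions, whenever `f'` is Lipschitz; this bounds positions and
moments. For a cluster of particles near `y` and `f u = (u - y) ^ 2` the quotients are constant, and
the derivative is `((∑ b) ^ 2 - ∑ b ^ 2) / n` up to a small influence from outside
(`abs_virial_sub_le`). Its boundedness gives the upper square root bound at collisions. If the net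
charge is at most one in absolute value and at least two particles are charged, the cluster
contracts at a definite rate. This gives the lower square root bound, and it forces the cluster of a
perturbed solution to annihilate soon as well (`exists_stability_collision`).

The separation bounds rest on a comparison of sums: with decreasing weights, the worst case for a
charge is that all others on one side have the same sign and are packed at the minimal distance
(`sum_sign_mul_antitone_le`). For a closest pair of equal sign the resulting sum telescopes, for
general neighbors it is harmonic. Annihilation preserves the net charge of every interval, so it
cannot create close neighbors of equal sign.

For existence, the equation is solved with frozen charges up to a maximal time. Sums of truncated
squares converge there and determine the ordered configuration, so the positions converge. By
separation the net charge at each point is `-1`, `0` or `1`, so at most one charged particle needs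
to survive there. Each restart has fewer charged particles. For uniqueness, a Gronwall estimate
applies between jumps; at a jump, the conserved net charges determine the configuration up to a
permutation.

Everything is done for an `Evolution`, which uses right derivatives and imposes no order on the
labels, so that it can be relabeled. -/

namespace AnnihilatingParticles

/-! ### Continuous induction and barriers -/

/-- The infimum of the failing times would satisfy `P` by `hl`, and then `hr` excludes failing times
just after it. For evolutions, jumps of the charges are handled in `hl` and the equation enters in
`hr`. -/
theorem continuous_induction {a b : ℝ} {P : ℝ → Prop} (h0 : P a)
    (hl : ∀ t ∈ Ioc a b, (∀ s ∈ Ico a t, P s) → P t)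
    (hr : ∀ t ∈ Ico a b, (∀ s ∈ Icc a t, P s) → ∀ᶠ s in 𝓝[>] t, P s) :
    ∀ t ∈ Icc a b, P t := by
  intro t₁ ht₁
  by_contra hcon
  set A : Set ℝ := {t | a ≤ t ∧ t ≤ b ∧ ¬ P t}
  have hne : A.Nonempty := ⟨t₁, ht₁.1, ht₁.2, hcon⟩
  have hbd : BddBelow A := ⟨a, fun t ht => ht.1⟩
  set τ := sInf A
  have hτa : a ≤ τ := le_csInf hne fun t ht => ht.1
  have hτb : τ ≤ b := (csInf_le hbd ⟨ht₁.1, ht₁.2, hcon⟩).trans ht₁.2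
  have hbelow : ∀ s ∈ Ico a τ, P s := by
    intro s hs
    by_contra h
    exact absurd (csInf_le hbd (⟨hs.1, hs.2.le.trans hτb, h⟩ : s ∈ A)) (not_le.2 hs.2)
  have hPτ : P τ := by
    rcases hτa.eq_or_lt with h | h
    · rw [← h]; exact h0
    · exact hl τ ⟨h, hτb⟩ hbelow
  have hle : ∀ s ∈ Icc a τ, P s := by
    intro s hs
    rcases hs.2.eq_or_lt with h | h
    · rw [h]; exact hPτ
    · exact hbelow s ⟨hs.1, h⟩
  have hτlt : τ < b := by
    rcases hτb.eq_or_lt with h | h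
    · exact absurd (hle t₁ ⟨ht₁.1, h ▸ ht₁.2⟩) hcon
    · exact h
  obtain ⟨u, hu, hPu⟩ := mem_nhdsGT_iff_exists_Ioo_subset.1 (hr τ ⟨hτa, hτlt⟩ hle)
  obtain ⟨t, htA, htu⟩ := exists_lt_of_csInf_lt hne (show sInf A < u from hu)
  rcases (csInf_le hbd htA).eq_or_lt with h | h
  · exact htA.2.2 (h ▸ hPτ)
  · exact htA.2.2 (hPu ⟨h, htu⟩)

/-- A function that is nonnegative at `t`, and has positive right derivative if it vanishes there,
is nonnegative immediately to the right of `t`. -/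
theorem eventually_nonneg_right {h : ℝ → ℝ} {h' t : ℝ} (hd : HasDerivWithinAt h h' (Ici t) t)
    (h0 : 0 ≤ h t) (hpos : h t = 0 → 0 < h') : ∀ᶠ s in 𝓝[>] t, 0 ≤ h s := by
  rcases h0.eq_or_lt with he | he
  · have hslope := (hasDerivWithinAt_iff_tendsto_slope.1 hd)
    rw [Ici_sdiff_left] at hslope
    filter_upwards [hslope.eventually (lt_mem_nhds (hpos he.symm)), self_mem_nhdsWithin]
      with s hs hts
    rw [slope_def_field, ← he, sub_zero] at hs
    have : 0 < s - t := sub_pos.2 hts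
    exact ((div_pos_iff_of_pos_right this).1 hs).le
  · have : ContinuousWithinAt h (Ioi t) t := hd.continuousWithinAt.mono Ioi_subset_Ici_self
    exact (this.eventually (lt_mem_nhds he)).mono fun s hs => le_of_lt hs

theorem hasDerivWithinAt_const_add {f : ℝ → ℝ} {f' c t : ℝ}
    (h : HasDerivWithinAt f f' (Ici (c + t)) (c + t)) :
    HasDerivWithinAt (fun r => f (c + r)) f' (Ici t) t := by
  have h2 := HasDerivWithinAt.scomp (t' := Ici (c + t)) (s := Ici t) t h
    (((hasDerivAt_id t).const_add c).hasDerivWithinAt) (fun r hr => by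
      simp only [mem_Ici] at *; linarith)
  simpa [Function.comp_def] using h2

/-- Only right derivatives are required, so the interval may contain collision times. -/
theorem sub_le_of_deriv_right_le {f f' : ℝ → ℝ} {a b C : ℝ} (hab : a ≤ b)
    (hf : ContinuousOn f (Icc a b)) (hd : ∀ t ∈ Ico a b, HasDerivWithinAt f (f' t) (Ici t) t)
    (hC : ∀ t ∈ Ico a b, f' t ≤ C) : f b - f a ≤ C * (b - a) := by
  have := image_le_of_deriv_right_le_deriv_boundary hf hd (B := fun t => f a + C * (t - a))
    (B' := fun _ => C) (by simp) (by fun_prop)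
    (fun t _ => by
      simpa using ((((hasDerivAt_id t).sub_const a).const_mul C).const_add (f a)).hasDerivWithinAt)
    hC (right_mem_Icc.2 hab)
  linarith

theorem abs_sub_le_of_abs_deriv_right_le {f f' : ℝ → ℝ} {a b C : ℝ} (hab : a ≤ b)
    (hf : ContinuousOn f (Icc a b)) (hd : ∀ t ∈ Ico a b, HasDerivWithinAt f (f' t) (Ici t) t)
    (hC : ∀ t ∈ Ico a b, |f' t| ≤ C) : |f b - f a| ≤ C * (b - a) := by
  refine abs_le.2 ⟨?_, sub_le_of_deriv_right_le hab hf hd fun t ht => (abs_le.1 (hC t ht)).2⟩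
  have := sub_le_of_deriv_right_le hab hf.neg (fun t ht => (hd t ht).neg) (C := C)
    fun t ht => by have := (abs_le.1 (hC t ht)).1; linarith
  simp only [Pi.neg_apply] at this
  linarith

/-! ### Charges -/

theorem coe_int_eq_zero {s : SignType} : ((s : ℤ) = 0) ↔ s = 0 := by
  cases s <;> simp

theorem coe_int_injective : Function.Injective (fun s : SignType => (s : ℤ)) := by
  intro s t h
  cases s <;> cases t <;> simp_all

theorem abs_coe_int_le (s : SignType) : |(s : ℤ)| ≤ 1 := by
  cases s <;> simp

theorem abs_coe_le (s : SignType) : |(s : ℝ)| ≤ 1 := by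
  cases s <;> simp

theorem abs_coe_mul_le (s t : SignType) : |(s : ℝ) * (t : ℝ)| ≤ 1 := by
  rw [abs_mul]
  exact mul_le_one₀ (abs_coe_le s) (abs_nonneg _) (abs_coe_le t)

theorem velocity_eq_zero {n : ℕ} {x : Fin n → ℝ} {b : Fin n → SignType} {i : Fin n}
    (h : b i = 0) : velocity x b i = 0 := by
  simp [velocity, h]

/-! ### Evolutions -/

/-- The features of a solution that do not refer to the labels of the particles. The equation is
satisfied in the sense of right derivatives at all times, including the collision times. -/
structure Evolution {n : ℕ} (T : ℝ) (x : ℝ → Fin n → ℝ) (b : ℝ → Fin n → SignType) : Prop where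
  cont : ∀ i, ContinuousOn (fun t => x t i) (Icc 0 T)
  deriv_right : ∀ t ∈ Ico 0 T, ∀ i,
    HasDerivWithinAt (fun s => x s i) (velocity (x t) (b t) i) (Ici t) t
  charge_right : ∀ t ∈ Ico 0 T, ∀ᶠ s in 𝓝[>] t, b s = b t
  charge_left : ∀ t ∈ Ioc 0 T, ∃ β : Fin n → SignType, (∀ᶠ s in 𝓝[<] t, b s = β) ∧
    (∀ i, b t i = β i ∨ b t i = 0) ∧
    ∀ y, ∑ i with x t i = y, ((b t i : ℤ) - (β i : ℤ)) = 0
  inj : ∀ t ∈ Icc 0 T, ∀ i j, i ≠ j → b t i ≠ 0 → b t j ≠ 0 → x t i ≠ x t j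

section

variable {n : ℕ} {T : ℝ} {x : ℝ → Fin n → ℝ} {b : ℝ → Fin n → SignType}

/-- Conservation of charge at single points passes to every set that is a union of position fibers,
such as the particles in an interval or in a cluster. -/
theorem sum_saturated {x : Fin n → ℝ} {f : Fin n → ℤ} (h : ∀ y, ∑ i with x i = y, f i = 0)
    (A : Finset (Fin n)) (hA : ∀ i ∈ A, ∀ j, x j = x i → j ∈ A) : ∑ i ∈ A, f i = 0 := by
  rw [← Finset.sum_fiberwise_of_maps_to (t := A.image x) (g := x)
    (fun i hi => Finset.mem_image_of_mem x hi)]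
  refine Finset.sum_eq_zero fun y hy => ?_
  obtain ⟨k, hk, rfl⟩ := Finset.mem_image.1 hy
  rw [← h (x k)]
  refine Finset.sum_congr ?_ fun _ _ => rfl
  ext j
  simp only [Finset.mem_filter, Finset.mem_univ, true_and, and_iff_right_iff_imp]
  exact fun hj => hA k hk j hj

/-- If the particles that are charged before have different positions, then no charge jumps. -/
theorem charge_eq_of_injective {x : Fin n → ℝ} {c β : Fin n → SignType}
    (hc : ∀ i, c i = β i ∨ c i = 0)
    (h : ∀ y, ∑ i with x i = y, ((c i : ℤ) - (β i : ℤ)) = 0)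
    (hinj : ∀ i j, i ≠ j → β i ≠ 0 → β j ≠ 0 → x i ≠ x j) : c = β := by
  ext i
  by_cases hi : β i = 0
  · rcases hc i with h | h
    · exact h
    · rw [h, hi]
  · have := h (x i)
    rw [Finset.sum_eq_single i] at this
    · exact coe_int_injective (sub_eq_zero.1 this)
    · intro j hj hji
      have hβ : β j = 0 := by
        by_contra hβ
        exact hinj j i hji hβ hi (Finset.mem_filter.1 hj).2
      have : c j = 0 := by
        rcases hc j with h | h
        · rw [h, hβ]
        · exact h
      rw [this, hβ, sub_self]
    · simp

namespace Evolution

theorem restrict (E : Evolution T x b) {T' : ℝ} (h : T' ≤ T) : Evolution T' x b where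
  cont i := (E.cont i).mono (Icc_subset_Icc_right h)
  deriv_right t ht := E.deriv_right t ⟨ht.1, ht.2.trans_le h⟩
  charge_right t ht := E.charge_right t ⟨ht.1, ht.2.trans_le h⟩
  charge_left t ht := E.charge_left t ⟨ht.1, ht.2.trans h⟩
  inj t ht := E.inj t ⟨ht.1, ht.2.trans h⟩

theorem velocity_relabel (x : Fin n → ℝ) (b : Fin n → SignType) (σ : Equiv.Perm (Fin n))
    (i : Fin n) :
    velocity (fun i => x (σ i)) (fun i => b (σ i)) i = velocity x b (σ i) := by
  unfold velocity
  congr 1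
  refine Finset.sum_equiv σ (by simp) (fun _ _ => rfl)

/-- An evolution requires distinct positions of charged particles, but no order; this is why it can
be relabeled. Two evolutions are compared after relabeling one of them. -/
theorem relabel (E : Evolution T x b) (σ : Equiv.Perm (Fin n)) :
    Evolution T (fun t i => x t (σ i)) (fun t i => b t (σ i)) where
  cont i := E.cont (σ i)
  deriv_right t ht i := by
    rw [velocity_relabel]
    exact E.deriv_right t ht (σ i)
  charge_right t ht := (E.charge_right t ht).mono fun s hs => by simp [hs]
  charge_left t ht := by
    obtain ⟨β, h1, h2, h3⟩ := E.charge_left t ht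
    refine ⟨fun i => β (σ i), h1.mono fun s hs => by simp [hs], fun i => h2 _, fun y => ?_⟩
    rw [← h3 y]
    exact Finset.sum_equiv σ (by simp) (fun _ _ => rfl)
  inj t ht i j hij := E.inj t ht (σ i) (σ j) (fun h => hij (σ.injective h))

theorem charge_mono (E : Evolution T x b) {s t : ℝ} (hs : 0 ≤ s) (hst : s ≤ t) (ht : t ≤ T) :
    ∀ i, b t i = b s i ∨ b t i = 0 := by
  refine continuous_induction (a := s) (b := T) (P := fun t => ∀ i, b t i = b s i ∨ b t i = 0)
    (fun _ => Or.inl rfl) ?_ ?_ t ⟨hst, ht⟩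
  · intro t ht hP i
    obtain ⟨β, h1, h2, -⟩ := E.charge_left t ⟨hs.trans_lt ht.1, ht.2⟩
    obtain ⟨r, hr, hr'⟩ := (h1.and (Ico_mem_nhdsLT ht.1)).exists
    have := hP r hr' i
    rw [hr] at this
    rcases h2 i with h | h
    · rwa [h]
    · exact Or.inr h
  · intro t ht hP
    filter_upwards [E.charge_right t ⟨hs.trans ht.1, ht.2⟩] with r hr
    rw [hr]
    exact hP t ⟨ht.1, le_rfl⟩

theorem charge_ne_zero (E : Evolution T x b) {s t : ℝ} (hs : 0 ≤ s) (hst : s ≤ t) (ht : t ≤ T)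
    {i : Fin n} (h : b t i ≠ 0) : b s i = b t i := by
  rcases E.charge_mono hs hst ht i with h' | h'
  · exact h'.symm
  · exact absurd h' h

theorem charge_eq_zero (E : Evolution T x b) {s t : ℝ} (hs : 0 ≤ s) (hst : s ≤ t) (ht : t ≤ T)
    {i : Fin n} (h : b s i = 0) : b t i = 0 := by
  rcases E.charge_mono hs hst ht i with h' | h'
  · rw [h', h]
  · exact h'

theorem cont_pi (E : Evolution T x b) : ContinuousOn x (Icc 0 T) :=
  continuousOn_pi.2 E.cont

theorem tendsto_left (E : Evolution T x b) {t : ℝ} (ht : t ∈ Ioc 0 T) (i : Fin n) :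
    Tendsto (fun s => x s i) (𝓝[<] t) (𝓝 (x t i)) := by
  have h := (E.cont i t ⟨ht.1.le, ht.2⟩).tendsto
  refine h.mono_left ?_
  rw [← nhdsWithin_Ioo_eq_nhdsLT ht.1]
  exact nhdsWithin_mono _ fun s hs => ⟨hs.1.le, hs.2.le.trans ht.2⟩

theorem tendsto_right (E : Evolution T x b) {t : ℝ} (ht : t ∈ Ico 0 T) (i : Fin n) :
    Tendsto (fun s => x s i) (𝓝[>] t) (𝓝 (x t i)) :=
  ((E.deriv_right t ht i).continuousWithinAt.mono Ioi_subset_Ici_self)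

end Evolution

end

/-! ### Sums over charged particles -/

theorem coe_mul_self {s : SignType} (hs : s ≠ 0) : (s : ℝ) * (s : ℝ) = 1 := by
  cases s <;> simp_all

theorem coe_mul_of_ne {s t : SignType} (hs : s ≠ 0) (ht : t ≠ 0) (h : t ≠ s) :
    (s : ℝ) * (t : ℝ) = -1 := by
  cases s <;> cases t <;> simp_all

/-- A finite sequence of signs in which no two consecutive ones are equal to `s` contains at most
one more `s` than `-s`. -/
theorem mul_sum_le_one {ι : Type*} [LinearOrder ι] (β : ι → SignType) (A : Finset ι)
    {s : SignType} (hs : s ≠ 0) (hβ : ∀ a ∈ A, β a ≠ 0)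
    (halt : ∀ m ∈ A, ∀ l ∈ A, m < l → (∀ k ∈ A, ¬ (m < k ∧ k < l)) → β m = s → β l ≠ s) :
    (s : ℤ) * ∑ a ∈ A, (β a : ℤ) ≤ 1 := by
  -- The induction on the largest element also has to record that the surplus is gone unless the
  -- last sign is `s`.
  suffices H : (s : ℤ) * ∑ a ∈ A, (β a : ℤ) ≤ 1 ∧
      ((∀ m ∈ A, (∀ l ∈ A, l ≤ m) → β m ≠ s) → (s : ℤ) * ∑ a ∈ A, (β a : ℤ) ≤ 0) from H.1
  induction A using Finset.induction_on_max with
  | empty => simp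
  | insert a t ht ih =>
    have hat : a ∉ t := fun h => lt_irrefl _ (ht a h)
    have hih := ih (fun k hk => hβ k (Finset.mem_insert_of_mem hk)) (fun m hm l hl hml hk =>
      halt m (Finset.mem_insert_of_mem hm) l (Finset.mem_insert_of_mem hl) hml fun k hk' h => by
        rcases Finset.mem_insert.1 hk' with rfl | hk'
        · exact absurd h.2 (not_lt.2 (ht l hl).le)
        · exact hk k hk' h)
    rw [Finset.sum_insert hat, mul_add]
    have ha := hβ a (Finset.mem_insert_self _ _)
    by_cases has : β a = s
    · have h0 := hih.2 fun m hm hmax hms =>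
        halt m (Finset.mem_insert_of_mem hm) a (Finset.mem_insert_self _ _) (ht m hm)
          (fun k hk hk' => by
            rcases Finset.mem_insert.1 hk with rfl | hk
            · exact lt_irrefl _ hk'.2
            · exact absurd hk'.1 (not_lt.2 (hmax k hk))) hms has
      have h1 : (s : ℤ) * (β a : ℤ) = 1 := by
        rw [has]; revert hs; cases s <;> simp
      refine ⟨by linarith, fun h => absurd has (h a (Finset.mem_insert_self _ _) fun l hl => ?_)⟩
      rcases Finset.mem_insert.1 hl with rfl | hl
      · exact le_rfl
      · exact (ht l hl).le
    · have h1 : (s : ℤ) * (β a : ℤ) = -1 := by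
        revert hs ha has; cases s <;> cases β a <;> simp
      exact ⟨by linarith [hih.1], fun _ => by linarith [hih.1]⟩

/-- A sum of signs with decreasing nonnegative weights is largest if all signs agree and the
points are as close as allowed. -/
theorem sum_sign_mul_antitone_le {ι : Type*} [LinearOrder ι] (A : Finset ι) (y : ι → ℝ)
    (β : ι → SignType) {s : SignType} (hs : s ≠ 0) {g : ℝ → ℝ} {D : ℝ} (hD : 0 < D)
    (hg : ∀ u v, 0 < u → u ≤ v → g v ≤ g u) (hg0 : ∀ u, 0 < u → 0 ≤ g u)
    (hβ : ∀ a ∈ A, β a ≠ 0) (hmono : ∀ m ∈ A, ∀ l ∈ A, m < l → y m < y l)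
    (hpos : ∀ m ∈ A, 0 < y m)
    (hfirst : ∀ l ∈ A, (∀ k ∈ A, ¬ k < l) → β l = s → D ≤ y l)
    (hnext : ∀ m ∈ A, ∀ l ∈ A, m < l → (∀ k ∈ A, ¬ (m < k ∧ k < l)) → β m = s → β l = s →
      y m + D ≤ y l) :
    ∑ l ∈ A, ((s : ℝ) * (β l : ℝ)) * g (y l) ≤
      ∑ q ∈ Finset.range A.card, g (((q : ℝ) + 1) * D) := by
  have hgq : ∀ q : ℕ, 0 ≤ g (((q : ℝ) + 1) * D) := fun q => hg0 _ (by positivity)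
  -- `N` counts the terms of sign `s` not yet cancelled. The last point lies beyond `N * D`. If its
  -- sign is not `s`, its negative term leaves a slack `g (y m)` that pays for the next term of sign
  -- `s`; otherwise the next such term lies beyond `(N + 1) * D` and raises `N` by one.
  suffices H : ∃ N ≤ A.card, ∑ l ∈ A, ((s : ℝ) * (β l : ℝ)) * g (y l) ≤
        ∑ q ∈ Finset.range N, g (((q : ℝ) + 1) * D) ∧ (A = ∅ → N = 0) ∧
      ∀ m ∈ A, (∀ l ∈ A, l ≤ m) → N * D ≤ y m ∧
        (β m ≠ s → ∑ l ∈ A, ((s : ℝ) * (β l : ℝ)) * g (y l) + g (y m) ≤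
          ∑ q ∈ Finset.range N, g (((q : ℝ) + 1) * D)) by
    obtain ⟨N, hN, h, -⟩ := H
    exact h.trans (Finset.sum_le_sum_of_subset_of_nonneg (Finset.range_subset_range.2 hN)
      fun q _ _ => hgq q)
  induction A using Finset.induction_on_max with
  | empty => exact ⟨0, by simp⟩
  | insert a t ht ih =>
    have hat : a ∉ t := fun h => lt_irrefl _ (ht a h)
    have hmem : ∀ {k}, k ∈ t → k ∈ insert a t := fun hk => Finset.mem_insert_of_mem hk
    have haA := Finset.mem_insert_self a t
    obtain ⟨N, hN, hsum, hemp, hlast⟩ := ih (fun k hk => hβ k (hmem hk))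
      (fun m hm l hl => hmono m (hmem hm) l (hmem hl)) (fun m hm => hpos m (hmem hm))
      (fun l hl hk => hfirst l (hmem hl) fun k hk' h => by
        rcases Finset.mem_insert.1 hk' with rfl | hk'
        · exact absurd h (not_lt.2 (ht l hl).le)
        · exact hk k hk' h)
      (fun m hm l hl hml hk => hnext m (hmem hm) l (hmem hl) hml fun k hk' h => by
        rcases Finset.mem_insert.1 hk' with rfl | hk'
        · exact absurd h.2 (not_lt.2 (ht l hl).le)
        · exact hk k hk' h)
    have hcard : (insert a t).card = t.card + 1 := Finset.card_insert_of_notMem hat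
    have hya := hpos a haA
    have hNa : N * D ≤ y a := by
      rcases t.eq_empty_or_nonempty with h | h
      · rw [hemp h]; simpa using hya.le
      · have h1 := (hlast (t.max' h) (t.max'_mem h) fun l hl => t.le_max' l hl).1
        exact h1.trans (hmono _ (hmem (t.max'_mem h)) a haA (ht _ (t.max'_mem h))).le
    have hmaxa : ∀ m ∈ insert a t, (∀ l ∈ insert a t, l ≤ m) → m = a := by
      intro m hm hmm
      rcases Finset.mem_insert.1 hm with h | h
      · exact h
      · exact absurd (hmm a haA) (not_le.2 (ht m h))
    simp only [Finset.sum_insert hat]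
    by_cases hβa : β a = s
    · rw [hβa, coe_mul_self hs, one_mul]
      have hcase : (∃ m ∈ t, (∀ l ∈ t, l ≤ m) ∧ β m ≠ s) ∨ ((N : ℝ) + 1) * D ≤ y a := by
        rcases t.eq_empty_or_nonempty with h | h
        · right
          rw [hemp h]
          have := hfirst a haA (fun k hk hka => by
            rw [h] at hk
            simp only [insert_empty_eq, Finset.mem_singleton] at hk
            exact hka.ne hk) hβa
          simpa using this
        · by_cases hm : β (t.max' h) = s
          · right
            have h1 := (hlast (t.max' h) (t.max'_mem h) fun l hl => t.le_max' l hl).1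
            have h2 := hnext _ (hmem (t.max'_mem h)) a haA (ht _ (t.max'_mem h))
              (fun k hk hk' => by
                rcases Finset.mem_insert.1 hk with rfl | hk
                · exact lt_irrefl _ hk'.2
                · exact absurd hk'.1 (not_lt.2 (t.le_max' k hk))) hm hβa
            linarith
          · exact Or.inl ⟨_, t.max'_mem h, fun l hl => t.le_max' l hl, hm⟩
      rcases hcase with ⟨m, hm, hmax, hms⟩ | h
      · have h1 := (hlast m hm hmax).2 hms
        have h2 := hg _ _ (hpos m (hmem hm)) (hmono m (hmem hm) a haA (ht m hm)).le
        refine ⟨N, by omega, by linarith, fun h => absurd h (Finset.insert_ne_empty a t), ?_⟩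
        intro k hk hkm
        rw [hmaxa k hk hkm]
        exact ⟨hNa, fun h => absurd hβa h⟩
      · have h2 := hg _ _ (by positivity) h
        refine ⟨N + 1, by omega, ?_, fun h => absurd h (Finset.insert_ne_empty a t), ?_⟩
        · rw [Finset.sum_range_succ]; linarith
        · intro k hk hkm
          rw [hmaxa k hk hkm]
          exact ⟨by push_cast; exact h, fun h => absurd hβa h⟩
    · rw [coe_mul_of_ne hs (hβ a haA) hβa]
      have h0 := hg0 _ hya
      refine ⟨N, by omega, by linarith, fun h => absurd h (Finset.insert_ne_empty a t), ?_⟩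
      intro k hk hkm
      rw [hmaxa k hk hkm]
      exact ⟨hNa, fun _ => by linarith⟩

theorem sum_sign_mul_antitone_le_rev {ι : Type*} [LinearOrder ι] (A : Finset ι) (y : ι → ℝ)
    (β : ι → SignType) {s : SignType} (hs : s ≠ 0) {g : ℝ → ℝ} {D : ℝ} (hD : 0 < D)
    (hg : ∀ u v, 0 < u → u ≤ v → g v ≤ g u) (hg0 : ∀ u, 0 < u → 0 ≤ g u)
    (hβ : ∀ a ∈ A, β a ≠ 0) (hmono : ∀ m ∈ A, ∀ l ∈ A, l < m → y m < y l)
    (hpos : ∀ m ∈ A, 0 < y m)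
    (hfirst : ∀ l ∈ A, (∀ k ∈ A, ¬ l < k) → β l = s → D ≤ y l)
    (hnext : ∀ m ∈ A, ∀ l ∈ A, l < m → (∀ k ∈ A, ¬ (k < m ∧ l < k)) → β m = s → β l = s →
      y m + D ≤ y l) :
    ∑ l ∈ A, ((s : ℝ) * (β l : ℝ)) * g (y l) ≤
      ∑ q ∈ Finset.range A.card, g (((q : ℝ) + 1) * D) :=
  sum_sign_mul_antitone_le (ι := ιᵒᵈ) A y β hs hD hg hg0 hβ hmono hpos hfirst hnext

section

variable {n : ℕ} {x : Fin n → ℝ} {b : Fin n → SignType}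

theorem lt_of_mem_stateSpace (h : (x, b) ∈ stateSpace n) {i j : Fin n} (hij : i < j)
    (hi : b i ≠ 0) (hj : b j ≠ 0) : x i < x j :=
  h j i hij (mul_ne_zero hj hi)

theorem ne_of_mem_stateSpace (h : (x, b) ∈ stateSpace n) {i j : Fin n} (hij : i ≠ j)
    (hi : b i ≠ 0) (hj : b j ≠ 0) : x i ≠ x j := by
  rcases lt_or_gt_of_ne hij with h' | h'
  · exact (lt_of_mem_stateSpace h h' hi hj).ne
  · exact (lt_of_mem_stateSpace h h' hj hi).ne'

/-- Consecutive particles of the charge `s` have distance at least `D`. -/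
def Separated (x : Fin n → ℝ) (b : Fin n → SignType) (s : SignType) (D : ℝ) : Prop :=
  ∀ i j, Neighbors b i j → b i = s → b j = s → D ≤ x j - x i

/-- If the nearest charged particle has sign `s`, its distance to `k` is controlled by separation
only when `k` has the sign `s` too. For the other sign this first gap must be assumed, hence the
alternative in `hfirst`. -/
theorem sum_right_le (h : (x, b) ∈ stateSpace n) {k : Fin n} (hk : b k ≠ 0) {s : SignType}
    (hs : s ≠ 0) {D : ℝ} (hD : 0 < D) (hsep : Separated x b s D)
    (hfirst : s = b k ∨ ∀ l, k < l → b l ≠ 0 → D ≤ x l - x k) {g : ℝ → ℝ}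
    (hg : ∀ u v, 0 < u → u ≤ v → g v ≤ g u) (hg0 : ∀ u, 0 < u → 0 ≤ g u) :
    ∑ l with k < l ∧ b l ≠ 0, ((s : ℝ) * (b l : ℝ)) * g (x l - x k) ≤
      ∑ q ∈ Finset.range (n - 1 - k), g (((q : ℝ) + 1) * D) := by
  refine (sum_sign_mul_antitone_le (Finset.univ.filter fun l => k < l ∧ b l ≠ 0)
    (fun l => x l - x k) b hs hD hg hg0 ?_ ?_ ?_ ?_ ?_).trans ?_
  · intro a ha
    exact (Finset.mem_filter.1 ha).2.2
  · intro m hm l hl hml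
    have := lt_of_mem_stateSpace h hml (Finset.mem_filter.1 hm).2.2 (Finset.mem_filter.1 hl).2.2
    simpa using this
  · intro m hm
    have hm := (Finset.mem_filter.1 hm).2
    exact sub_pos.2 (lt_of_mem_stateSpace h hm.1 hk hm.2)
  · intro l hl hl' hls
    have hm := (Finset.mem_filter.1 hl).2
    rcases hfirst with h1 | h1
    · refine hsep k l ⟨hm.1, hk, hm.2, fun r hkr hrl => ?_⟩ h1.symm hls
      by_contra hr
      exact hl' r (by simp [hkr, hr]) hrl
    · exact h1 l hm.1 hm.2
  · intro m hm l hl hml hno hms hls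
    have hm := (Finset.mem_filter.1 hm).2
    have hl := (Finset.mem_filter.1 hl).2
    have := hsep m l ⟨hml, hm.2, hl.2, fun r hmr hrl => by
      by_contra hr
      exact hno r (by simp [hm.1.trans hmr, hr]) ⟨hmr, hrl⟩⟩ hms hls
    linarith
  · refine Finset.sum_le_sum_of_subset_of_nonneg (Finset.range_subset_range.2 ?_)
      fun q _ _ => hg0 _ (by positivity)
    calc (Finset.univ.filter fun l => k < l ∧ b l ≠ 0).card ≤ (Finset.Ioi k).card :=
        Finset.card_le_card fun l hl => by simpa using (Finset.mem_filter.1 hl).2.1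
      _ = n - 1 - k := by simp

theorem sum_left_le (h : (x, b) ∈ stateSpace n) {k : Fin n} (hk : b k ≠ 0) {s : SignType}
    (hs : s ≠ 0) {D : ℝ} (hD : 0 < D) (hsep : Separated x b s D)
    (hfirst : s = b k ∨ ∀ l, l < k → b l ≠ 0 → D ≤ x k - x l) {g : ℝ → ℝ}
    (hg : ∀ u v, 0 < u → u ≤ v → g v ≤ g u) (hg0 : ∀ u, 0 < u → 0 ≤ g u) :
    ∑ l with l < k ∧ b l ≠ 0, ((s : ℝ) * (b l : ℝ)) * g (x k - x l) ≤
      ∑ q ∈ Finset.range k, g (((q : ℝ) + 1) * D) := by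
  refine (sum_sign_mul_antitone_le_rev (Finset.univ.filter fun l => l < k ∧ b l ≠ 0)
    (fun l => x k - x l) b hs hD hg hg0 ?_ ?_ ?_ ?_ ?_).trans ?_
  · intro a ha
    exact (Finset.mem_filter.1 ha).2.2
  · intro m hm l hl hml
    have := lt_of_mem_stateSpace h hml (Finset.mem_filter.1 hl).2.2
      (Finset.mem_filter.1 hm).2.2
    simpa using this
  · intro m hm
    have hm := (Finset.mem_filter.1 hm).2
    exact sub_pos.2 (lt_of_mem_stateSpace h hm.1 hm.2 hk)
  · intro l hl hl' hls
    have hm := (Finset.mem_filter.1 hl).2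
    rcases hfirst with h1 | h1
    · refine hsep l k ⟨hm.1, hm.2, hk, fun r hkr hrl => ?_⟩ hls h1.symm
      by_contra hr
      exact hl' r (by simp [hrl, hr]) hkr
    · exact h1 l hm.1 hm.2
  · intro m hm l hl hml hno hms hls
    have hm := (Finset.mem_filter.1 hm).2
    have hl := (Finset.mem_filter.1 hl).2
    have := hsep l m ⟨hml, hl.2, hm.2, fun r hmr hrl => by
      by_contra hr
      exact hno r (by simp [hrl.trans hm.1, hr])
        ⟨hrl, hmr⟩⟩ hls hms
    linarith
  · refine Finset.sum_le_sum_of_subset_of_nonneg (Finset.range_subset_range.2 ?_)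
      fun q _ _ => hg0 _ (by positivity)
    calc (Finset.univ.filter fun l : Fin n => l < k ∧ b l ≠ 0).card ≤ (Finset.Iio k).card :=
        Finset.card_le_card fun l hl => Finset.mem_Iio.2 (Finset.mem_filter.1 hl).2.1
      _ = k := by simp

theorem velocity_eq_sum (x : Fin n → ℝ) (b : Fin n → SignType) (i : Fin n) :
    velocity x b i = (1 / (n : ℝ)) * ∑ j, ((b i : ℝ) * (b j : ℝ)) / (x i - x j) := by
  rw [velocity, Finset.sum_erase]
  simp

/-! ### Velocity estimates under separation -/

theorem sum_range_telescope (d : ℝ) (N : ℕ) :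
    ∑ q ∈ Finset.range N, (1 / (((q : ℝ) + 1) * d) - 1 / (((q : ℝ) + 1) * d + d)) =
      1 / d - 1 / (((N : ℝ) + 1) * d) := by
  induction N with
  | zero => simp
  | succ N ih =>
    rw [Finset.sum_range_succ, ih]
    push_cast
    have : ((N : ℝ) + 1) * d + d = ((N : ℝ) + 1 + 1) * d := by ring
    rw [this]
    ring

/-- The right side is smallest when `p + q = n` and `p`, `q` are as equal as possible. Later `p` and
`q` count the particles on either side of a gap, including its endpoints. -/
theorem separationRate_le {n p q : ℕ} (hp : 1 ≤ p) (hq : 1 ≤ q) (h : p + q ≤ n) :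
    n / 2 * separationRate n ≤ 1 / (p : ℝ) + 1 / q := by
  have hp' : (1 : ℝ) ≤ p := by exact_mod_cast hp
  have hq' : (1 : ℝ) ≤ q := by exact_mod_cast hq
  have hn : ((p : ℝ) + q) ≤ n := by exact_mod_cast h
  have key : (p : ℝ) * q * 4 ≤ (p + q) ^ 2 := by nlinarith [sq_nonneg ((p : ℝ) - q)]
  have hsum : 1 / (p : ℝ) + 1 / q = (p + q) / (p * q) := by field_simp; ring
  rw [hsum, separationRate, le_div_iff₀ (by positivity)]
  split_ifs with hodd
  · have hn3 : (3 : ℝ) ≤ n := by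
      have : 3 ≤ n := by rcases hodd with ⟨k, rfl⟩; omega
      exact_mod_cast this
    have hpos : (0 : ℝ) < (n : ℝ) ^ 2 - 1 := by nlinarith
    rw [show (n : ℝ) / 2 * (8 / ((n : ℝ) ^ 2 - 1)) * (p * q) =
      (4 * n * (p * q)) / ((n : ℝ) ^ 2 - 1) by ring, div_le_iff₀ hpos]
    rcases h.eq_or_lt with he | hlt
    -- An odd sum excludes `p = q`, so `4 * p * q = n ^ 2 - (p - q) ^ 2 ≤ n ^ 2 - 1`.
    · have hne : (1 : ℝ) ≤ (p - q) ^ 2 := by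
        have hpq : (p : ℤ) - q ≠ 0 := by
          intro h0
          have : p = q := by omega
          subst this
          exact (Nat.not_even_iff_odd.2 hodd) ⟨p, he.symm⟩
        have : (1 : ℤ) ≤ ((p : ℤ) - q) ^ 2 := by
          have := Int.one_le_abs hpq
          nlinarith [sq_abs ((p : ℤ) - q)]
        exact_mod_cast this
      have he' : (n : ℝ) = p + q := by rw [← he]; push_cast; ring
      rw [he']
      nlinarith
    · have h1 : ((p : ℝ) + q) + 1 ≤ n := by exact_mod_cast hlt
      have h2 : ((p : ℝ) + q) * n ≤ n ^ 2 - 1 := by nlinarith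
      have h3 : 4 * (n : ℝ) * (p * q) ≤ n * (p + q) ^ 2 := by nlinarith
      nlinarith
  · have hpos : (0 : ℝ) < n := by linarith
    rw [show (n : ℝ) / 2 * (8 / ((n : ℝ) ^ 2)) * (p * q) = (4 * (p * q)) / n by
        field_simp; norm_num,
      div_le_iff₀ hpos]
    nlinarith

/-- The closest neighbors of equal sign repel each other. -/
theorem separationRate_le_velocity_sub (h : (x, b) ∈ stateSpace n) {i j : Fin n}
    (hij : Neighbors b i j) (hb : b i = b j) (hsep : Separated x b (b i) (x j - x i)) :
    separationRate n / 2 ≤ (x j - x i) * (velocity x b j - velocity x b i) := by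
  obtain ⟨hlt, hi, hj, hbet⟩ := hij
  set d := x j - x i
  have hdpos : 0 < d := sub_pos.2 (lt_of_mem_stateSpace h hlt hi hj)
  -- Up to the factor `1 / n`, `g y` is what a charge of the sign of the pair, at distance `y`
  -- outside of it, takes from the growth of the gap.
  set g : ℝ → ℝ := fun y => 1 / y - 1 / (y + d) with hgdef
  have hg : ∀ u v, 0 < u → u ≤ v → g v ≤ g u := by
    intro u v hu huv
    have e : ∀ y, 0 < y → g y = d / (y * (y + d)) := fun y hy => by
      simp only [hgdef]; field_simp; ring
    have := hu.le.trans huv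
    rw [e u hu, e v (hu.trans_le huv)]
    gcongr
  have hg0 : ∀ u, 0 < u → 0 ≤ g u := by
    intro u hu
    exact sub_nonneg.2 (one_div_le_one_div_of_le hu (by linarith))
  have hR := sum_right_le h hj hi hdpos hsep (Or.inl hb) hg hg0
  have hL := sum_left_le h hi hi hdpos hsep (Or.inl rfl) hg hg0
  -- The mutual repulsion of the pair contributes `1 / d` twice, and each side takes away at most `1
  -- / d - 1 / ((N + 1) * d)`, so a positive growth remains.
  rw [sum_range_telescope] at hR hL
  have hterm : ∀ l, ((b j : ℝ) * (b l : ℝ)) / (x j - x l) - ((b i : ℝ) * (b l : ℝ)) / (x i - x l) =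
      (if l = i then 1 / d else 0) + (if l = j then 1 / d else 0)
      - (if j < l ∧ b l ≠ 0 then ((b i : ℝ) * (b l : ℝ)) * g (x l - x j) else 0)
      - (if l < i ∧ b l ≠ 0 then ((b i : ℝ) * (b l : ℝ)) * g (x i - x l) else 0) := by
    intro l
    rw [← hb]
    by_cases hl : b l = 0
    · have h1 : l ≠ i := fun h => hi (h ▸ hl)
      have h2 : l ≠ j := fun h => hj (h ▸ hl)
      simp [hl, h1, h2]
    rcases lt_trichotomy l i with h1 | rfl | h1
    · have h3 : l ≠ j := (h1.trans hlt).ne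
      have h4 : ¬ j < l := (h1.trans hlt).not_gt
      have h5 := lt_of_mem_stateSpace h h1 hl hi
      have h6 := lt_of_mem_stateSpace h (h1.trans hlt) hl hj
      simp only [h1.ne, h3, h4, h1, hgdef, d]
      rw [show x i - x l + (x j - x i) = x j - x l by ring]
      simp [hl]
      ring
    · have h3 : l ≠ j := hlt.ne
      have h4 : ¬ j < l := hlt.not_gt
      simp [h3, h4, coe_mul_self hi, d]
    · have h0 : l ≠ i := h1.ne'
      have h00 : ¬ l < i := h1.not_gt
      rcases lt_trichotomy l j with h2 | rfl | h2
      · exact absurd (hbet l h1 h2) hl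
      · rw [← hb]
        simp [h0, h00, coe_mul_self hi, d]
        rw [← neg_sub (x l) (x i), inv_neg]
        simp
      · have h5 := lt_of_mem_stateSpace h h2 hj hl
        simp only [h2.ne', h0, h00, h2, hgdef, d]
        rw [show x l - x j + (x j - x i) = x l - x i by ring, ← neg_sub (x l) (x j),
          ← neg_sub (x l) (x i)]
        simp only [div_neg]
        simp [hl]
        ring
  have hn : (0 : ℝ) < n := by
    have := i.pos; exact_mod_cast this
  have hv : velocity x b j - velocity x b i = (1 / (n : ℝ)) * (1 / d + 1 / d
      - ∑ l with j < l ∧ b l ≠ 0, ((b i : ℝ) * (b l : ℝ)) * g (x l - x j)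
      - ∑ l with l < i ∧ b l ≠ 0, ((b i : ℝ) * (b l : ℝ)) * g (x i - x l)) := by
    rw [velocity_eq_sum, velocity_eq_sum, ← mul_sub, ← Finset.sum_sub_distrib]
    congr 1
    rw [Finset.sum_congr rfl fun l _ => hterm l]
    simp only [Finset.sum_sub_distrib, Finset.sum_add_distrib, Finset.sum_ite_eq',
      Finset.mem_univ, if_true, Finset.sum_filter]
  have hp : (1 : ℕ) ≤ (n - 1 - j) + 1 := by omega
  have hq : (1 : ℕ) ≤ (i : ℕ) + 1 := by omega
  have hrate := separationRate_le (n := n) hp hq (by have := j.2; have : (i : ℕ) < j := hlt; omega)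
  rw [hv]
  have h1 : d * ((1 / (n : ℝ)) * (1 / (((n - 1 - (j : ℕ) : ℕ) + 1 : ℝ) * d) +
      1 / (((i : ℕ) + 1 : ℝ) * d))) =
      (1 / n) * (1 / (((n - 1 - (j : ℕ) + 1 : ℕ)) : ℝ) + 1 / (((i : ℕ) + 1 : ℕ) : ℝ)) := by
    push_cast
    field_simp
  calc separationRate n / 2 = (1 / n) * (n / 2 * separationRate n) := by field_simp
    _ ≤ _ := by gcongr
    _ = _ := h1.symm
    _ ≤ _ := by
      gcongr
      linarith

/-- The sum is harmonic. Strictness comes from `N < n` and is needed for the strict velocity bounds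
used in the barrier argument. -/
theorem sum_range_inv_lt {n N : ℕ} (hN : N < n) {D : ℝ} (hD : 0 < D) :
    ∑ q ∈ Finset.range N, 1 / (((q : ℝ) + 1) * D) < (Real.log n + 1) / D := by
  have h1 : ∑ q ∈ Finset.range N, 1 / (((q : ℝ) + 1) * D) = (harmonic N : ℝ) / D := by
    simp only [harmonic, Rat.cast_sum, Finset.sum_div]
    refine Finset.sum_congr rfl fun q _ => ?_
    push_cast
    field_simp
  rw [h1]
  gcongr
  have h2 := harmonic_le_one_add_log N
  rcases Nat.eq_zero_or_pos N with h0 | h0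
  · subst h0
    simp only [harmonic_zero, Rat.cast_zero]
    have : 0 ≤ Real.log n := Real.log_natCast_nonneg n
    linarith
  · have : Real.log N < Real.log n := Real.log_lt_log (by exact_mod_cast h0) (by exact_mod_cast hN)
    linarith

theorem velocity_eq_left_sub_right (x : Fin n → ℝ) (b : Fin n → SignType) (k : Fin n) :
    velocity x b k = (1 / (n : ℝ)) *
      (∑ l with l < k ∧ b l ≠ 0, ((b k : ℝ) * (b l : ℝ)) * (1 / (x k - x l))
      - ∑ l with k < l ∧ b l ≠ 0, ((b k : ℝ) * (b l : ℝ)) * (1 / (x l - x k))) := by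
  rw [velocity_eq_sum, Finset.sum_filter, Finset.sum_filter, ← Finset.sum_sub_distrib]
  congr 1
  refine Finset.sum_congr rfl fun l _ => ?_
  by_cases hl : b l = 0
  · simp [hl]
  rcases lt_trichotomy l k with h1 | rfl | h1
  · simp [h1, h1.not_gt, hl]
    ring
  · simp
  · simp only [h1, h1.not_gt]
    rw [← neg_sub (x l) (x k), div_neg]
    simp [hl]
    ring

/-- A particle which has no charged particle to its right within distance `D` does not move to the
right too fast. -/
theorem velocity_lt (h : (x, b) ∈ stateSpace n) {k : Fin n} (hk : b k ≠ 0) {D : ℝ} (hD : 0 < D)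
    (hsep : ∀ s : SignType, s ≠ 0 → Separated x b s D)
    (hfirst : ∀ l, k < l → b l ≠ 0 → D ≤ x l - x k) :
    velocity x b k < 2 * ((Real.log n + 1) / n) / D := by
  have hg : ∀ u v : ℝ, 0 < u → u ≤ v → 1 / v ≤ 1 / u := fun u v hu huv =>
    one_div_le_one_div_of_le hu huv
  have hg0 : ∀ u : ℝ, 0 < u → 0 ≤ 1 / u := fun u hu => by positivity
  have hk' : -b k ≠ 0 := by simpa using hk
  -- To the right of `k` only charges of the opposite sign pull it to the right; to its left only
  -- charges of its own sign push it there.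
  have hR := sum_right_le h hk hk' hD (hsep _ hk') (Or.inr hfirst) hg hg0
  have hL := sum_left_le h hk hk hD (hsep _ hk) (Or.inl rfl) hg hg0
  have hR' := sum_range_inv_lt (n := n) (N := n - 1 - k) (by have := k.2; omega) hD
  have hL' := sum_range_inv_lt (n := n) (N := k) k.2 hD
  have hn : (0 : ℝ) < n := by
    have := k.pos; exact_mod_cast this
  rw [velocity_eq_left_sub_right]
  simp only [SignType.coe_neg, neg_mul, Finset.sum_neg_distrib] at hR
  calc _ < (1 / (n : ℝ)) * ((Real.log n + 1) / D + (Real.log n + 1) / D) := by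
        gcongr
        linarith
    _ = _ := by ring

theorem lt_velocity (h : (x, b) ∈ stateSpace n) {k : Fin n} (hk : b k ≠ 0) {D : ℝ} (hD : 0 < D)
    (hsep : ∀ s : SignType, s ≠ 0 → Separated x b s D)
    (hfirst : ∀ l, l < k → b l ≠ 0 → D ≤ x k - x l) :
    -(2 * ((Real.log n + 1) / n) / D) < velocity x b k := by
  have hg : ∀ u v : ℝ, 0 < u → u ≤ v → 1 / v ≤ 1 / u := fun u v hu huv =>
    one_div_le_one_div_of_le hu huv
  have hg0 : ∀ u : ℝ, 0 < u → 0 ≤ 1 / u := fun u hu => by positivity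
  have hk' : -b k ≠ 0 := by simpa using hk
  have hR := sum_right_le h hk hk hD (hsep _ hk) (Or.inl rfl) hg hg0
  have hL := sum_left_le h hk hk' hD (hsep _ hk') (Or.inr hfirst) hg hg0
  have hR' := sum_range_inv_lt (n := n) (N := n - 1 - k) (by have := k.2; omega) hD
  have hL' := sum_range_inv_lt (n := n) (N := k) k.2 hD
  have hn : (0 : ℝ) < n := by
    have := k.pos; exact_mod_cast this
  rw [velocity_eq_left_sub_right, neg_lt]
  simp only [SignType.coe_neg, neg_mul, Finset.sum_neg_distrib] at hL
  calc _ = (1 / (n : ℝ)) * (-∑ l with l < k ∧ b l ≠ 0, ((b k : ℝ) * (b l : ℝ)) * (1 / (x k - x l))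
      + ∑ l with k < l ∧ b l ≠ 0, ((b k : ℝ) * (b l : ℝ)) * (1 / (x l - x k))) := by ring
    _ < (1 / (n : ℝ)) * ((Real.log n + 1) / D + (Real.log n + 1) / D) := by
        have := add_lt_add (hL.trans_lt hL') (hR.trans_lt hR')
        exact mul_lt_mul_of_pos_left this (by positivity)
    _ = _ := by ring

end

/-! ### Separation of neighbors -/

section

variable {n : ℕ}

/-- Annihilation does not create close neighbors of equal sign. -/
theorem Separated.of_annihilation {x : Fin n → ℝ} {c β : Fin n → SignType} {s : SignType} {D : ℝ}
    (hD : Separated x β s D) (hs : s ≠ 0)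
    (hsum : ∀ y, ∑ i with x i = y, ((c i : ℤ) - (β i : ℤ)) = 0)
    (hmono : ∀ m l, m < l → β m ≠ 0 → β l ≠ 0 → x m ≤ x l) (hst : (x, c) ∈ stateSpace n) :
    Separated x c s D := by
  intro i j hij hi hj
  by_contra! hlt
  obtain ⟨hltij, hi0, hj0, hbet⟩ := hij
  have hxij := lt_of_mem_stateSpace hst hltij hi0 hj0
  -- After the annihilation only `i` and `j` are charged in the closed interval between them, so the
  -- net charge there is `2 * s`. It was the same before, when no two consecutive particles in this
  -- interval of length less than `D` both had the sign `s`; this allows a surplus of one only.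
  set A : Finset (Fin n) := Finset.univ.filter fun k => x i ≤ x k ∧ x k ≤ x j with hA
  have hAm : ∀ k, k ∈ A ↔ x i ≤ x k ∧ x k ≤ x j := fun k => by simp [hA]
  have h1 := sum_saturated hsum A fun k hk l hl => by rw [hAm] at *; rwa [hl]
  rw [Finset.sum_sub_distrib, sub_eq_zero] at h1
  have h2 : ∑ k ∈ A, (c k : ℤ) = 2 * (s : ℤ) := by
    rw [← Finset.sum_subset (s₁ := {i, j}), Finset.sum_pair hltij.ne, hi, hj, two_mul]
    · intro k hk
      rw [hAm]
      rcases Finset.mem_insert.1 hk with rfl | hk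
      · exact ⟨le_rfl, hxij.le⟩
      · rw [Finset.mem_singleton.1 hk]; exact ⟨hxij.le, le_rfl⟩
    · intro k hk hk'
      rw [hAm] at hk
      simp only [Finset.mem_insert, Finset.mem_singleton, not_or] at hk'
      by_contra hck
      rw [coe_int_eq_zero] at hck
      rcases lt_or_gt_of_ne hk'.1 with h | h
      · exact absurd hk.1 (not_le.2 (lt_of_mem_stateSpace hst h hck hi0))
      · rcases lt_or_gt_of_ne hk'.2 with h' | h'
        · exact hck (hbet k h h')
        · exact absurd hk.2 (not_le.2 (lt_of_mem_stateSpace hst h' hj0 hck))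
  have h3 : ∑ k ∈ A with β k ≠ 0, (β k : ℤ) = ∑ k ∈ A, (β k : ℤ) := by
    rw [Finset.sum_filter]
    refine Finset.sum_congr rfl fun k _ => ?_
    by_cases h : β k = 0 <;> simp [h]
  have h4 := mul_sum_le_one β (A.filter fun k => β k ≠ 0) hs
    (fun a ha => (Finset.mem_filter.1 ha).2) (fun m hm l hl hml hno hms hls => by
      obtain ⟨hm, hm0⟩ := Finset.mem_filter.1 hm
      obtain ⟨hl, hl0⟩ := Finset.mem_filter.1 hl
      rw [hAm] at hm hl
      have := hD m l ⟨hml, hm0, hl0, fun k hmk hkl => by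
        by_contra hk
        refine hno k (Finset.mem_filter.2 ⟨(hAm k).2 ⟨?_, ?_⟩, hk⟩) ⟨hmk, hkl⟩
        · exact hm.1.trans (hmono m k hmk hm0 hk)
        · exact (hmono k l hkl hk hl0).trans hl.2⟩ hms hls
      linarith [hm.1, hl.2])
  rw [h3, ← h1, h2] at h4
  revert hs h4
  cases s <;> simp

variable {T : ℝ} {x : ℝ → Fin n → ℝ} {b : ℝ → Fin n → SignType}

namespace Evolution

/-- The order of the particles that are charged before time `t` persists weakly at time `t`. -/
theorem le_of_left (E : Evolution T x b) (hord : ∀ t ∈ Icc 0 T, (x t, b t) ∈ stateSpace n)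
    {t : ℝ} (ht : t ∈ Ioc 0 T) {β : Fin n → SignType} (hβ : ∀ᶠ s in 𝓝[<] t, b s = β)
    {m l : Fin n} (hml : m < l) (hm : β m ≠ 0) (hl : β l ≠ 0) : x t m ≤ x t l := by
  refine le_of_tendsto_of_tendsto (E.tendsto_left ht m) (E.tendsto_left ht l) ?_
  filter_upwards [hβ, Ioo_mem_nhdsLT ht.1] with s hs hs'
  have := hord s ⟨hs'.1.le, hs'.2.le.trans ht.2⟩
  rw [hs] at this
  exact (lt_of_mem_stateSpace this hml hm hl).le

/-- The squared distance between neighbors of equal sign grows at least linearly. -/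
theorem separated (E : Evolution T x b) (hord : ∀ t ∈ Icc 0 T, (x t, b t) ∈ stateSpace n)
    {t₀ : ℝ} (ht₀ : 0 ≤ t₀) {s : SignType} (hs : s ≠ 0) {d : ℝ} (hd : 0 ≤ d)
    (h : Separated (x t₀) (b t₀) s d) :
    ∀ t ∈ Icc t₀ T, Separated (x t) (b t) s (√(d ^ 2 + separationRate n * (t - t₀))) := by
  -- A rate strictly below the optimal one makes the barrier strict; the claim follows as `γ` tends
  -- to `separationRate n`.
  have key : ∀ γ < separationRate n, ∀ t ∈ Icc t₀ T,
      Separated (x t) (b t) s (√(d ^ 2 + γ * (t - t₀))) := by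
    intro γ hγ
    refine continuous_induction ?_ ?_ ?_
    · simpa [Real.sqrt_sq hd] using h
    · intro t ht hP
      have ht' : t ∈ Ioc 0 T := ⟨ht₀.trans_lt ht.1, ht.2⟩
      obtain ⟨β, h1, h2, h3⟩ := E.charge_left t ht'
      refine Separated.of_annihilation (β := β) ?_ hs h3 (fun m l hml hm hl =>
        E.le_of_left hord ht' h1 hml hm hl) (hord t ⟨ht'.1.le, ht.2⟩)
      intro i j hij hi hj
      refine le_of_tendsto_of_tendsto (f := fun r => √(d ^ 2 + γ * (r - t₀))) (b := 𝓝[<] t) ?_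
        ((E.tendsto_left ht' j).sub (E.tendsto_left ht' i)) ?_
      · exact ((by fun_prop : Continuous fun r => √(d ^ 2 + γ * (r - t₀))).tendsto t).mono_left
          nhdsWithin_le_nhds
      · filter_upwards [h1, Ico_mem_nhdsLT ht.1] with r hr hr'
        have := hP r hr'
        rw [hr] at this
        exact this i j hij hi hj
    · intro t ht hP
      have ht' : t ∈ Ico 0 T := ⟨ht₀.trans ht.1, ht.2⟩
      have hst := hord t ⟨ht'.1, ht'.2.le⟩
      have hPt := hP t ⟨ht.1, le_rfl⟩
      have hpair : ∀ i j, Neighbors (b t) i j ∧ b t i = s ∧ b t j = s → ∀ᶠ r in 𝓝[>] t,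
          0 ≤ (x r j - x r i) ^ 2 - (d ^ 2 + γ * (r - t₀)) := by
        rintro i j ⟨hij, hi, hj⟩
        have hle := hPt i j hij hi hj
        have hdiff : HasDerivWithinAt (fun r => (x r j - x r i) ^ 2 - (d ^ 2 + γ * (r - t₀)))
            (2 * ((x t j - x t i) * (velocity (x t) (b t) j - velocity (x t) (b t) i)) - γ)
            (Ici t) t := by
          have h1 := ((E.deriv_right t ht' j).sub (E.deriv_right t ht' i)).pow 2
          have h2 := ((((hasDerivAt_id t).sub_const t₀).const_mul γ).const_add
            (d ^ 2)).hasDerivWithinAt (s := Ici t)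
          exact (h1.sub h2).congr_deriv (by norm_num; ring)
        refine eventually_nonneg_right hdiff ?_ fun h0 => ?_
        · have := (Real.sqrt_le_iff.1 hle).2
          linarith
        · have hx := lt_of_mem_stateSpace hst hij.1 hij.2.1 hij.2.2.1
          have : √(d ^ 2 + γ * (t - t₀)) = x t j - x t i := by
            rw [← sub_eq_zero.1 h0, Real.sqrt_sq (by linarith)]
          -- Where the barrier is touched, `i` and `j` are a closest pair of their sign, so the
          -- repulsion estimate applies to them.
          rw [this] at hPt
          have := separationRate_le_velocity_sub hst hij (hi.trans hj.symm) (hi ▸ hPt)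
          linarith
      have hall : ∀ᶠ r in 𝓝[>] t, ∀ i j, Neighbors (b t) i j ∧ b t i = s ∧ b t j = s →
          0 ≤ (x r j - x r i) ^ 2 - (d ^ 2 + γ * (r - t₀)) := by
        simp only [eventually_all]
        exact hpair
      filter_upwards [hall, E.charge_right t ht', Ioo_mem_nhdsGT ht.2] with r hr hbr hrT
      have hstr := hord r ⟨ht'.1.trans hrT.1.le, hrT.2.le⟩
      intro i j hij hi hj
      have := lt_of_mem_stateSpace hstr hij.1 hij.2.1 hij.2.2.1
      rw [hbr] at hij hi hj
      exact Real.sqrt_le_iff.2 ⟨by linarith, by linarith [hr i j ⟨hij, hi, hj⟩]⟩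
  intro t ht i j hij hi hj
  refine le_of_tendsto (f := fun γ => √(d ^ 2 + γ * (t - t₀)))
    (x := 𝓝[<] (separationRate n)) ?_ ?_
  · exact ((by fun_prop : Continuous fun γ => √(d ^ 2 + γ * (t - t₀))).tendsto _).mono_left
      nhdsWithin_le_nhds
  · filter_upwards [self_mem_nhdsWithin] with γ hγ
    exact key γ hγ t ht i j hij hi hj

theorem separationRate_nonneg (n : ℕ) : 0 ≤ separationRate n := by
  unfold separationRate
  split_ifs with h
  · have : (1 : ℝ) ≤ n := by exact_mod_cast h.pos
    exact div_nonneg (by norm_num) (by nlinarith)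
  · positivity

theorem separated_mono (E : Evolution T x b) (hord : ∀ t ∈ Icc 0 T, (x t, b t) ∈ stateSpace n)
    {t₀ : ℝ} (ht₀ : 0 ≤ t₀) {s : SignType} (hs : s ≠ 0) {d : ℝ} (hd : 0 ≤ d)
    (h : Separated (x t₀) (b t₀) s d) {t : ℝ} (ht : t ∈ Icc t₀ T) :
    Separated (x t) (b t) s d := by
  intro i j hij hi hj
  refine le_trans (Real.le_sqrt_of_sq_le ?_) (E.separated hord ht₀ hs hd h t ht i j hij hi hj)
  have := mul_nonneg (separationRate_nonneg n) (sub_nonneg.2 ht.1)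
  linarith

/-- Charged particles on both sides of a gap do not approach each other too fast. -/
theorem sqrt_le_gap (E : Evolution T x b) (hord : ∀ t ∈ Icc 0 T, (x t, b t) ∈ stateSpace n)
    {t₀ : ℝ} (ht₀ : 0 ≤ t₀) {i j : Fin n} (hij : Neighbors (b t₀) i j) {c : ℝ} (hc : 0 < c)
    (hsep : ∀ s : SignType, s ≠ 0 → Separated (x t₀) (b t₀) s c) (hcij : c ≤ x t₀ j - x t₀ i)
    {t : ℝ} (ht : t ∈ Icc t₀ T) (hpos : 0 ≤ c ^ 2 - 8 * ((Real.log n + 1) / n) * (t - t₀)) :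
    √(c ^ 2 - 8 * ((Real.log n + 1) / n) * (t - t₀)) ≤ x t j - x t i := by
  have hn : (0 : ℝ) < n := by
    have := i.pos; exact_mod_cast this
  have hκ : 0 < (Real.log n + 1) / n := by
    have : 0 ≤ Real.log n := Real.log_natCast_nonneg n
    positivity
  set κ := (Real.log n + 1) / n with hκdef
  set φ : ℝ → ℝ := fun t => c ^ 2 - 8 * κ * (t - t₀) with hφ
  have hφc : Continuous φ := by fun_prop
  have hφanti : ∀ r r', r ≤ r' → φ r' ≤ φ r := fun r r' h => by simp only [hφ]; nlinarith
  -- The bound is proved for all pairs on opposite sides of the gap that were charged at `t₀`. It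
  -- then survives the annihilation of `i` or `j`, and it controls the first charge that each
  -- endpoint sees across the gap.
  have key : ∀ t₁ ≤ T, 0 < φ t₁ → ∀ t ∈ Icc t₀ t₁, ∀ k l, k ≤ i → j ≤ l → b t₀ k ≠ 0 →
      b t₀ l ≠ 0 → √(φ t) ≤ x t l - x t k := by
    intro t₁ ht₁ hφ₁
    refine continuous_induction ?_ ?_ ?_
    · intro k l hk hl hk0 hl0
      simp only [hφ, sub_self, mul_zero, sub_zero, Real.sqrt_sq hc.le]
      by_cases hT : t₀ ≤ T
      · have hst := hord t₀ ⟨ht₀, hT⟩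
        have h1 : x t₀ k ≤ x t₀ i := by
          rcases hk.eq_or_lt with rfl | h
          · exact le_rfl
          · exact (lt_of_mem_stateSpace hst h hk0 hij.2.1).le
        have h2 : x t₀ j ≤ x t₀ l := by
          rcases hl.eq_or_lt with rfl | h
          · exact le_rfl
          · exact (lt_of_mem_stateSpace hst h hij.2.2.1 hl0).le
        linarith
      · exact absurd (ht.1.trans ht.2) hT
    · intro t ht hP k l hk hl hk0 hl0
      have ht' : t ∈ Ioc 0 T := ⟨ht₀.trans_lt ht.1, ht.2.trans ht₁⟩
      refine le_of_tendsto_of_tendsto (f := fun r => √(φ r)) (b := 𝓝[<] t) ?_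
        ((E.tendsto_left ht' l).sub (E.tendsto_left ht' k)) ?_
      · exact ((Real.continuous_sqrt.comp hφc).tendsto t).mono_left nhdsWithin_le_nhds
      · filter_upwards [Ico_mem_nhdsLT ht.1] with r hr
        exact hP r hr k l hk hl hk0 hl0
    · intro t ht hP
      have ht' : t ∈ Ico 0 T := ⟨ht₀.trans ht.1, ht.2.trans_le ht₁⟩
      have hst := hord t ⟨ht'.1, ht'.2.le⟩
      have hPt := hP t ⟨ht.1, le_rfl⟩
      have hφt : 0 < φ t := hφ₁.trans_le (hφanti _ _ ht.2.le)
      simp only [eventually_all]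
      intro k l hk hl hk0 hl0
      have hle := hPt k l hk hl hk0 hl0
      have hgap : 0 < x t l - x t k := (Real.sqrt_pos.2 hφt).trans_le hle
      have hcharged : ∀ r, b t r ≠ 0 → b t₀ r ≠ 0 := fun r hr h =>
        hr (E.charge_eq_zero ht₀ ht.1 ht'.2.le h)
      have hdiff : HasDerivWithinAt (fun r => (x r l - x r k) ^ 2 - φ r)
          (2 * ((x t l - x t k) * (velocity (x t) (b t) l - velocity (x t) (b t) k)) + 8 * κ)
          (Ici t) t := by
        have h1 := ((E.deriv_right t ht' l).sub (E.deriv_right t ht' k)).pow 2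
        have h2 := ((((hasDerivAt_id t).sub_const t₀).const_mul (8 * κ)).const_sub
          (c ^ 2)).hasDerivWithinAt (s := Ici t)
        exact (h1.sub h2).congr_deriv (by norm_num; ring)
      have hev : ∀ᶠ r in 𝓝[>] t, 0 ≤ (x r l - x r k) ^ 2 - φ r := by
        refine eventually_nonneg_right hdiff ?_ fun h0 => ?_
        · have := (Real.sqrt_le_iff.1 hle).2
          linarith
        · have hD : √(φ t) = x t l - x t k := by
            rw [← sub_eq_zero.1 h0, Real.sqrt_sq hgap.le]
          set D := x t l - x t k
          have hDc : D ≤ c := by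
            rw [← hD]
            refine Real.sqrt_le_iff.2 ⟨hc.le, ?_⟩
            have := hφanti _ _ ht.1
            simpa [hφ] using this
          -- The barrier decreases from `c`, so where it is touched its value `D` is at most the
          -- separation `c` of equal signs, which persists.
          have hsept : ∀ s : SignType, s ≠ 0 → Separated (x t) (b t) s D :=
            fun s hs p q hpq hp hq => hDc.trans
              (E.separated_mono hord ht₀ hs hc.le (hsep s hs) ⟨ht.1, ht'.2.le⟩ p q hpq hp hq)
          have hside : ∀ r, b t r ≠ 0 → r ≤ i ∨ j ≤ r := fun r hr => by
            by_contra! h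
            exact hcharged r hr (hij.2.2.2 r h.1 h.2)
          have hvk : velocity (x t) (b t) k < 2 * κ / D := by
            by_cases hbk : b t k = 0
            · rw [velocity_eq_zero hbk]; positivity
            · refine velocity_lt hst hbk hgap hsept fun r hkr hr => ?_
              rcases hside r hr with h | h
              · have h1 := hPt r l h hl (hcharged r hr) hl0
                have h2 := lt_of_mem_stateSpace hst hkr hbk hr
                rw [hD] at h1
                simp only [D] at h1
                linarith
              · have := hPt k r hk h hk0 (hcharged r hr)
                rwa [hD] at this
          have hvl : -(2 * κ / D) < velocity (x t) (b t) l := by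
            by_cases hbl : b t l = 0
            · rw [velocity_eq_zero hbl, neg_lt_zero]; positivity
            · refine lt_velocity hst hbl hgap hsept fun r hrl hr => ?_
              rcases hside r hr with h | h
              · have := hPt r l h hl (hcharged r hr) hl0
                rwa [hD] at this
              · have h1 := hPt k r hk h hk0 (hcharged r hr)
                have h2 := lt_of_mem_stateSpace hst hrl hr hbl
                rw [hD] at h1
                simp only [D] at h1
                linarith
          -- Each end approaches the other with speed less than `2 * κ / D`. The squared distance
          -- therefore decreases at a rate less than `8 * κ`, which is the slope of the barrier.
          have h3 : -(4 * κ) < D * (velocity (x t) (b t) l - velocity (x t) (b t) k) := by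
            have : -(4 * κ) = D * (-(2 * κ / D) - 2 * κ / D) := by field_simp; ring
            rw [this]
            exact mul_lt_mul_of_pos_left (by linarith) hgap
          linarith
      filter_upwards [hev, ((E.tendsto_right ht' l).sub (E.tendsto_right ht' k)).eventually
        (lt_mem_nhds hgap)] with r hr hr'
      exact Real.sqrt_le_iff.2 ⟨hr'.le, by linarith⟩
  -- The induction needs a positive radicand. At the time when it vanishes, the bound is the limit
  -- from the left.
  rcases hpos.eq_or_lt with h0 | h0
  · have htt : t₀ < t := by
      refine lt_of_le_of_ne ht.1 fun h => ?_
      rw [← h] at h0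
      simp at h0
      exact (pow_pos hc 2).ne h0
    have ht' : t ∈ Ioc 0 T := ⟨ht₀.trans_lt htt, ht.2⟩
    rw [← h0, Real.sqrt_zero]
    refine ge_of_tendsto ((E.tendsto_left ht' j).sub (E.tendsto_left ht' i)) ?_
    filter_upwards [Ico_mem_nhdsLT htt] with r hr
    refine (Real.sqrt_nonneg _).trans (key r (hr.2.le.trans ht.2) ?_ r ⟨hr.1, le_rfl⟩ i j le_rfl
      le_rfl hij.2.1 hij.2.2.1)
    have : κ * (r - t₀) < κ * (t - t₀) := mul_lt_mul_of_pos_left (by linarith [hr.2]) hκ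
    simp only [hφ]
    linarith
  · exact key t ht.2 h0 t ⟨ht.1, le_rfl⟩ i j le_rfl le_rfl hij.2.1 hij.2.2.1

end Evolution

end

/-! ### Sums of velocities -/

section

variable {n : ℕ}

/-- Exchanging `k` and `l` within `I` turns the singular kernel into difference quotients of `a`;
only the interaction with the outside stays unsymmetrized. -/
theorem sum_mul_velocity (x : Fin n → ℝ) (b : Fin n → SignType) (a : Fin n → ℝ)
    (I : Finset (Fin n)) :
    n * ∑ k ∈ I, a k * velocity x b k =
      1 / 2 * ∑ k ∈ I, ∑ l ∈ I, ((b k : ℝ) * (b l : ℝ)) * ((a k - a l) / (x k - x l)) +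
      ∑ k ∈ I, ∑ l ∈ Iᶜ, ((b k : ℝ) * (b l : ℝ)) * (a k / (x k - x l)) := by
  rcases Nat.eq_zero_or_pos n with rfl | hn
  · simp [Finset.eq_empty_of_isEmpty I]
  have hn' : (n : ℝ) ≠ 0 := by exact_mod_cast hn.ne'
  have h1 : n * ∑ k ∈ I, a k * velocity x b k =
      ∑ k ∈ I, ∑ l ∈ I, ((b k : ℝ) * (b l : ℝ)) * (a k / (x k - x l)) +
      ∑ k ∈ I, ∑ l ∈ Iᶜ, ((b k : ℝ) * (b l : ℝ)) * (a k / (x k - x l)) := by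
    rw [← Finset.sum_add_distrib, Finset.mul_sum]
    refine Finset.sum_congr rfl fun k _ => ?_
    rw [Finset.sum_add_sum_compl, velocity_eq_sum, mul_left_comm, ← mul_assoc (n : ℝ),
      mul_one_div_cancel hn', one_mul, Finset.mul_sum]
    exact Finset.sum_congr rfl fun l _ => by ring
  have h2 : ∑ k ∈ I, ∑ l ∈ I, ((b k : ℝ) * (b l : ℝ)) * ((a k - a l) / (x k - x l)) =
      ∑ k ∈ I, ∑ l ∈ I, ((b k : ℝ) * (b l : ℝ)) * (a k / (x k - x l)) +
      ∑ k ∈ I, ∑ l ∈ I, ((b k : ℝ) * (b l : ℝ)) * (a k / (x k - x l)) := by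
    conv_rhs => rhs; rw [Finset.sum_comm]
    rw [← Finset.sum_add_distrib]
    refine Finset.sum_congr rfl fun k _ => ?_
    rw [← Finset.sum_add_distrib]
    refine Finset.sum_congr rfl fun l _ => ?_
    rw [← neg_sub (x l) (x k)]
    simp only [div_neg]
    ring
  rw [h1, h2]
  ring

/-- Each of the `n ^ 2` difference quotients is at most `L`, no matter how close the particles are.
-/
theorem abs_sum_mul_velocity_le (x : Fin n → ℝ) (b : Fin n → SignType) (a : Fin n → ℝ) {L : ℝ}
    (hL : 0 ≤ L) (ha : ∀ k l, |a k - a l| ≤ L * |x k - x l|) :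
    |∑ k, a k * velocity x b k| ≤ n * L := by
  rcases Nat.eq_zero_or_pos n with rfl | hn
  · simp
  have hn' : (0 : ℝ) < n := by exact_mod_cast hn
  have h := sum_mul_velocity x b a Finset.univ
  rw [Finset.compl_univ] at h
  simp only [Finset.sum_empty, Finset.sum_const_zero, add_zero] at h
  have hb : |∑ k, ∑ l, ((b k : ℝ) * (b l : ℝ)) * ((a k - a l) / (x k - x l))| ≤ n * (n * L) := by
    calc _ ≤ ∑ _k : Fin n, ∑ _l : Fin n, L := by
          refine (Finset.abs_sum_le_sum_abs _ _).trans (Finset.sum_le_sum fun k _ =>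
            (Finset.abs_sum_le_sum_abs _ _).trans (Finset.sum_le_sum fun l _ => ?_))
          rw [abs_mul, ← one_mul L]
          refine mul_le_mul (abs_coe_mul_le _ _) ?_ (abs_nonneg _) zero_le_one
          rw [abs_div]
          rcases (abs_nonneg (x k - x l)).eq_or_lt with h0 | h0
          · rw [← h0, div_zero]; exact hL
          · rw [div_le_iff₀ h0]; exact ha k l
      _ = _ := by simp
  have h2 : |n * ∑ k, a k * velocity x b k| ≤ n * (n * L) := by
    rw [h, abs_mul, abs_of_pos (by norm_num : (0 : ℝ) < 1 / 2)]
    have : 0 ≤ n * (n * L) := by positivity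
    linarith
  rw [abs_mul, abs_of_pos hn'] at h2
  exact le_of_mul_le_mul_left h2 hn'

theorem abs_sum_cross_le (x : Fin n → ℝ) (b : Fin n → SignType) (a : Fin n → ℝ)
    (I : Finset (Fin n)) {r δ : ℝ} (hδ : 0 < δ) (hr : 0 ≤ r) (ha : ∀ k ∈ I, |a k| ≤ r)
    (hI : ∀ k ∈ I, ∀ l ∉ I, b l ≠ 0 → δ ≤ |x k - x l|) :
    |∑ k ∈ I, ∑ l ∈ Iᶜ, ((b k : ℝ) * (b l : ℝ)) * (a k / (x k - x l))| ≤ n ^ 2 * r / δ := by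
  calc _ ≤ ∑ _k ∈ I, ∑ _l ∈ Iᶜ, r / δ := by
        refine (Finset.abs_sum_le_sum_abs _ _).trans (Finset.sum_le_sum fun k hk =>
          (Finset.abs_sum_le_sum_abs _ _).trans (Finset.sum_le_sum fun l hl => ?_))
        by_cases hbl : b l = 0
        · simp only [hbl, SignType.coe_zero, mul_zero, zero_mul, abs_zero]; positivity
        rw [abs_mul, ← one_mul (r / δ), abs_div]
        have := hI k hk l (Finset.mem_compl.1 hl) hbl
        refine mul_le_mul (abs_coe_mul_le _ _) ?_ (by positivity) zero_le_one
        exact div_le_div₀ hr (ha k hk) hδ this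
    _ ≤ ∑ _k : Fin n, ∑ _l : Fin n, r / δ := by
        have : 0 ≤ r / δ := by positivity
        refine (Finset.sum_le_sum fun k _ => Finset.sum_le_sum_of_subset_of_nonneg
          (Finset.subset_univ _) fun _ _ _ => this).trans
          (Finset.sum_le_sum_of_subset_of_nonneg (Finset.subset_univ _) fun _ _ _ =>
            Finset.sum_nonneg fun _ _ => this)
    _ = _ := by simp; ring

/-- The virial of a cluster of particles. -/
theorem abs_virial_sub_le {x : Fin n → ℝ} {b : Fin n → SignType}
    (hinj : ∀ i j, i ≠ j → b i ≠ 0 → b j ≠ 0 → x i ≠ x j) (y : ℝ)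
    (I : Finset (Fin n)) {r δ : ℝ} (hδ : 0 < δ) (hr : 0 ≤ r) (ha : ∀ k ∈ I, |x k - y| ≤ r)
    (hI : ∀ k ∈ I, ∀ l ∉ I, b l ≠ 0 → δ ≤ |x k - x l|) :
    |n * ∑ k ∈ I, (x k - y) * velocity x b k -
      1 / 2 * ((∑ k ∈ I, (b k : ℝ)) ^ 2 - ∑ k ∈ I, (b k : ℝ) ^ 2)| ≤ n ^ 2 * r / δ := by
  have h := sum_mul_velocity x b (fun k => x k - y) I
  -- All quotients between distinct charged particles equal one. The diagonal quotients are `0 / 0 =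
  -- 0`, which is why `∑ b ^ 2` is subtracted.
  have h2 : ∑ k ∈ I, ∑ l ∈ I, ((b k : ℝ) * (b l : ℝ)) * ((x k - y - (x l - y)) / (x k - x l)) =
      (∑ k ∈ I, (b k : ℝ)) ^ 2 - ∑ k ∈ I, (b k : ℝ) ^ 2 := by
    rw [sq, Finset.sum_mul_sum, ← Finset.sum_sub_distrib]
    refine Finset.sum_congr rfl fun k hk => ?_
    rw [← Finset.add_sum_erase I _ hk, ← Finset.add_sum_erase I (fun l => (b k : ℝ) * (b l : ℝ)) hk]
    have : ∑ l ∈ I.erase k, ((b k : ℝ) * (b l : ℝ)) * ((x k - y - (x l - y)) / (x k - x l)) =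
        ∑ l ∈ I.erase k, (b k : ℝ) * (b l : ℝ) := by
      refine Finset.sum_congr rfl fun l hl => ?_
      by_cases hbk : b k = 0
      · simp [hbk]
      by_cases hbl : b l = 0
      · simp [hbl]
      have := sub_ne_zero.2 (hinj k l (Finset.ne_of_mem_erase hl).symm hbk hbl)
      rw [show x k - y - (x l - y) = x k - x l by ring, div_self this, mul_one]
    rw [this]
    simp
    ring
  rw [h2] at h
  rw [h, add_sub_cancel_left]
  exact abs_sum_cross_le x b (fun k => x k - y) I hδ hr ha hI

/-- Internal forces cancel, so the center of a cluster is moved only by charges outside of it. -/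
theorem abs_sum_velocity_le {x : Fin n → ℝ} {b : Fin n → SignType}
    (I : Finset (Fin n)) {δ : ℝ} (hδ : 0 < δ)
    (hI : ∀ k ∈ I, ∀ l ∉ I, b l ≠ 0 → δ ≤ |x k - x l|) :
    |∑ k ∈ I, velocity x b k| ≤ n / δ := by
  rcases Nat.eq_zero_or_pos n with rfl | hn
  · simp [Finset.eq_empty_of_isEmpty I]
  have hn' : (0 : ℝ) < n := by exact_mod_cast hn
  have h := sum_mul_velocity x b (fun _ => 1) I
  simp only [sub_self, zero_div, mul_zero, Finset.sum_const_zero, zero_add, one_mul] at h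
  have h2 := abs_sum_cross_le x b (fun _ => 1) I hδ zero_le_one (by simp) hI
  rw [← h, abs_mul, abs_of_pos hn'] at h2
  refine le_of_mul_le_mul_left (h2.trans_eq ?_) hn'
  ring

/-! ### Bounds and Lipschitz estimates -/

variable {T : ℝ} {x : ℝ → Fin n → ℝ} {b : ℝ → Fin n → SignType}

namespace Evolution

/-- This is the source of all a priori bounds that hold across collisions. It is used for powers
(moments), squares (bounds on positions) and truncated squares (convergence at collisions). -/
theorem abs_sum_sub_le (E : Evolution T x b) {f f' : ℝ → ℝ} (hf : ∀ u, HasDerivAt f (f' u) u)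
    {L : ℝ} (hL : 0 ≤ L)
    (hf' : ∀ t ∈ Icc 0 T, ∀ k l, |f' (x t k) - f' (x t l)| ≤ L * |x t k - x t l|)
    {s t : ℝ} (hs : 0 ≤ s) (hst : s ≤ t) (ht : t ≤ T) :
    |∑ k, f (x t k) - ∑ k, f (x s k)| ≤ n * L * (t - s) := by
  refine abs_sub_le_of_abs_deriv_right_le (f := fun t => ∑ k, f (x t k))
    (f' := fun t => ∑ k, f' (x t k) * velocity (x t) (b t) k) hst ?_ ?_ ?_
  · refine continuousOn_finsetSum _ fun k _ => ?_
    have hfc : Continuous f := continuous_iff_continuousAt.2 fun u => (hf u).continuousAt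
    exact hfc.comp_continuousOn ((E.cont k).mono (Icc_subset_Icc hs ht))
  · intro r hr
    refine HasDerivWithinAt.fun_sum fun k _ => ?_
    exact (hf (x r k)).comp_hasDerivWithinAt r (E.deriv_right r ⟨hs.trans hr.1, hr.2.trans_le ht⟩ k)
  · intro r hr
    exact abs_sum_mul_velocity_le _ _ _ hL (hf' r ⟨hs.trans hr.1, hr.2.le.trans ht⟩)

theorem sum_sq_le (E : Evolution T x b) {t : ℝ} (ht : t ∈ Icc 0 T) :
    ∑ k, x t k ^ 2 ≤ ∑ k, x 0 k ^ 2 + 2 * n * T := by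
  have := E.abs_sum_sub_le (f := fun u => u ^ 2) (f' := fun u => 2 * u)
    (fun u => by simpa using hasDerivAt_pow 2 u) (L := 2) (by norm_num)
    (fun t _ k l => by rw [← mul_sub, abs_mul]; norm_num) le_rfl ht.1 ht.2
  have h2 : (n : ℝ) * 2 * (t - 0) ≤ 2 * n * T := by
    have := ht.2
    have : (0 : ℝ) ≤ n := Nat.cast_nonneg n
    nlinarith
  linarith [(abs_le.1 this).2]

theorem abs_position_le (E : Evolution T x b) {R : ℝ} (hR : ∑ k, x 0 k ^ 2 + 2 * n * T ≤ R) {t : ℝ}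
    (ht : t ∈ Icc 0 T) (i : Fin n) : |x t i| ≤ 1 + R := by
  have h1 := E.sum_sq_le ht
  have h2 : x t i ^ 2 ≤ ∑ k, x t k ^ 2 :=
    Finset.single_le_sum (f := fun k => x t k ^ 2) (fun k _ => sq_nonneg _) (Finset.mem_univ i)
  have h3 : |x t i| ^ 2 ≤ R := by rw [sq_abs]; linarith
  nlinarith [abs_nonneg (x t i), sq_nonneg (|x t i| - 1)]

theorem momentDist_le (E : Evolution T x b) {R : ℝ} (hR : ∑ k, x 0 k ^ 2 + 2 * n * T ≤ R)
    (hR0 : 0 ≤ R) {s t : ℝ} (hs : 0 ≤ s) (hst : s ≤ t) (ht : t ≤ T) :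
    momentDist (x t) (x s) ≤ n * (n * (n * (1 + R) ^ n)) * (t - s) := by
  have hcomp : ∀ k : Fin n, |(moments (x t) - moments (x s)) k| ≤
      n * (n * (1 + R) ^ n) * (t - s) := by
    intro k
    have h := E.abs_sum_sub_le (f := fun u => (1 / ((k : ℕ) + 1 : ℝ)) * u ^ ((k : ℕ) + 1))
      (f' := fun u => u ^ (k : ℕ)) (fun u => by
        have := (hasDerivAt_pow ((k : ℕ) + 1) u).const_mul (1 / ((k : ℕ) + 1 : ℝ))
        refine this.congr_deriv ?_
        push_cast
        have : ((k : ℕ) + 1 : ℝ) ≠ 0 := by positivity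
        field_simp) (L := n * (1 + R) ^ n) (by positivity) (fun r hr i j => by
        have h1 := abs_pow_sub_pow_le (x r i) (x r j) (k : ℕ)
        have h2 : max |x r i| |x r j| ≤ 1 + R :=
          max_le (E.abs_position_le hR hr i) (E.abs_position_le hR hr j)
        have h3 : max |x r i| |x r j| ^ ((k : ℕ) - 1) ≤ (1 + R) ^ n :=
          (pow_le_pow_left₀ (le_max_of_le_left (abs_nonneg _)) h2 _).trans
            (pow_le_pow_right₀ (by linarith) (by have := k.2; omega))
        have h4 : ((k : ℕ) : ℝ) ≤ n := by exact_mod_cast k.2.le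
        calc _ ≤ _ := h1
          _ ≤ |x r i - x r j| * n * (1 + R) ^ n := by gcongr
          _ = _ := by ring) hs hst ht
    have he : (moments (x t) - moments (x s)) k =
        ∑ i, (1 / ((k : ℕ) + 1 : ℝ)) * x t i ^ ((k : ℕ) + 1) -
        ∑ i, (1 / ((k : ℕ) + 1 : ℝ)) * x s i ^ ((k : ℕ) + 1) := by
      simp [moments, Finset.mul_sum]
    rw [he]
    exact h
  have hB : 0 ≤ n * (n * (1 + R) ^ n) * (t - s) := by
    have := sub_nonneg.2 hst
    positivity
  calc momentDist (x t) (x s) ≤ ∑ k, |(moments (x t) - moments (x s)) k| := by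
        rw [momentDist, EuclideanSpace.norm_eq]
        refine Real.sqrt_le_iff.2 ⟨Finset.sum_nonneg fun _ _ => abs_nonneg _, ?_⟩
        simp only [Real.norm_eq_abs]
        exact Finset.sum_sq_le_sq_sum_of_nonneg fun _ _ => abs_nonneg _
    _ ≤ ∑ _k : Fin n, n * (n * (1 + R) ^ n) * (t - s) := Finset.sum_le_sum fun k _ => hcomp k
    _ = _ := by simp; ring

end Evolution

/-! ### Collisions -/

theorem exists_separation (x : Fin n → ℝ) : ∃ ρ > 0, ∀ k l, x k ≠ x l → ρ ≤ |x k - x l| := by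
  have h : ∀ p : Fin n × Fin n, ∃ ρ > 0, x p.1 ≠ x p.2 → ρ ≤ |x p.1 - x p.2| := fun p => by
    by_cases hp : x p.1 = x p.2
    · exact ⟨1, one_pos, fun h => absurd hp h⟩
    · exact ⟨_, abs_pos.2 (sub_ne_zero.2 hp), fun _ => le_rfl⟩
  choose ρ hρ hρ' using h
  rcases isEmpty_or_nonempty (Fin n × Fin n) with hE | hE
  · exact ⟨1, one_pos, fun k l => (hE.false (k, l)).elim⟩
  obtain ⟨p, hp⟩ := Finite.exists_min ρ
  exact ⟨ρ p, hρ p, fun k l hkl => (hp (k, l)).trans (hρ' (k, l) hkl)⟩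

theorem abs_sum_le_one {c : Fin n → SignType} {I : Finset (Fin n)}
    (h : ∀ k ∈ I, ∀ l ∈ I, k ≠ l → c k = 0 ∨ c l = 0) : |∑ k ∈ I, (c k : ℤ)| ≤ 1 := by
  by_cases h0 : ∃ k ∈ I, c k ≠ 0
  · obtain ⟨k, hk, hck⟩ := h0
    rw [Finset.sum_eq_single k]
    · exact abs_coe_int_le _
    · intro l hl hlk
      rcases h l hl k hk hlk with h | h
      · simp [h]
      · exact absurd h hck
    · exact fun h => absurd hk h
  · push Not at h0
    rw [Finset.sum_eq_zero fun k hk => by simp [h0 k hk]]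
    simp

/-- If all `u k ≤ a`, the bound on the sum forces `u k ≥ -2 * n * a`, and the squares are too small.
Applied to `u` and `-u`, it finds particles on both sides of a collision point. -/
theorem exists_lt_of_sum {I : Finset (Fin n)} {u : Fin n → ℝ} {a : ℝ} (ha : 0 ≤ a)
    (hsum : |∑ k ∈ I, u k| ≤ n * a) (hsq : 4 * n ^ 3 * a ^ 2 < ∑ k ∈ I, u k ^ 2) :
    ∃ k ∈ I, a < u k := by
  by_contra! hcon
  have hcard : (I.card : ℝ) ≤ n := by
    have := I.card_le_univ
    rw [Fintype.card_fin] at this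
    exact_mod_cast this
  have hb : ∀ k ∈ I, u k ^ 2 ≤ 4 * n ^ 2 * a ^ 2 := by
    intro k hk
    have h1 : ∑ l ∈ I.erase k, u l ≤ n * a := by
      calc _ ≤ ∑ _l ∈ I.erase k, a :=
            Finset.sum_le_sum fun l hl => hcon l (Finset.mem_of_mem_erase hl)
        _ ≤ ∑ _l ∈ I, a := Finset.sum_le_sum_of_subset_of_nonneg (Finset.erase_subset _ _)
            fun _ _ _ => ha
        _ = I.card * a := by simp
        _ ≤ n * a := by gcongr
    have h2 := Finset.add_sum_erase I u hk
    have h3 := (abs_le.1 hsum).1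
    have hn1 : (1 : ℝ) ≤ n := by
      have := k.pos; exact_mod_cast this
    have h4 : |u k| ≤ 2 * n * a := abs_le.2 ⟨by linarith, by nlinarith [hcon k hk]⟩
    calc u k ^ 2 = |u k| ^ 2 := (sq_abs _).symm
      _ ≤ (2 * n * a) ^ 2 := by gcongr
      _ = _ := by ring
  have : ∑ k ∈ I, u k ^ 2 ≤ 4 * n ^ 3 * a ^ 2 := by
    calc _ ≤ ∑ _k ∈ I, 4 * n ^ 2 * a ^ 2 := Finset.sum_le_sum hb
      _ = I.card * (4 * n ^ 2 * a ^ 2) := by simp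
      _ ≤ n * (4 * n ^ 2 * a ^ 2) := by gcongr
      _ = _ := by ring
  linarith

theorem sum_sq_charge_le {c : Fin n → SignType} (I : Finset (Fin n)) :
    ∑ k ∈ I, (c k : ℝ) ^ 2 ≤ n := by
  calc _ ≤ ∑ _k ∈ I, (1 : ℝ) := Finset.sum_le_sum fun k _ => by
        rw [← sq_abs]; exact pow_le_one₀ (abs_nonneg _) (abs_coe_le _)
    _ = I.card := by simp
    _ ≤ n := by
      have := I.card_le_univ
      rw [Fintype.card_fin] at this
      exact_mod_cast this

theorem abs_sum_charge_le {c : Fin n → SignType} (I : Finset (Fin n)) :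
    |∑ k ∈ I, (c k : ℝ)| ≤ n := by
  calc _ ≤ ∑ _k ∈ I, (1 : ℝ) := (Finset.abs_sum_le_sum_abs _ _).trans
        (Finset.sum_le_sum fun k _ => abs_coe_le _)
    _ = I.card := by simp
    _ ≤ n := by
      have := I.card_le_univ
      rw [Fintype.card_fin] at this
      exact_mod_cast this

namespace Evolution

theorem hasDerivWithinAt_sum_sq (E : Evolution T x b) (I : Finset (Fin n)) (y : ℝ) {t : ℝ}
    (ht : t ∈ Ico 0 T) :
    HasDerivWithinAt (fun s => ∑ k ∈ I, (x s k - y) ^ 2)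
      (2 * ∑ k ∈ I, (x t k - y) * velocity (x t) (b t) k) (Ici t) t := by
  have := HasDerivWithinAt.fun_sum (u := I) fun k _ => ((E.deriv_right t ht k).sub_const y).pow 2
  refine HasDerivWithinAt.congr_deriv this ?_
  rw [Finset.mul_sum]
  exact Finset.sum_congr rfl fun k _ => by norm_num; ring

theorem continuousOn_sum_sq (E : Evolution T x b) (I : Finset (Fin n)) (y : ℝ) :
    ContinuousOn (fun s => ∑ k ∈ I, (x s k - y) ^ 2) (Icc 0 T) :=
  continuousOn_finsetSum _ fun k _ => ((E.cont k).sub continuousOn_const).pow 2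

theorem eventually_close_left (E : Evolution T x b) {τ : ℝ} (hτ : τ ∈ Ioc 0 T) {r : ℝ}
    (hr : 0 < r) : ∃ t₀ ∈ Ico 0 τ, ∀ t ∈ Icc t₀ τ, ∀ k, |x t k - x τ k| < r := by
  have h : ∀ᶠ t in 𝓝[<] τ, ∀ k, |x t k - x τ k| < r := by
    rw [eventually_all]
    intro k
    have := ((E.tendsto_left hτ k).sub_const (x τ k)).abs
    rw [sub_self, abs_zero] at this
    exact this.eventually (gt_mem_nhds hr)
  obtain ⟨l, hl, hl'⟩ := (mem_nhdsLT_iff_exists_Ioo_subset).1 (h : {t | _} ∈ 𝓝[<] τ)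
  have hl : l < τ := hl
  refine ⟨max 0 ((l + τ) / 2), ⟨le_max_left _ _, max_lt hτ.1 (by linarith)⟩, fun t ht k => ?_⟩
  rcases ht.2.eq_or_lt with he | he
  · rw [he, sub_self, abs_zero]; exact hr
  · have : (l + τ) / 2 ≤ t := (le_max_right _ _).trans ht.1
    exact hl' ⟨by linarith, he⟩ k

/-- Before a collision, the positions are Hölder continuous with exponent one half. -/
theorem exists_abs_sub_le_sqrt (E : Evolution T x b) {τ : ℝ} (hτ : τ ∈ Ioc 0 T) (i : Fin n) :
    ∃ K : ℝ, 0 ≤ K ∧ ∀ t ∈ Icc 0 τ, |x t i - x τ i| ≤ K * √(τ - t) := by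
  have hn : (0 : ℝ) < n := by
    have := i.pos; exact_mod_cast this
  obtain ⟨ρ, hρ, hsep⟩ := exists_separation (x τ)
  obtain ⟨t₀, ht₀, hclose⟩ := E.eventually_close_left hτ (r := ρ / 4) (by positivity)
  set y := x τ i with hy
  set I : Finset (Fin n) := Finset.univ.filter fun k => x τ k = y with hI
  have hImem : ∀ k, k ∈ I ↔ x τ k = y := fun k => by simp [hI]
  set C : ℝ := 2 * ((n ^ 2 + n + n ^ 2) / n) with hC
  have hC0 : 0 ≤ C := by positivity
  have hnear : ∀ t ∈ Icc t₀ τ, |x t i - x τ i| ≤ √C * √(τ - t) := by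
    intro t ht
    -- The second moment of the cluster about `y` vanishes at `τ` and has derivative bounded by `C`,
    -- so it is at most `C * (τ - t)`.
    have h := abs_sub_le_of_abs_deriv_right_le (f := fun s => ∑ k ∈ I, (x s k - y) ^ 2)
      (f' := fun s => 2 * ∑ k ∈ I, (x s k - y) * velocity (x s) (b s) k) (C := C) ht.2
      ((E.continuousOn_sum_sq I y).mono (Icc_subset_Icc (ht₀.1.trans ht.1) hτ.2))
      (fun s hs => E.hasDerivWithinAt_sum_sq I y
        ⟨ht₀.1.trans (ht.1.trans hs.1), hs.2.trans_le hτ.2⟩)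
      (fun s hs => by
        have hs' : s ∈ Icc t₀ τ := ⟨ht.1.trans hs.1, hs.2.le⟩
        have hc := hclose s hs'
        have hv := abs_virial_sub_le (E.inj s ⟨ht₀.1.trans hs'.1, hs'.2.trans hτ.2⟩) y I
          (r := ρ / 4) (δ := ρ / 2) (by positivity) (by positivity)
          (fun k hk => by rw [← (hImem k).1 hk]; exact (hc k).le)
          (fun k hk l hl _ => by
            rw [hImem] at hk hl
            have h1 := hsep k l (by rw [hk]; exact fun h => hl h.symm)
            have h2 := abs_lt.1 (hc k)
            have h3 := abs_lt.1 (hc l)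
            rcases le_abs.1 h1 with h | h
            · exact le_abs.2 (Or.inl (by linarith))
            · exact le_abs.2 (Or.inr (by linarith)))
        have hr : (n : ℝ) ^ 2 * (ρ / 4) / (ρ / 2) ≤ n ^ 2 := by
          rw [div_le_iff₀ (by positivity)]
          nlinarith [sq_nonneg (n : ℝ)]
        have hs1 := sum_sq_charge_le (c := b s) I
        have hs2 := abs_sum_charge_le (c := b s) I
        have hs3 : (∑ k ∈ I, (b s k : ℝ)) ^ 2 ≤ n ^ 2 := by
          rw [← sq_abs]; gcongr
        have hs4 : 0 ≤ ∑ k ∈ I, (b s k : ℝ) ^ 2 := Finset.sum_nonneg fun _ _ => sq_nonneg _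
        have hs5 := sq_nonneg (∑ k ∈ I, (b s k : ℝ))
        have hv' := abs_le.1 hv
        set Q := ∑ k ∈ I, (x s k - y) * velocity (x s) (b s) k
        have : |n * Q| ≤ n ^ 2 + n + n ^ 2 := abs_le.2 ⟨by linarith, by linarith⟩
        rw [abs_mul, abs_of_pos hn] at this
        rw [abs_mul, abs_of_pos two_pos, hC]
        gcongr
        rw [le_div_iff₀ hn]
        linarith)
    have hV : ∑ k ∈ I, (x τ k - y) ^ 2 = 0 :=
      Finset.sum_eq_zero fun k hk => by rw [(hImem k).1 hk]; ring
    have h1 : (x t i - y) ^ 2 ≤ ∑ k ∈ I, (x t k - y) ^ 2 :=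
      Finset.single_le_sum (f := fun k => (x t k - y) ^ 2) (fun k _ => sq_nonneg _)
        ((hImem i).2 rfl)
    rw [hV] at h
    have h2 := (abs_le.1 h).1
    rw [← Real.sqrt_mul hC0]
    exact Real.abs_le_sqrt (by linarith)
  -- Before `t₀` the displacement is merely bounded, while `√(τ - t)` is at least `√(τ - t₀)`.
  obtain ⟨M, hM⟩ := isCompact_Icc.exists_bound_of_continuousOn
    (((E.cont i).mono (Icc_subset_Icc_right hτ.2)).sub (continuousOn_const (c := x τ i)))
  have hpos : 0 < √(τ - t₀) := Real.sqrt_pos.2 (by linarith [ht₀.2])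
  refine ⟨√C + |M| / √(τ - t₀), by positivity, fun t ht => ?_⟩
  rcases le_total t₀ t with h | h
  · calc _ ≤ √C * √(τ - t) := hnear t ⟨h, ht.2⟩
      _ ≤ _ := by gcongr; exact le_add_of_nonneg_right (by positivity)
  · calc |x t i - x τ i| ≤ |M| := (hM t ht).trans (le_abs_self M)
      _ = |M| / √(τ - t₀) * √(τ - t₀) := by field_simp
      _ ≤ |M| / √(τ - t₀) * √(τ - t) := by gcongr
      _ ≤ _ := by gcongr; exact le_add_of_nonneg_left (by positivity)

/-- Annihilating particles approach each other at least at the rate of the square root. -/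
theorem exists_sqrt_lt (E : Evolution T x b) (hord : ∀ t ∈ Icc 0 T, (x t, b t) ∈ stateSpace n)
    {τ : ℝ} (hτ : τ ∈ Ioc 0 T) {β : Fin n → SignType} (hβ : ∀ᶠ s in 𝓝[<] τ, b s = β)
    (hβb : ∀ i, b τ i = β i ∨ b τ i = 0)
    (hsum : ∀ y, ∑ i with x τ i = y, ((b τ i : ℤ) - (β i : ℤ)) = 0)
    {i₀ : Fin n} (hi₀ : b τ i₀ ≠ β i₀) :
    ∃ c : ℝ, 0 < c ∧ ∃ i j : Fin n, x τ i = x τ i₀ ∧ x τ j = x τ i₀ ∧ β i ≠ 0 ∧ β j ≠ 0 ∧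
      ∀ᶠ t in 𝓝[<] τ, c * √(τ - t) < x t i - x τ i₀ ∧ x t j - x τ i₀ < -(c * √(τ - t)) := by
  have hn1 : (1 : ℝ) ≤ n := by
    have := i₀.pos; exact_mod_cast this
  have hn : (0 : ℝ) < n := by linarith
  obtain ⟨ρ, hρ, hsep⟩ := exists_separation (x τ)
  set y := x τ i₀ with hy
  set I : Finset (Fin n) := Finset.univ.filter fun k => x τ k = y ∧ β k ≠ 0 with hI
  have hImem : ∀ k, k ∈ I ↔ x τ k = y ∧ β k ≠ 0 := fun k => by simp [hI]
  have hjump : ∀ k, b τ k ≠ β k → β k ≠ 0 ∧ b τ k = 0 := fun k hk => by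
    rcases hβb k with h | h
    · exact absurd h hk
    · exact ⟨fun h0 => hk (by rw [h, h0]), h⟩
  obtain ⟨hβi, hbi⟩ := hjump i₀ hi₀
  have hiI : i₀ ∈ I := (hImem i₀).2 ⟨rfl, hβi⟩
  -- The net charge at `y` is the same after `τ`, when at most one charged particle sits there.
  have hnet : |∑ k ∈ I, (β k : ℝ)| ≤ 1 := by
    have h1 := hsum y
    rw [Finset.sum_sub_distrib, sub_eq_zero] at h1
    have h2 : ∑ k ∈ I, (β k : ℤ) = ∑ k with x τ k = y, (β k : ℤ) := by
      rw [hI, ← Finset.filter_filter, Finset.sum_filter]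
      exact Finset.sum_congr rfl fun k _ => by by_cases h : β k = 0 <;> simp [h]
    have h3 := abs_sum_le_one (c := b τ) (I := Finset.univ.filter fun k => x τ k = y)
      fun k hk l hl hkl => by
        by_contra! h
        refine E.inj τ ⟨hτ.1.le, hτ.2⟩ k l hkl h.1 h.2 ?_
        rw [(Finset.mem_filter.1 hk).2, (Finset.mem_filter.1 hl).2]
    rw [h1, ← h2] at h3
    have : ((|∑ k ∈ I, (β k : ℤ)| : ℤ) : ℝ) ≤ 1 := by exact_mod_cast h3
    simpa using this
  -- The jumps at `y` sum to zero, so `i₀` cannot jump alone.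
  have htwo : (2 : ℝ) ≤ ∑ k ∈ I, (β k : ℝ) ^ 2 := by
    obtain ⟨j, hj, hji, hjI⟩ : ∃ j, b τ j ≠ β j ∧ j ≠ i₀ ∧ x τ j = y := by
      by_contra! hcon
      have := hsum y
      rw [Finset.sum_eq_single i₀] at this
      · exact hi₀ (coe_int_injective (sub_eq_zero.1 this))
      · intro j hj hji
        have : b τ j = β j := by
          by_contra h
          exact hcon j h hji (Finset.mem_filter.1 hj).2
        rw [this, sub_self]
      · simp [hy]
    have hsub : ({i₀, j} : Finset (Fin n)) ⊆ I := by
      intro k hk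
      rcases Finset.mem_insert.1 hk with rfl | hk
      · exact hiI
      · rw [Finset.mem_singleton.1 hk]; exact (hImem j).2 ⟨hjI, (hjump j hj).1⟩
    calc (2 : ℝ) = ∑ k ∈ {i₀, j}, (β k : ℝ) ^ 2 := by
          rw [Finset.sum_pair hji.symm, sq, sq, coe_mul_self hβi, coe_mul_self (hjump j hj).1]
          norm_num
      _ ≤ _ := Finset.sum_le_sum_of_subset_of_nonneg hsub fun _ _ _ => sq_nonneg _
  -- With this radius the outside contributes at most `n ^ 2 * r / (ρ / 2) = 1 / 4` to `n` times the
  -- virial, while the inside contributes at most `(1 - 2) / 2`.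
  set r : ℝ := ρ / (8 * n ^ 2) with hr
  have hr0 : 0 < r := by positivity
  have hrρ : r ≤ ρ / 4 := by
    rw [hr]
    refine div_le_div_of_nonneg_left hρ.le (by norm_num) ?_
    nlinarith
  obtain ⟨t₀, ht₀, hclose⟩ := E.eventually_close_left hτ hr0
  obtain ⟨l, hl, hlβ⟩ := (mem_nhdsLT_iff_exists_Ioo_subset).1 (hβ : {t | _} ∈ 𝓝[<] τ)
  have hdist : ∀ s ∈ Icc t₀ τ, b s = β → ∀ k ∈ I, ∀ l ∉ I, b s l ≠ 0 →
      ρ / 2 ≤ |x s k - x s l| := by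
    intro s hs hbs k hk l hl hbl
    rw [hbs] at hbl
    rw [hImem] at hk hl
    have h1 := hsep k l (by rw [hk.1]; exact fun h => hl ⟨h.symm, hbl⟩)
    have h2 := abs_lt.1 (hclose s hs k)
    have h3 := abs_lt.1 (hclose s hs l)
    rcases le_abs.1 h1 with h | h
    · exact le_abs.2 (Or.inl (by linarith))
    · exact le_abs.2 (Or.inr (by linarith))
  -- Near `τ` the second moment about `y` is at least linear in `τ - t`, and so is of order `√(τ -
  -- t)` as a length. The first moment is at most linear, so there must be particles far out on both
  -- sides.
  have hinterval : ∀ t ∈ Ioo (max t₀ l) τ, (τ - t) / (2 * n) ≤ ∑ k ∈ I, (x t k - y) ^ 2 ∧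
      |∑ k ∈ I, (x t k - y)| ≤ 2 * n / ρ * (τ - t) := by
    intro t ht
    have htt := max_lt_iff.1 ht.1
    have h0t : 0 ≤ t := ht₀.1.trans htt.1.le
    have hst : ∀ s ∈ Ico t τ, s ∈ Icc t₀ τ ∧ b s = β ∧ s ∈ Ico 0 T := fun s hs =>
      ⟨⟨htt.1.le.trans hs.1, hs.2.le⟩, hlβ ⟨htt.2.trans_le hs.1, hs.2⟩,
        h0t.trans hs.1, hs.2.trans_le hτ.2⟩
    constructor
    · have h := sub_le_of_deriv_right_le (f := fun s => ∑ k ∈ I, (x s k - y) ^ 2)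
        (f' := fun s => 2 * ∑ k ∈ I, (x s k - y) * velocity (x s) (b s) k) (C := -(1 / (2 * n)))
        ht.2.le ((E.continuousOn_sum_sq I y).mono (Icc_subset_Icc h0t hτ.2))
        (fun s hs => E.hasDerivWithinAt_sum_sq I y (hst s hs).2.2)
        (fun s hs => by
          obtain ⟨h1, h2, h3⟩ := hst s hs
          have hv := abs_virial_sub_le (E.inj s ⟨h3.1, h3.2.le⟩) y I
            (r := r) (δ := ρ / 2) (by positivity) hr0.le
            (fun k hk => by rw [← ((hImem k).1 hk).1]; exact (hclose s h1 k).le)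
            (hdist s h1 h2)
          have hr : (n : ℝ) ^ 2 * r / (ρ / 2) = 1 / 4 := by
            rw [hr]; field_simp; norm_num
          rw [h2] at hv
          have h5 : (∑ k ∈ I, (β k : ℝ)) ^ 2 ≤ 1 := by
            rw [← sq_abs]; exact pow_le_one₀ (abs_nonneg _) hnet
          have h6 := (abs_le.1 hv).2
          rw [hr] at h6
          rw [h2]
          have h7 : n * ∑ k ∈ I, (x s k - y) * velocity (x s) β k ≤ -(1 / 4) := by linarith
          rw [← le_div_iff₀' hn] at h7
          calc _ ≤ 2 * (-(1 / 4) / (n : ℝ)) := by gcongr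
            _ = _ := by field_simp; norm_num)
      have hV : ∑ k ∈ I, (x τ k - y) ^ 2 = 0 :=
        Finset.sum_eq_zero fun k hk => by rw [((hImem k).1 hk).1]; ring
      rw [hV] at h
      have : (τ - t) / (2 * n) = 1 / (2 * n) * (τ - t) := by ring
      rw [this]
      linarith
    · have h := abs_sub_le_of_abs_deriv_right_le (f := fun s => ∑ k ∈ I, (x s k - y))
        (f' := fun s => ∑ k ∈ I, velocity (x s) (b s) k) (C := 2 * n / ρ) ht.2.le
        (continuousOn_finsetSum _ fun k _ =>
          ((E.cont k).mono (Icc_subset_Icc h0t hτ.2)).sub continuousOn_const)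
        (fun s hs => HasDerivWithinAt.fun_sum fun k _ =>
          (E.deriv_right s (hst s hs).2.2 k).sub_const y)
        (fun s hs => by
          obtain ⟨h1, h2, h3⟩ := hst s hs
          refine (abs_sum_velocity_le I (by positivity) (hdist s h1 h2)).trans_eq ?_
          field_simp)
      have hV : ∑ k ∈ I, (x τ k - y) = 0 :=
        Finset.sum_eq_zero fun k hk => by rw [((hImem k).1 hk).1]; ring
      rwa [hV, zero_sub, abs_neg] at h
  -- With `a = c * √(τ - t)` the number `4 * n ^ 3 * a ^ 2` is half of the lower bound for the
  -- second moment. The witnesses are the extreme charged labels of the cluster, which do not depend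
  -- on `t` because the order persists.
  set c : ℝ := 1 / (4 * n ^ 2) with hc
  have hc0 : 0 < c := by positivity
  have hne : I.Nonempty := ⟨i₀, hiI⟩
  have hmax := (hImem _).1 (I.max'_mem hne)
  have hmin := (hImem _).1 (I.min'_mem hne)
  refine ⟨c, hc0, I.max' hne, I.min' hne, hmax.1, hmin.1, hmax.2, hmin.2, ?_⟩
  have hsmall : ∀ᶠ t in 𝓝[<] τ, √(τ - t) < n * c / (2 * n / ρ) := by
    have : Tendsto (fun t => √(τ - t)) (𝓝[<] τ) (𝓝 (√(τ - τ))) :=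
      ((by fun_prop : Continuous fun t => √(τ - t)).tendsto τ).mono_left nhdsWithin_le_nhds
    rw [sub_self, Real.sqrt_zero] at this
    exact this.eventually (gt_mem_nhds (by positivity))
  filter_upwards [hsmall, Ioo_mem_nhdsLT (max_lt ht₀.2 hl)] with t hts ht
  obtain ⟨hV, hA⟩ := hinterval t ht
  have htt := max_lt_iff.1 ht.1
  have h0t : 0 ≤ t := ht₀.1.trans htt.1.le
  have hbt : b t = β := hlβ ⟨htt.2, ht.2⟩
  have hst := hord t ⟨h0t, ht.2.le.trans hτ.2⟩
  rw [hbt] at hst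
  have hs : 0 < τ - t := sub_pos.2 ht.2
  set a := c * √(τ - t) with ha
  have hssq : √(τ - t) ^ 2 = τ - t := Real.sq_sqrt hs.le
  have h1 : |∑ k ∈ I, (x t k - y)| ≤ n * a := by
    refine hA.trans ?_
    rw [lt_div_iff₀ (by positivity)] at hts
    calc 2 * n / ρ * (τ - t) = (√(τ - t) * (2 * n / ρ)) * √(τ - t) := by
          rw [mul_right_comm, ← sq, hssq]; ring
      _ ≤ n * c * √(τ - t) := by gcongr
      _ = n * a := by rw [ha]; ring
  have h2 : 4 * n ^ 3 * a ^ 2 < ∑ k ∈ I, (x t k - y) ^ 2 := by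
    refine lt_of_lt_of_le ?_ hV
    rw [ha, mul_pow, hssq, hc]
    have : 4 * (n : ℝ) ^ 3 * ((1 / (4 * n ^ 2)) ^ 2 * (τ - t)) = (τ - t) / (4 * n) := by
      field_simp
    rw [this]
    gcongr
    norm_num
  have ha0 : 0 ≤ a := by positivity
  constructor
  · obtain ⟨k, hk, hlt⟩ := exists_lt_of_sum ha0 h1 h2
    refine hlt.trans_le (sub_le_sub_right ?_ _)
    rcases (I.le_max' k hk).eq_or_lt with h | h
    · rw [← h]
    · exact (lt_of_mem_stateSpace hst h ((hImem k).1 hk).2 hmax.2).le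
  · obtain ⟨k, hk, hlt⟩ := exists_lt_of_sum (I := I) (u := fun k => -(x t k - y)) ha0
      (by rw [Finset.sum_neg_distrib, abs_neg]; exact h1) (by simpa only [neg_sq] using h2)
    have : x t (I.min' hne) ≤ x t k := by
      rcases (I.min'_le k hk).eq_or_lt with h | h
      · rw [← h]
      · exact (lt_of_mem_stateSpace hst h hmin.2 ((hImem k).1 hk).2).le
    linarith

end Evolution

end

/-! ### Solutions and evolutions -/

section

variable {n : ℕ} {T : ℝ} {x : ℝ → Fin n → ℝ} {b : ℝ → Fin n → SignType}

theorem continuousAt_velocity {x₀ : Fin n → ℝ} {β : Fin n → SignType}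
    (hinj : ∀ i j, i ≠ j → β i ≠ 0 → β j ≠ 0 → x₀ i ≠ x₀ j) (i : Fin n) :
    ContinuousAt (fun x => velocity x β i) x₀ := by
  unfold velocity
  refine continuousAt_const.mul (tendsto_finsetSum _ fun j hj => ?_)
  by_cases hi : β i = 0
  · simp [hi]
  by_cases hj' : β j = 0
  · simp [hj']
  refine Tendsto.div tendsto_const_nhds ?_
    (sub_ne_zero.2 (hinj i j (Finset.ne_of_mem_erase hj).symm hi hj'))
  exact ((continuous_apply i).sub (continuous_apply j)).tendsto x₀

theorem chargeBefore_eq {t : ℝ} {β : Fin n → SignType} (h : ∀ᶠ s in 𝓝[<] t, b s = β) (i : Fin n) :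
    chargeBefore b i t = β i := by
  refine leftLim_eq_of_tendsto ?_
  refine tendsto_const_nhds.congr' ?_
  filter_upwards [h] with s hs
  rw [hs]

theorem eventually_notMem_finset (S : Finset ℝ) (t : ℝ) : ∀ᶠ s in 𝓝[≠] t, s ∉ S := by
  have h : ((S : Set ℝ) \ {t})ᶜ ∈ 𝓝 t :=
    (S.finite_toSet.subset sdiff_subset).isClosed.isOpen_compl.mem_nhds (by simp)
  filter_upwards [nhdsWithin_le_nhds h, self_mem_nhdsWithin] with s hs hst hsS
  exact hs ⟨hsS, hst⟩

namespace IsSolutionWith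

variable {x₀ : Fin n → ℝ} {b₀ : Fin n → SignType} {S : Finset ℝ}

theorem continuousWithinAt_of_notMem (h : IsSolutionWith T x₀ b₀ x b S) {t : ℝ}
    (ht : t ∈ Icc 0 T) (htS : t ∉ S) (i : Fin n) :
    ContinuousWithinAt (fun s => b s i) (Icc 0 T) t := by
  by_contra hcon
  exact htS (h.jump_to_neutral i t ht hcon).1

/-- Just after `t` the charges are constant and `t` is the only possible exceptional time, so the
velocity tends to its value at `t` and is the right derivative there. Just before `t` the charges
are continuous with discrete values on an interval, hence constant. -/
theorem evolution (h : IsSolutionWith T x₀ b₀ x b S) : Evolution T x b := by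
  have hinj : ∀ t ∈ Icc 0 T, ∀ i j, i ≠ j → b t i ≠ 0 → b t j ≠ 0 → x t i ≠ x t j :=
    fun t ht i j hij hi hj => ne_of_mem_stateSpace (h.mem_stateSpace t ht) hij hi hj
  have hright : ∀ t ∈ Ico 0 T, ∀ᶠ s in 𝓝[>] t, b s = b t := by
    intro t ht
    have : ∀ᶠ s in 𝓝[>] t, ∀ i, b s i = b t i := by
      rw [eventually_all]
      intro i
      have := (h.rightContinuous i t ht).mono Ioi_subset_Ici_self
      exact this.eventually_mem ((isOpen_discrete {b t i}).mem_nhds rfl)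
    exact this.mono fun s hs => funext hs
  refine ⟨h.continuousOn, ?_, hright, ?_, hinj⟩
  · intro t ht i
    obtain ⟨u, hu, huS⟩ := mem_nhdsGT_iff_exists_Ioo_subset.1
      (((eventually_notMem_finset S t).filter_mono (nhdsWithin_mono t fun s hs => ne_of_gt hs)).and
        ((hright t ht).and (Iio_mem_nhds ht.2 |> fun h => nhdsWithin_le_nhds h)))
    have hu : t < u := hu
    have hd : ∀ s ∈ Ioo t u, HasDerivAt (fun s => x s i) (velocity (x s) (b t) i) s := by
      intro s hs
      have := h.ode s ⟨⟨ht.1.trans_lt hs.1, (huS hs).2.2⟩, (huS hs).1⟩ i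
      rwa [(huS hs).2.1] at this
    refine hasDerivWithinAt_Ici_of_tendsto_deriv (s := Ioo t u)
      (fun s hs => (hd s hs).differentiableAt.differentiableWithinAt) ?_ (Ioo_mem_nhdsGT hu) ?_
    · refine (h.continuousOn i t ⟨ht.1, ht.2.le⟩).mono fun s hs => ⟨ht.1.trans hs.1.le, ?_⟩
      exact le_of_lt (huS hs).2.2
    · have h1 : Tendsto x (𝓝[>] t) (𝓝 (x t)) := by
        refine tendsto_pi_nhds.2 fun k => ?_
        have := h.continuousOn k t ⟨ht.1, ht.2.le⟩
        rw [← nhdsWithin_Ioo_eq_nhdsGT ht.2]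
        exact this.mono fun s hs => ⟨ht.1.trans hs.1.le, hs.2.le⟩
      refine ((continuousAt_velocity (hinj t ⟨ht.1, ht.2.le⟩) i).tendsto.comp h1).congr' ?_
      filter_upwards [Ioo_mem_nhdsGT hu] with s hs
      exact (hd s hs).deriv.symm
  · intro t ht
    obtain ⟨l, hl, hlS⟩ := mem_nhdsLT_iff_exists_Ioo_subset.1
      (((eventually_notMem_finset S t).filter_mono (nhdsWithin_mono t fun s hs => ne_of_lt hs)).and
        (nhdsWithin_le_nhds (Ioi_mem_nhds ht.1)))
    have hl : l < t := hl
    set m := (l + t) / 2 with hm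
    have hconst : ∀ s ∈ Ioo l t, b s = b m := by
      intro s hs
      funext i
      have hc : ContinuousOn (fun s => b s i) (Ioo l t) := fun r hr =>
        (h.continuousWithinAt_of_notMem ⟨le_of_lt (hlS hr).2, hr.2.le.trans ht.2⟩
          (hlS hr).1 i).mono fun q hq => ⟨le_of_lt (hlS hq).2, hq.2.le.trans ht.2⟩
      exact isPreconnected_Ioo.constant hc hs (show m ∈ Ioo l t from ⟨by linarith, by linarith⟩)
    have hev : ∀ᶠ s in 𝓝[<] t, b s = b m := by
      filter_upwards [Ioo_mem_nhdsLT hl] with s hs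
      exact hconst s hs
    have hcont : ∀ i, ContinuousWithinAt (fun s => b s i) (Icc 0 T) t → b t i = b m i := by
      intro i hi
      have h1 : ∀ᶠ s in 𝓝[Icc 0 T] t, b s i = b t i :=
        hi.eventually_mem ((isOpen_discrete {b t i}).mem_nhds rfl)
      have h2 : ∀ᶠ s in 𝓝[<] t, b s i = b t i := by
        rw [← nhdsWithin_Ioo_eq_nhdsLT ht.1]
        exact h1.filter_mono (nhdsWithin_mono t
          (Ioo_subset_Ico_self.trans (Ico_subset_Icc_self.trans (Icc_subset_Icc_right ht.2))))
      obtain ⟨s, hs, hs'⟩ := (h2.and hev).exists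
      rw [← hs, hs']
    refine ⟨b m, hev, fun i => ?_, fun y => ?_⟩
    · by_cases hi : JumpsAt T b i t
      · exact Or.inr (h.jump_to_neutral i t ⟨ht.1.le, ht.2⟩ hi).2.2
      · exact Or.inl (hcont i (not_not.1 hi))
    · by_cases htS : t ∈ S
      · rw [← h.annihilation_rule t htS y]
        refine Finset.sum_congr rfl fun i _ => ?_
        rw [jump, chargeBefore_eq hev]
      · refine Finset.sum_eq_zero fun i _ => ?_
        rw [hcont i (h.continuousWithinAt_of_notMem ⟨ht.1.le, ht.2⟩ htS i), sub_self]

end IsSolutionWith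

/-! ### Jump times and the return from evolutions to solutions -/

/-- Some charge jumps at time `t`. -/
def IsJumpTime (b : ℝ → Fin n → SignType) (t : ℝ) : Prop :=
  ¬ ∀ᶠ s in 𝓝[<] t, b s = b t

namespace Evolution

theorem exists_constant_right (E : Evolution T x b) {t : ℝ} (ht : t ∈ Ico 0 T) :
    ∃ q ∈ Ioc t T, ∀ s ∈ Ico t q, b s = b t := by
  obtain ⟨u, hu, huS⟩ := mem_nhdsGT_iff_exists_Ioo_subset.1 (E.charge_right t ht)
  have hu : t < u := hu
  refine ⟨min u T, ⟨lt_min hu ht.2, min_le_right _ _⟩, fun s hs => ?_⟩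
  rcases hs.1.eq_or_lt with h | h
  · rw [h]
  · exact huS ⟨h, hs.2.trans_le (min_le_left _ _)⟩

theorem exists_constant_left {t : ℝ} (ht : 0 < t) {β : Fin n → SignType}
    (hβ : ∀ᶠ s in 𝓝[<] t, b s = β) : ∃ p ∈ Ico 0 t, ∀ s ∈ Ico p t, b s = β := by
  obtain ⟨l, hl, hlS⟩ := mem_nhdsLT_iff_exists_Ioo_subset.1 hβ
  have hl : l < t := hl
  refine ⟨max 0 ((l + t) / 2), ⟨le_max_left _ _, max_lt ht (by linarith)⟩, fun s hs =>
    hlS ⟨?_, hs.2⟩⟩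
  have := (le_max_right _ _).trans hs.1
  linarith

/-- The charges are constant in a neighborhood of a time at which they do not jump. -/
theorem exists_constant (E : Evolution T x b) {t : ℝ} (ht : t ∈ Icc 0 T)
    (hJ : 0 < t → ¬ IsJumpTime b t) :
    ∃ p q, 0 ≤ p ∧ q ≤ T ∧ p ≤ t ∧ t ≤ q ∧ (0 < t → p < t) ∧ (t < T → t < q) ∧
      ∀ s ∈ Icc p q, b s = b t := by
  obtain ⟨p, hp0, hpt, hpt', hpb⟩ : ∃ p, 0 ≤ p ∧ p ≤ t ∧ (0 < t → p < t) ∧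
      ∀ s ∈ Icc p t, b s = b t := by
    rcases ht.1.eq_or_lt with h | h
    · refine ⟨0, le_rfl, ht.1, id, fun s hs => ?_⟩
      rw [le_antisymm hs.2 (h ▸ hs.1)]
    · obtain ⟨p, hp, hpb⟩ := exists_constant_left h (not_not.1 (hJ h))
      refine ⟨p, hp.1, hp.2.le, fun _ => hp.2, fun s hs => ?_⟩
      rcases hs.2.eq_or_lt with h' | h'
      · rw [h']
      · exact hpb s ⟨hs.1, h'⟩
  obtain ⟨q, hqT, htq, htq', hqb⟩ : ∃ q, q ≤ T ∧ t ≤ q ∧ (t < T → t < q) ∧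
      ∀ s ∈ Icc t q, b s = b t := by
    rcases ht.2.eq_or_lt with h | h
    · refine ⟨T, le_rfl, ht.2, id, fun s hs => ?_⟩
      rw [le_antisymm (h ▸ hs.2) hs.1]
    · obtain ⟨q, hq, hqb⟩ := E.exists_constant_right ⟨ht.1, h⟩
      refine ⟨(t + q) / 2, by linarith [hq.1, hq.2], by linarith [hq.1],
        fun _ => by linarith [hq.1],
        fun s hs => hqb s ⟨hs.1, by linarith [hs.2, hq.1]⟩⟩
  refine ⟨p, q, hp0, hqT, hpt, htq, hpt', htq', fun s hs => ?_⟩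
  rcases le_total s t with h | h
  · exact hpb s ⟨hs.1, h⟩
  · exact hqb s ⟨h, hs.2⟩

theorem jumpsAt_iff (E : Evolution T x b) {t : ℝ} (ht : t ∈ Icc 0 T) (i : Fin n) :
    JumpsAt T b i t ↔ 0 < t ∧ ∃ β : Fin n → SignType, (∀ᶠ s in 𝓝[<] t, b s = β) ∧ b t i ≠ β i := by
  constructor
  · intro hJ
    have hright : ContinuousWithinAt (fun s => b s i) (Icc t T) t := by
      rcases ht.2.eq_or_lt with h | h
      · rw [h, Icc_self]; exact continuousWithinAt_singleton
      · obtain ⟨q, hq, hqb⟩ := E.exists_constant_right ⟨ht.1, h⟩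
        refine ContinuousWithinAt.congr_of_eventuallyEq (f := fun _ => b t i)
          continuousWithinAt_const ?_ rfl
        filter_upwards [self_mem_nhdsWithin, nhdsWithin_le_nhds (Iio_mem_nhds hq.1)] with s hs hs'
        rw [hqb s ⟨hs.1, hs'⟩]
    have h0 : 0 < t := by
      refine lt_of_le_of_ne ht.1 fun h => hJ ?_
      rw [← h] at hright ⊢
      exact hright
    obtain ⟨β, h1, -, -⟩ := E.charge_left t ⟨h0, ht.2⟩
    refine ⟨h0, β, h1, fun heq => hJ ?_⟩
    rw [← Icc_union_Icc_eq_Icc ht.1 ht.2]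
    refine ContinuousWithinAt.union ?_ hright
    obtain ⟨p, hp, hpb⟩ := exists_constant_left h0 h1
    refine ContinuousWithinAt.congr_of_eventuallyEq (f := fun _ => b t i)
      continuousWithinAt_const ?_ rfl
    filter_upwards [self_mem_nhdsWithin, nhdsWithin_le_nhds (Ioi_mem_nhds hp.2)] with s hs hs'
    rcases hs.2.eq_or_lt with h | h
    · rw [h]
    · rw [hpb s ⟨le_of_lt hs', h⟩, heq]
  · rintro ⟨h0, β, h1, hne⟩ hc
    have h2 : ∀ᶠ s in 𝓝[Icc 0 T] t, b s i = b t i :=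
      hc.eventually_mem ((isOpen_discrete {b t i}).mem_nhds rfl)
    have h3 : ∀ᶠ s in 𝓝[<] t, b s i = b t i := by
      rw [← nhdsWithin_Ioo_eq_nhdsLT h0]
      exact h2.filter_mono (nhdsWithin_mono t
          (Ioo_subset_Ico_self.trans (Ico_subset_Icc_self.trans (Icc_subset_Icc_right ht.2))))
    obtain ⟨s, hs, hs'⟩ := (h3.and h1).exists
    exact hne (by rw [← hs, hs'])

theorem jumpsAt_charge (E : Evolution T x b) {t : ℝ} (ht : t ∈ Icc 0 T) {i : Fin n}
    (h : JumpsAt T b i t) : 0 < t ∧ b t i = 0 ∧ chargeBefore b i t ≠ 0 ∧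
      ∀ s ∈ Ico 0 t, b s i ≠ 0 := by
  obtain ⟨h0, β, h1, hne⟩ := (E.jumpsAt_iff ht i).1 h
  obtain ⟨β', h1', h2, -⟩ := E.charge_left t ⟨h0, ht.2⟩
  obtain rfl : β = β' := by
    obtain ⟨s, hs, hs'⟩ := (h1.and h1').exists
    rw [← hs, hs']
  have hb0 : b t i = 0 := by
    rcases h2 i with h | h
    · exact absurd h hne
    · exact h
  have hβ : β i ≠ 0 := fun h => hne (by rw [hb0, h])
  refine ⟨h0, hb0, by rwa [chargeBefore_eq h1], fun s hs hs0 => ?_⟩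
  obtain ⟨r, hr, hr'⟩ := (h1.and (show ∀ᶠ r in 𝓝[<] t, r ∈ Ioo s t from Ioo_mem_nhdsLT hs.2)).exists
  apply hβ
  rw [← hr]
  exact E.charge_eq_zero hs.1 hr'.1.le (hr'.2.le.trans ht.2) hs0

theorem exists_jumpsAt_iff (E : Evolution T x b) {t : ℝ} (ht : t ∈ Icc 0 T) :
    (∃ i, JumpsAt T b i t) ↔ 0 < t ∧ IsJumpTime b t := by
  constructor
  · rintro ⟨i, hi⟩
    obtain ⟨h0, β, h1, hne⟩ := (E.jumpsAt_iff ht i).1 hi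
    refine ⟨h0, fun h => hne ?_⟩
    obtain ⟨s, hs, hs'⟩ := (h1.and h).exists
    rw [← hs', hs]
  · rintro ⟨h0, hJ⟩
    obtain ⟨β, h1, -, -⟩ := E.charge_left t ⟨h0, ht.2⟩
    have : ∃ i, b t i ≠ β i := by
      by_contra! h
      exact hJ (by rwa [funext h])
    obtain ⟨i, hi⟩ := this
    exact ⟨i, (E.jumpsAt_iff ht i).2 ⟨h0, β, h1, hi⟩⟩

/-- A charge that has jumped is zero and stays zero, so each particle accounts for at most one time.
-/
theorem finite_jumpTimes (E : Evolution T x b) : {t | t ∈ Ioc 0 T ∧ IsJumpTime b t}.Finite := by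
  have : {t | t ∈ Ioc 0 T ∧ IsJumpTime b t} ⊆ ⋃ i : Fin n, {t | t ∈ Icc 0 T ∧ JumpsAt T b i t} := by
    rintro t ⟨ht, hJ⟩
    obtain ⟨i, hi⟩ := (E.exists_jumpsAt_iff ⟨ht.1.le, ht.2⟩).2 ⟨ht.1, hJ⟩
    exact mem_iUnion.2 ⟨i, ⟨ht.1.le, ht.2⟩, hi⟩
  refine (finite_iUnion fun i => Subsingleton.finite ?_).subset this
  have key : ∀ s ∈ Icc 0 T, ∀ t ∈ Icc 0 T, JumpsAt T b i s → JumpsAt T b i t → ¬ s < t := by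
    intro s hs t ht hJs hJt hst
    exact (E.jumpsAt_charge ht hJt).2.2.2 s ⟨hs.1, hst⟩ (E.jumpsAt_charge hs hJs).2.1
  exact fun s hs t ht => le_antisymm (not_lt.1 (key t ht.1 s hs.1 ht.2 hs.2))
    (not_lt.1 (key s hs.1 t ht.1 hs.2 ht.2))

/-- The set of times at which some charge jumps. -/
noncomputable def jumpTimes (E : Evolution T x b) : Finset ℝ :=
  E.finite_jumpTimes.toFinset

theorem mem_jumpTimes (E : Evolution T x b) {t : ℝ} :
    t ∈ E.jumpTimes ↔ t ∈ Ioc 0 T ∧ IsJumpTime b t := by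
  simp [jumpTimes]

/-- While the charges are constant the velocity is continuous in time, so the position is its
integral. Extending the velocity by its end values makes this integral continuously differentiable
on the whole line, endpoints included. -/
theorem exists_contDiff (E : Evolution T x b) {p q : ℝ} (hp : 0 ≤ p) (hpq : p ≤ q) (hq : q ≤ T)
    {β : Fin n → SignType} (hβ : ∀ s ∈ Icc p q, b s = β) (i : Fin n) :
    ∃ F : ℝ → ℝ, ContDiff ℝ 1 F ∧ ∀ s ∈ Icc p q, F s = x s i ∧
      HasDerivAt F (velocity (x s) (b s) i) s := by
  have hsub : Icc p q ⊆ Icc 0 T := Icc_subset_Icc hp hq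
  set v : ℝ → ℝ := fun s => velocity (x s) β i with hv
  have hvc : ContinuousOn v (Icc p q) := by
    intro s hs
    have h1 := E.inj s (hsub hs)
    rw [hβ s hs] at h1
    exact (continuousAt_velocity h1 i).comp_continuousWithinAt ((E.cont_pi s (hsub hs)).mono hsub)
  set w : ℝ → ℝ := IccExtend hpq ((Icc p q).domRestrict v) with hw
  have hwc : Continuous w := (continuousOn_iff_continuous_domRestrict.1 hvc).Icc_extend'
  have hwv : ∀ s ∈ Icc p q, w s = v s := fun s hs => by
    rw [hw, IccExtend_of_mem _ _ hs, domRestrict_apply]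
  have hderiv : ∀ s, HasDerivAt (fun s => x p i + ∫ r in p..s, w r) (w s) s := fun s =>
    (hwc.integral_hasStrictDerivAt p s).hasDerivAt.const_add _
  refine ⟨fun s => x p i + ∫ r in p..s, w r, ?_, fun s hs => ⟨?_, ?_⟩⟩
  · rw [contDiff_one_iff_deriv]
    refine ⟨fun s => (hderiv s).differentiableAt, ?_⟩
    rwa [funext fun s => (hderiv s).deriv]
  · have h := intervalIntegral.integral_eq_sub_of_hasDeriv_right_of_le hs.1
      ((E.cont i).mono (Icc_subset_Icc hp (hs.2.trans hq))) (f' := w) (fun r hr => by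
        have hr' : r ∈ Icc p q := ⟨hr.1.le, hr.2.le.trans hs.2⟩
        rw [hwv r hr', hv, ← hβ r hr']
        exact (E.deriv_right r ⟨hp.trans hr.1.le, (hr.2.trans_le hs.2).trans_le hq⟩ i).mono
          Ioi_subset_Ici_self) (hwc.intervalIntegrable _ _)
    simp only [h]
    ring
  · have := hderiv s
    rwa [hwv s hs, hv, ← hβ s hs] at this

theorem isSolutionWith (E : Evolution T x b) (hord : ∀ t ∈ Icc 0 T, (x t, b t) ∈ stateSpace n) :
    IsSolutionWith T (x 0) (b 0) x b E.jumpTimes where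
  times_mem τ hτ := (E.mem_jumpTimes.1 hτ).1
  mem_stateSpace := hord
  continuousOn := E.cont
  contDiffOn i t ht := by
    obtain ⟨p, q, hp, hq, hpt, htq, hpt', htq', hb⟩ := E.exists_constant ht.1
      fun h0 hJ => ht.2 (E.mem_jumpTimes.2 ⟨⟨h0, ht.1.2⟩, hJ⟩)
    obtain ⟨F, hF, hFx⟩ := E.exists_contDiff hp (hpt.trans htq) hq hb i
    refine hF.contDiffAt.contDiffWithinAt.congr_of_eventuallyEq ?_ (hFx t ⟨hpt, htq⟩).1.symm
    have h1 : ∀ᶠ s in 𝓝[Icc 0 T \ ↑E.jumpTimes] t, p ≤ s := by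
      rcases ht.1.1.eq_or_lt with h | h
      · have : p = 0 := le_antisymm (h ▸ hpt) hp
        filter_upwards [self_mem_nhdsWithin] with s hs
        rw [this]; exact hs.1.1
      · filter_upwards [nhdsWithin_le_nhds (Ioi_mem_nhds (hpt' h))] with s hs using le_of_lt hs
    have h2 : ∀ᶠ s in 𝓝[Icc 0 T \ ↑E.jumpTimes] t, s ≤ q := by
      rcases ht.1.2.eq_or_lt with h | h
      · have : q = T := le_antisymm hq (h ▸ htq)
        filter_upwards [self_mem_nhdsWithin] with s hs
        rw [this]; exact hs.1.2
      · filter_upwards [nhdsWithin_le_nhds (Iio_mem_nhds (htq' h))] with s hs using le_of_lt hs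
    filter_upwards [h1, h2] with s hs hs'
    exact (hFx s ⟨hs, hs'⟩).1.symm
  rightContinuous i t ht := by
    obtain ⟨q, hq, hqb⟩ := E.exists_constant_right ht
    refine ContinuousWithinAt.congr_of_eventuallyEq (f := fun _ => b t i)
      continuousWithinAt_const ?_ rfl
    filter_upwards [self_mem_nhdsWithin, nhdsWithin_le_nhds (Iio_mem_nhds hq.1)] with s hs hs'
    rw [hqb s ⟨hs, hs'⟩]
  initial_position := rfl
  initial_charge := rfl
  jumps_at_most_once i := by
    have key : ∀ s ∈ Icc 0 T, ∀ t ∈ Icc 0 T, JumpsAt T b i s → JumpsAt T b i t → ¬ s < t := by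
      intro s hs t ht hJs hJt hst
      exact (E.jumpsAt_charge ht hJt).2.2.2 s ⟨hs.1, hst⟩ (E.jumpsAt_charge hs hJs).2.1
    exact fun s hs t ht => le_antisymm (not_lt.1 (key t ht.1 s hs.1 ht.2 hs.2))
      (not_lt.1 (key s hs.1 t ht.1 hs.2 ht.2))
  jump_to_neutral i t ht hJ := by
    obtain ⟨h0, h1, h2, -⟩ := E.jumpsAt_charge ht hJ
    exact ⟨E.mem_jumpTimes.2 ⟨⟨h0, ht.2⟩, ((E.exists_jumpsAt_iff ht).1 ⟨i, hJ⟩).2⟩, h2, h1⟩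
  annihilation_rule τ hτ y := by
    obtain ⟨β, h1, -, h3⟩ := E.charge_left τ (E.mem_jumpTimes.1 hτ).1
    rw [← h3 y]
    refine Finset.sum_congr rfl fun i _ => ?_
    rw [jump, chargeBefore_eq h1]
  ode t ht i := by
    obtain ⟨p, q, hp, hq, hpt, htq, hpt', htq', hb⟩ := E.exists_constant ⟨ht.1.1.le, ht.1.2.le⟩
      fun h0 hJ => ht.2 (E.mem_jumpTimes.2 ⟨⟨h0, ht.1.2.le⟩, hJ⟩)
    obtain ⟨F, hF, hFx⟩ := E.exists_contDiff hp (hpt.trans htq) hq hb i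
    refine (hFx t ⟨hpt, htq⟩).2.congr_of_eventuallyEq ?_
    filter_upwards [Ioo_mem_nhds (hpt' ht.1.1) (htq' ht.1.2)] with s hs
    exact (hFx s ⟨hs.1.le, hs.2.le⟩).1.symm

end Evolution

/-- The definition of a solution forces every jump time into every admissible set, and the jump
times alone suffice. -/
theorem isMinimalTimeSet_jumpTimes {x₀ : Fin n → ℝ} {b₀ : Fin n → SignType}
    (h : IsSolution T x₀ b₀ x b) (E : Evolution T x b) :
    IsMinimalTimeSet T x₀ b₀ x b E.jumpTimes := by
  obtain ⟨S, hS⟩ := h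
  refine ⟨?_, fun S' hS' t ht => ?_⟩
  · have := E.isSolutionWith hS.mem_stateSpace
    rwa [hS.initial_position, hS.initial_charge] at this
  · obtain ⟨ht, hJ⟩ := E.mem_jumpTimes.1 ht
    obtain ⟨i, hi⟩ := (E.exists_jumpsAt_iff ⟨ht.1.le, ht.2⟩).2 ⟨ht.1, hJ⟩
    exact (hS'.jump_to_neutral i t ⟨ht.1.le, ht.2⟩ hi).1

end

/-! ### Stability between collisions and uniqueness -/

section

theorem exists_pos_forall {ι : Type*} [Finite ι] {P : ι → ℝ → Prop}
    (hmono : ∀ i a a', P i a → 0 < a' → a' ≤ a → P i a') (h : ∀ i, ∃ a > 0, P i a) :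
    ∃ a > 0, ∀ i, P i a := by
  rcases isEmpty_or_nonempty ι with hE | hE
  · exact ⟨1, one_pos, fun i => (hE.false i).elim⟩
  choose a ha hP using h
  obtain ⟨i, hi⟩ := Finite.exists_min a
  exact ⟨a i, ha i, fun j => hmono j _ _ (hP j) (ha i) (hi j)⟩

variable {n : ℕ} {T : ℝ} {x y : ℝ → Fin n → ℝ} {b c : ℝ → Fin n → SignType}

/-- The perturbed gaps are at least `g / 2` and each gap changes by at most `2 * m`, so each kernel
changes by at most `2 * m / (g * (g / 2))`. -/
theorem abs_velocity_sub_le {x y : Fin n → ℝ} {β : Fin n → SignType} {g m : ℝ} (hg : 0 < g)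
    (hx : ∀ i j, i ≠ j → β i ≠ 0 → β j ≠ 0 → g ≤ |x i - x j|) (hm : m ≤ g / 4)
    (hxy : ∀ k, |y k - x k| ≤ m) (i : Fin n) :
    |velocity y β i - velocity x β i| ≤ 4 / g ^ 2 * m := by
  have hn : (0 : ℝ) < n := by
    have := i.pos; exact_mod_cast this
  have hm0 : 0 ≤ m := (abs_nonneg _).trans (hxy i)
  have hterm : ∀ j, |(β i : ℝ) * (β j : ℝ) / (y i - y j) - (β i : ℝ) * (β j : ℝ) / (x i - x j)| ≤
      4 / g ^ 2 * m := by
    intro j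
    have h0 : 0 ≤ 4 / g ^ 2 * m := by positivity
    by_cases hij : i = j
    · simpa [hij] using h0
    by_cases hi : β i = 0
    · simpa [hi] using h0
    by_cases hj : β j = 0
    · simpa [hj] using h0
    have h1 := hx i j hij hi hj
    have h2 := abs_le.1 (hxy i)
    have h3 := abs_le.1 (hxy j)
    have h4 : |(x i - x j) - (y i - y j)| ≤ 2 * m := abs_le.2 ⟨by linarith, by linarith⟩
    have h5 : g / 2 ≤ |y i - y j| := by
      have := abs_sub_abs_le_abs_sub (x i - x j) (y i - y j)
      linarith
    have hu : x i - x j ≠ 0 := abs_pos.1 (hg.trans_le h1)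
    have hv : y i - y j ≠ 0 := abs_pos.1 (lt_of_lt_of_le (by positivity) h5)
    have he : (β i : ℝ) * (β j : ℝ) / (y i - y j) - (β i : ℝ) * (β j : ℝ) / (x i - x j) =
        (β i : ℝ) * (β j : ℝ) * ((x i - x j) - (y i - y j)) / ((x i - x j) * (y i - y j)) := by
      field_simp
    rw [he, abs_div, abs_mul ((β i : ℝ) * (β j : ℝ)), abs_mul (x i - x j),
      div_le_iff₀ (by positivity)]
    calc |(β i : ℝ) * (β j : ℝ)| * |(x i - x j) - (y i - y j)| ≤ 1 * (2 * m) :=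
          mul_le_mul (abs_coe_mul_le _ _) h4 (abs_nonneg _) zero_le_one
      _ = 4 / g ^ 2 * m * (g * (g / 2)) := by field_simp; ring
      _ ≤ _ := by gcongr
  rw [velocity_eq_sum, velocity_eq_sum, ← mul_sub, ← Finset.sum_sub_distrib, abs_mul,
    abs_of_pos (by positivity : (0 : ℝ) < 1 / n)]
  calc _ ≤ 1 / (n : ℝ) * ∑ _j : Fin n, 4 / g ^ 2 * m := by
        gcongr
        exact (Finset.abs_sum_le_sum_abs _ _).trans (Finset.sum_le_sum fun j _ => hterm j)
    _ = _ := by simp; field_simp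

namespace Evolution

theorem exists_gap (E : Evolution T x b) {s₀ t₁ : ℝ} (hs₀ : 0 ≤ s₀) (ht₁ : t₁ ≤ T)
    {β : Fin n → SignType} (hβ : ∀ r ∈ Icc s₀ t₁, b r = β) :
    ∃ g > 0, ∀ r ∈ Icc s₀ t₁, ∀ i j, i ≠ j → β i ≠ 0 → β j ≠ 0 → g ≤ |x r i - x r j| := by
  obtain ⟨g, hg, h⟩ := exists_pos_forall (ι := Fin n × Fin n) (P := fun p g =>
    ∀ r ∈ Icc s₀ t₁, p.1 ≠ p.2 → β p.1 ≠ 0 → β p.2 ≠ 0 → g ≤ |x r p.1 - x r p.2|)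
    (fun p a a' h _ haa r hr h1 h2 h3 => haa.trans (h r hr h1 h2 h3)) (by
      rintro ⟨i, j⟩
      have hsub : Icc s₀ t₁ ⊆ Icc 0 T := Icc_subset_Icc hs₀ ht₁
      by_cases hp : (i ≠ j ∧ β i ≠ 0 ∧ β j ≠ 0) ∧ (Icc s₀ t₁).Nonempty
      · obtain ⟨⟨h1, h2, h3⟩, hne⟩ := hp
        obtain ⟨r, hr, hmin⟩ := isCompact_Icc.exists_isMinOn hne
          (((E.cont i).sub (E.cont j)).abs.mono hsub)
        refine ⟨|x r i - x r j|, ?_, fun r' hr' _ _ _ => hmin hr'⟩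
        refine abs_pos.2 (sub_ne_zero.2 (E.inj r (hsub hr) i j h1 ?_ ?_))
        · rwa [hβ r hr]
        · rwa [hβ r hr]
      · exact ⟨1, one_pos, fun r hr h1 h2 h3 => absurd ⟨⟨h1, h2, h3⟩, ⟨r, hr⟩⟩ hp⟩)
  exact ⟨g, hg, fun r hr i j => h (i, j) r hr⟩

/-- Stability with respect to perturbations as long as no charge jumps. -/
theorem exists_stability (E : Evolution T x b) {s₀ t₁ : ℝ} (hs₀ : 0 ≤ s₀)
    (ht₁ : t₁ ≤ T) {β : Fin n → SignType} (hβ : ∀ r ∈ Icc s₀ t₁, b r = β) :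
    ∃ K > 0, ∃ η₀ > 0, ∀ (y : ℝ → Fin n → ℝ) (c : ℝ → Fin n → SignType), Evolution T y c →
      ∀ s ∈ Icc s₀ t₁, ∀ η ∈ Icc 0 η₀, c s = β → (∀ k, |y s k - x s k| ≤ η) →
      ∀ r ∈ Icc s t₁, c r = β ∧ ∀ k, |y r k - x r k| ≤ K * η := by
  obtain ⟨g, hg, hgap⟩ := E.exists_gap hs₀ ht₁ hβ
  -- The added `1` makes the exponential barrier strict as long as `η` is positive.
  set L : ℝ := 4 / g ^ 2 + 1 with hL
  have hL0 : 0 < L := by positivity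
  set K : ℝ := Real.exp (L * (t₁ - s₀)) with hK
  have hK0 : 0 < K := Real.exp_pos _
  refine ⟨K, hK0, g / (4 * K), by positivity, fun y c F s hs => ?_⟩
  have key : ∀ η ∈ Ioc 0 (g / (4 * K)), c s = β → (∀ k, |y s k - x s k| ≤ η) →
      ∀ r ∈ Icc s t₁, c r = β ∧ ∀ k, |y r k - x r k| ≤ K * η := by
    intro η hη hc hy
    set B : ℝ → ℝ := fun r => η * Real.exp (L * (r - s)) with hB
    have hBpos : ∀ r, 0 < B r := fun r => mul_pos hη.1 (Real.exp_pos _)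
    have hBK : ∀ r ≤ t₁, B r ≤ K * η := fun r hr => by
      rw [hB, mul_comm K]
      have : L * (r - s) ≤ L * (t₁ - s₀) := by
        refine mul_le_mul_of_nonneg_left ?_ hL0.le
        linarith [hs.1]
      exact mul_le_mul_of_nonneg_left (Real.exp_le_exp.2 this) hη.1.le
    have hKη : K * η ≤ g / 4 := by
      have := (le_div_iff₀ (by positivity)).1 hη.2
      linarith
    have hBc : Continuous B := by fun_prop
    have hind : ∀ r ∈ Icc s t₁, c r = β ∧ ∀ k, |y r k - x r k| ≤ B r := by
      refine continuous_induction ⟨hc, fun k => by simpa [hB] using hy k⟩ ?_ ?_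
      · intro r hr hP
        have hr' : r ∈ Ioc 0 T := ⟨(hs₀.trans hs.1).trans_lt hr.1, hr.2.trans ht₁⟩
        have hpos : ∀ k, |y r k - x r k| ≤ B r := fun k => by
          refine le_of_tendsto_of_tendsto (b := 𝓝[<] r)
            ((F.tendsto_left hr' k).sub (E.tendsto_left hr' k)).abs
            ((hBc.tendsto r).mono_left nhdsWithin_le_nhds) ?_
          filter_upwards [Ico_mem_nhdsLT hr.1] with q hq
          exact (hP q hq).2 k
        refine ⟨?_, hpos⟩
        obtain ⟨γ, h1, h2, h3⟩ := F.charge_left r hr'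
        obtain rfl : γ = β := by
          obtain ⟨q, hq, hq'⟩ := (h1.and (Ico_mem_nhdsLT hr.1)).exists
          rw [← hq, (hP q hq').1]
        refine charge_eq_of_injective h2 h3 fun i j hij hi hj he => ?_
        have h4 := hgap r ⟨hs.1.trans hr.1.le, hr.2⟩ i j hij hi hj
        have h5 := (hpos i).trans ((hBK r hr.2).trans hKη)
        have h6 := (hpos j).trans ((hBK r hr.2).trans hKη)
        rw [abs_le] at h5 h6
        have : |x r i - x r j| ≤ g / 2 := abs_le.2 ⟨by linarith, by linarith⟩
        linarith
      · intro r hr hP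
        have hr' : r ∈ Ico 0 T := ⟨(hs₀.trans hs.1).trans hr.1, hr.2.trans_le ht₁⟩
        obtain ⟨hcr, hyr⟩ := hP r ⟨hr.1, le_rfl⟩
        have hrI : r ∈ Icc s₀ t₁ := ⟨hs.1.trans hr.1, hr.2.le⟩
        have hev : ∀ k, ∀ᶠ q in 𝓝[>] r, |y q k - x q k| ≤ B q := by
          intro k
          have hv := abs_velocity_sub_le hg (hgap r hrI) ((hBK r hr.2.le).trans hKη) hyr k
          have hBd : HasDerivWithinAt B (L * B r) (Ici r) r := by
            have := ((((hasDerivAt_id r).sub_const s).const_mul L).exp.const_mul η)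
            refine this.hasDerivWithinAt.congr_deriv ?_
            simp [hB]; ring
          have hdiff := (F.deriv_right r hr' k).sub (E.deriv_right r hr' k)
          rw [hcr, hβ r hrI] at hdiff
          have hlt : 4 / g ^ 2 * B r < L * B r := by
            have := hBpos r
            rw [hL]; nlinarith
          have hup := eventually_nonneg_right (hBd.sub hdiff)
            (by simpa using (abs_le.1 (hyr k)).2) fun _ => by linarith [(abs_le.1 hv).2]
          have hlo := eventually_nonneg_right (hBd.add hdiff)
            (by simpa using by linarith [(abs_le.1 (hyr k)).1]) fun _ => by
              linarith [(abs_le.1 hv).1]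
          filter_upwards [hup, hlo] with q h1 h2
          simp only [Pi.sub_apply, Pi.add_apply] at h1 h2
          exact abs_le.2 ⟨by linarith, by linarith⟩
        filter_upwards [F.charge_right r hr', eventually_all.2 hev] with q hq hq'
        exact ⟨hq.trans hcr, hq'⟩
    exact fun r hr => ⟨(hind r hr).1, fun k => ((hind r hr).2 k).trans (hBK r hr.2)⟩
  intro η hη hc hy r hr
  -- The case `η = 0`, which yields uniqueness, is the limit of positive `η`.
  rcases hη.1.eq_or_lt with h0 | h0
  · subst h0
    have hle : ∀ ε > 0, c r = β ∧ ∀ k, |y r k - x r k| ≤ K * 0 + ε := by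
      intro ε hε
      have hm : min (g / (4 * K)) (ε / K) ∈ Ioc 0 (g / (4 * K)) :=
        ⟨lt_min (by positivity) (by positivity), min_le_left _ _⟩
      have := key _ hm hc (fun k => (hy k).trans hm.1.le) r hr
      refine ⟨this.1, fun k => (this.2 k).trans ?_⟩
      rw [mul_zero, zero_add]
      calc K * min (g / (4 * K)) (ε / K) ≤ K * (ε / K) := by gcongr; exact min_le_right _ _
        _ = ε := by field_simp
    exact ⟨(hle 1 one_pos).1, fun k => le_of_forall_pos_le_add fun ε hε => (hle ε hε).2 k⟩
  · exact key η ⟨h0, hη.2⟩ hc hy r hr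

end Evolution

/-! ### Matching of configurations and uniqueness -/

/-- The permutation `σ` matches the particles of two configurations. -/
def Matches (σ : Equiv.Perm (Fin n)) (x : Fin n → ℝ) (b : Fin n → SignType) (x' : Fin n → ℝ)
    (b' : Fin n → SignType) : Prop :=
  ∀ i, x' (σ i) = x i ∧ b' (σ i) = b i

/-- At most one charge sits at `y`, so these three relations determine the number of particles of
each charge from the net charge and the number of particles there. -/
theorem card_filter_charge {z : Fin n → ℝ} {c : Fin n → SignType}
    (h : ∀ i j, i ≠ j → c i ≠ 0 → c j ≠ 0 → z i ≠ z j) (y : ℝ) :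
    ((Finset.univ.filter fun k => z k = y ∧ c k = 1).card : ℤ) -
      (Finset.univ.filter fun k => z k = y ∧ c k = -1).card = ∑ k with z k = y, (c k : ℤ) ∧
    (Finset.univ.filter fun k => z k = y ∧ c k = 1).card +
      (Finset.univ.filter fun k => z k = y ∧ c k = -1).card ≤ 1 ∧
    (Finset.univ.filter fun k => z k = y ∧ c k = 1).card +
      (Finset.univ.filter fun k => z k = y ∧ c k = -1).card +
      (Finset.univ.filter fun k => z k = y ∧ c k = 0).card =
      (Finset.univ.filter fun k => z k = y).card := by
  simp only [← Finset.filter_filter]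
  set A := Finset.univ.filter fun k => z k = y with hA
  refine ⟨?_, ?_, ?_⟩
  · rw [Finset.card_filter, Finset.card_filter]
    push_cast
    rw [← Finset.sum_sub_distrib]
    refine Finset.sum_congr rfl fun k _ => ?_
    cases c k <;> simp
  · rw [← Finset.card_union_of_disjoint]
    · refine Finset.card_le_one.2 fun i hi j hj => ?_
      by_contra hij
      have hc : ∀ k ∈ A.filter (fun k => c k = 1) ∪ A.filter (fun k => c k = -1),
          z k = y ∧ c k ≠ 0 := by
        intro k hk
        rcases Finset.mem_union.1 hk with hk | hk
        · obtain ⟨hk, hk'⟩ := Finset.mem_filter.1 hk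
          exact ⟨(Finset.mem_filter.1 hk).2, by rw [hk']; decide⟩
        · obtain ⟨hk, hk'⟩ := Finset.mem_filter.1 hk
          exact ⟨(Finset.mem_filter.1 hk).2, by rw [hk']; decide⟩
      exact h i j hij (hc i hi).2 (hc j hj).2 ((hc i hi).1.trans (hc j hj).1.symm)
    · rw [Finset.disjoint_filter]
      intro k _ h1 h2
      rw [h1] at h2
      exact absurd h2 (by decide)
  · rw [Finset.card_filter, Finset.card_filter, Finset.card_filter, ← Finset.sum_add_distrib,
      ← Finset.sum_add_distrib, Finset.card_eq_sum_ones]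
    refine Finset.sum_congr rfl fun k _ => ?_
    cases c k <;> simp

/-- Two configurations with at most one charged particle at each point and equal net charges at
each point agree up to a permutation. -/
theorem exists_matches {z : Fin n → ℝ} {c c' : Fin n → SignType}
    (h : ∀ i j, i ≠ j → c i ≠ 0 → c j ≠ 0 → z i ≠ z j)
    (h' : ∀ i j, i ≠ j → c' i ≠ 0 → c' j ≠ 0 → z i ≠ z j)
    (hsum : ∀ y, ∑ k with z k = y, (c k : ℤ) = ∑ k with z k = y, (c' k : ℤ)) :
    ∃ σ, Matches σ z c z c' := by
  have hcard : ∀ p : ℝ × SignType, Fintype.card {k // (z k, c k) = p} =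
      Fintype.card {k // (z k, c' k) = p} := by
    rintro ⟨y, s⟩
    simp only [Fintype.card_subtype, Prod.mk.injEq]
    obtain ⟨h1, h2, h3⟩ := card_filter_charge h y
    obtain ⟨h1', h2', h3'⟩ := card_filter_charge h' y
    rw [hsum y, ← h1'] at h1
    rcases s.trichotomy with rfl | rfl | rfl <;> omega
  refine ⟨Equiv.ofFiberEquiv fun p => Fintype.equivOfCardEq (hcard p), fun i => ?_⟩
  have := Equiv.ofFiberEquiv_map (f := fun k => (z k, c k)) (g := fun k => (z k, c' k))
    (fun p => Fintype.equivOfCardEq (hcard p)) i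
  exact Prod.mk.injEq _ _ _ _ ▸ this

namespace Evolution

theorem constant_of_not_isJumpTime (E : Evolution T x b) {s t : ℝ} (hs : 0 ≤ s) (ht : t ≤ T)
    (h : ∀ r ∈ Ioc s t, ¬ IsJumpTime b r) : ∀ r ∈ Icc s t, b r = b s := by
  refine continuous_induction rfl ?_ ?_
  · intro r hr hP
    obtain ⟨q, hq, hq'⟩ := ((not_not.1 (h r hr)).and
      (show ∀ᶠ q in 𝓝[<] r, q ∈ Ico s r from Ico_mem_nhdsLT hr.1)).exists
    rw [← hq, hP q hq']
  · intro r hr hP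
    filter_upwards [E.charge_right r ⟨hs.trans hr.1, hr.2.trans_le ht⟩] with q hq
    rw [hq, hP r ⟨hr.1, le_rfl⟩]

/-- This is the stability estimate with initial error zero, after relabeling. -/
theorem matches_of_constant (E : Evolution T x b) (F : Evolution T y c) {s t : ℝ} (hs : 0 ≤ s)
    (hst : s ≤ t) (ht : t ≤ T) (hb : ∀ r ∈ Icc s t, b r = b s) {σ : Equiv.Perm (Fin n)}
    (hσ : Matches σ (x s) (b s) (y s) (c s)) : Matches σ (x t) (b t) (y t) (c t) := by
  obtain ⟨K, -, η₀, hη₀, h⟩ := E.exists_stability hs ht hb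
  have := h _ _ (F.relabel σ) s ⟨le_rfl, hst⟩ 0 ⟨le_rfl, hη₀.le⟩ (funext fun k => (hσ k).2)
    (fun k => by rw [(hσ k).1]; simp) t ⟨hst, le_rfl⟩
  intro k
  constructor
  · have h2 := this.2 k
    rw [mul_zero] at h2
    exact sub_eq_zero.1 (abs_nonpos_iff.1 h2)
  · rw [hb t ⟨hst, le_rfl⟩, ← this.1]

/-- Uniqueness of evolutions up to relabeling, at a fixed time. -/
theorem exists_matches (E : Evolution T x b) (F : Evolution T y c) (h0 : x 0 = y 0)
    (h0' : b 0 = c 0) {t : ℝ} (ht : t ∈ Icc 0 T) : ∃ σ, Matches σ (x t) (b t) (y t) (c t) := by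
  refine continuous_induction (P := fun t => ∃ σ, Matches σ (x t) (b t) (y t) (c t))
    ⟨1, fun i => by simp [h0, h0']⟩ ?_ ?_ t ht
  · intro t ht hP
    obtain ⟨β, h1, h2, h3⟩ := E.charge_left t ht
    obtain ⟨p, hp, hpb⟩ := exists_constant_left ht.1 h1
    obtain ⟨σ, hσ⟩ := hP p hp
    have hm : ∀ r ∈ Ico p t, Matches σ (x r) (b r) (y r) (c r) := fun r hr =>
      E.matches_of_constant F hp.1 hr.1 (hr.2.le.trans ht.2) (fun q hq => by
        rw [hpb q ⟨hq.1, hq.2.trans_lt hr.2⟩, hpb p ⟨le_rfl, hp.2⟩]) hσ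
    have F' := F.relabel σ
    have hx : ∀ k, y t (σ k) = x t k := fun k => by
      refine tendsto_nhds_unique (F'.tendsto_left ht k) ((E.tendsto_left ht k).congr' ?_)
      filter_upwards [Ico_mem_nhdsLT hp.2] with r hr
      exact (hm r hr k).1.symm
    obtain ⟨γ, g1, g2, g3⟩ := F'.charge_left t ht
    obtain rfl : γ = β := by
      obtain ⟨r, hr, hr'⟩ := (g1.and (show ∀ᶠ r in 𝓝[<] t, r ∈ Ico p t from
        Ico_mem_nhdsLT hp.2)).exists
      rw [← hr, ← hpb r hr']
      exact funext fun k => (hm r hr' k).2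
    -- Both evolutions come from the same charges at the same limit positions and conserve the net
    -- charge at each point. They may only differ in which particle survives, so the permutation is
    -- changed at this time.
    obtain ⟨ρ, hρ⟩ := AnnihilatingParticles.exists_matches (z := x t) (c := b t)
      (c' := fun k => c t (σ k)) (E.inj t ⟨ht.1.le, ht.2⟩) (fun i j hij hi hj => by
        rw [← hx i, ← hx j]
        exact F'.inj t ⟨ht.1.le, ht.2⟩ i j hij hi hj) (fun z => by
        have e1 := h3 z
        have e2 := g3 z
        simp only [hx] at e2
        rw [Finset.sum_sub_distrib, sub_eq_zero] at e1 e2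
        rw [e1, e2])
    refine ⟨ρ.trans σ, fun k => ⟨?_, (hρ k).2⟩⟩
    rw [Equiv.trans_apply, hx, (hρ k).1]
  · intro t ht hP
    obtain ⟨σ, hσ⟩ := hP t ⟨ht.1, le_rfl⟩
    obtain ⟨q, hq, hqb⟩ := E.exists_constant_right ht
    filter_upwards [Ioo_mem_nhdsGT hq.1] with r hr
    exact ⟨σ, E.matches_of_constant F ht.1 hr.1.le (hr.2.le.trans hq.2)
      (fun s hs => hqb s ⟨hs.1, hs.2.trans_lt hr.2⟩) hσ⟩

theorem not_isJumpTime_of_matches (E : Evolution T x b) (F : Evolution T y c) (h0 : x 0 = y 0)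
    (h0' : b 0 = c 0) {t : ℝ} (ht : t ∈ Ioc 0 T) (h : ¬ IsJumpTime b t) : ¬ IsJumpTime c t := by
  obtain ⟨p, hp, hpb⟩ := exists_constant_left ht.1 (not_not.1 h)
  obtain ⟨σ, hσ⟩ := E.exists_matches F h0 h0' ⟨hp.1, hp.2.le.trans ht.2⟩
  have hpb' : ∀ r ∈ Icc p t, b r = b t := fun r hr => by
    rcases hr.2.eq_or_lt with h | h
    · rw [h]
    · exact hpb r ⟨hr.1, h⟩
  have hm : ∀ r ∈ Icc p t, Matches σ (x r) (b r) (y r) (c r) := fun r hr =>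
    E.matches_of_constant F hp.1 hr.1 (hr.2.trans ht.2) (fun q hq => by
      rw [hpb' q ⟨hq.1, hq.2.trans hr.2⟩, hpb' p ⟨le_rfl, hp.2.le⟩]) hσ
  refine not_not.2 ?_
  filter_upwards [Ico_mem_nhdsLT hp.2] with r hr
  funext k
  have h1 := (hm r ⟨hr.1, hr.2.le⟩ (σ.symm k)).2
  have h2 := (hm t ⟨hp.2.le, le_rfl⟩ (σ.symm k)).2
  rw [Equiv.apply_symm_apply] at h1 h2
  rw [h1, h2, hpb' r ⟨hr.1, hr.2.le⟩]

theorem jumpTimes_eq (E : Evolution T x b) (F : Evolution T y c) (h0 : x 0 = y 0)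
    (h0' : b 0 = c 0) : E.jumpTimes = F.jumpTimes := by
  ext t
  rw [E.mem_jumpTimes, F.mem_jumpTimes]
  refine and_congr_right fun ht => ?_
  rw [← not_iff_not]
  exact ⟨E.not_isJumpTime_of_matches F h0 h0' ht,
    F.not_isJumpTime_of_matches E h0.symm h0'.symm ht⟩

theorem eqModRelabeling (E : Evolution T x b) (F : Evolution T y c) (h0 : x 0 = y 0)
    (h0' : b 0 = c 0) : EqModRelabeling T E.jumpTimes x b y c := by
  classical
  have hex : ∀ t, ∃ σ : Equiv.Perm (Fin n), t ∈ Icc 0 T → Matches σ (x t) (b t) (y t) (c t) := by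
    intro t
    by_cases ht : t ∈ Icc 0 T
    · obtain ⟨σ, hσ⟩ := E.exists_matches F h0 h0' ht
      exact ⟨σ, fun _ => hσ⟩
    · exact ⟨1, fun h => absurd h ht⟩
  choose σ hσ using hex
  -- The permutation at `t` is the one chosen at the last jump time up to `t`, or at `0` if there is
  -- none. It is thus constant between jumps.
  set A : ℝ → Finset ℝ := fun t => insert 0 (E.jumpTimes.filter fun τ => τ ≤ t) with hA
  have hne : ∀ t, (A t).Nonempty := fun t => Finset.insert_nonempty _ _
  refine ⟨fun t => σ ((A t).max' (hne t)), fun s hs t ht hno => ?_, fun t ht => ?_⟩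
  · have : A t = A s := by
      simp only [hA]
      congr 1
      refine Finset.filter_congr fun τ hτ => ⟨fun h => ?_, fun h => h.trans ht.1⟩
      by_contra hcon
      exact hno τ hτ ⟨not_le.1 hcon, h⟩
    simp only [this]
  · set l := (A t).max' (hne t) with hl
    have hlmem : l ∈ A t := Finset.max'_mem _ _
    have hl0 : 0 ≤ l := Finset.le_max' _ _ (Finset.mem_insert_self _ _)
    have hlt : l ≤ t := by
      rcases Finset.mem_insert.1 hlmem with h | h
      · rw [h]; exact ht.1
      · exact (Finset.mem_filter.1 h).2
    refine E.matches_of_constant F hl0 hlt ht.2 (E.constant_of_not_isJumpTime hl0 ht.2 ?_)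
      (hσ l ⟨hl0, hlt.trans ht.2⟩)
    intro r hr hJ
    have : r ∈ A t := Finset.mem_insert_of_mem (Finset.mem_filter.2
      ⟨E.mem_jumpTimes.2 ⟨⟨hl0.trans_lt hr.1, hr.2.trans ht.2⟩, hJ⟩, hr.2⟩)
    exact absurd (Finset.le_max' _ _ this) (not_le.2 hr.1)

end Evolution

end

/-! ### Stability through collisions -/

section

variable {n : ℕ} {T : ℝ} {x y : ℝ → Fin n → ℝ} {b c : ℝ → Fin n → SignType}

theorem half_le_abs_sub {z u : Fin n → ℝ} {ρ : ℝ} (hsep : ∀ k l, z k ≠ z l → ρ ≤ |z k - z l|)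
    (hclose : ∀ k, |u k - z k| ≤ ρ / 4) {k l : Fin n} (hkl : z k ≠ z l) : ρ / 2 ≤ |u k - u l| := by
  have h1 := hsep k l hkl
  have h2 := abs_le.1 (hclose k)
  have h3 := abs_le.1 (hclose l)
  rcases le_abs.1 h1 with h | h
  · exact le_abs.2 (Or.inl (by linarith))
  · exact le_abs.2 (Or.inr (by linarith))

theorem abs_two_mul_virial_le {u : Fin n → ℝ} {β : Fin n → SignType}
    (hinj : ∀ i j, i ≠ j → β i ≠ 0 → β j ≠ 0 → u i ≠ u j) {v : ℝ} {I : Finset (Fin n)} {r δ : ℝ}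
    (hδ : 0 < δ) (hr : 0 ≤ r) (ha : ∀ k ∈ I, |u k - v| ≤ r)
    (hI : ∀ k ∈ I, ∀ l ∉ I, β l ≠ 0 → δ ≤ |u k - u l|) :
    |2 * ∑ k ∈ I, (u k - v) * velocity u β k| ≤ 2 * ((n ^ 2 + n + n ^ 2 * r / δ) / n) := by
  rcases Nat.eq_zero_or_pos n with rfl | hn
  · simp [Finset.eq_empty_of_isEmpty I]
  have hn : (0 : ℝ) < n := by exact_mod_cast hn
  have hv := abs_virial_sub_le hinj v I hδ hr ha hI
  have hs1 := sum_sq_charge_le (c := β) I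
  have hs2 := abs_sum_charge_le (c := β) I
  have hs3 : (∑ k ∈ I, (β k : ℝ)) ^ 2 ≤ n ^ 2 := by
    rw [← sq_abs]; gcongr
  have hs4 : 0 ≤ ∑ k ∈ I, (β k : ℝ) ^ 2 := Finset.sum_nonneg fun _ _ => sq_nonneg _
  have hs5 := sq_nonneg (∑ k ∈ I, (β k : ℝ))
  have hv' := abs_le.1 hv
  set Q := ∑ k ∈ I, (u k - v) * velocity u β k
  have : |n * Q| ≤ n ^ 2 + n + n ^ 2 * r / δ := abs_le.2 ⟨by linarith, by linarith⟩
  rw [abs_mul, abs_of_pos hn] at this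
  rw [abs_mul, abs_of_pos two_pos]
  gcongr
  rw [le_div_iff₀ hn]
  linarith

/-- The net charge contributes at most one and the single charges at least two, so `n` times the
virial is at most `(1 - 2) / 2 + 1 / 4 = -1 / 4`. -/
theorem two_mul_virial_le {u : Fin n → ℝ} {β : Fin n → SignType}
    (hinj : ∀ i j, i ≠ j → β i ≠ 0 → β j ≠ 0 → u i ≠ u j) {v : ℝ} {I : Finset (Fin n)} {r δ : ℝ}
    (hδ : 0 < δ) (hr : 0 ≤ r) (ha : ∀ k ∈ I, |u k - v| ≤ r)
    (hI : ∀ k ∈ I, ∀ l ∉ I, β l ≠ 0 → δ ≤ |u k - u l|) (hrδ : n ^ 2 * r / δ ≤ 1 / 4)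
    (hnet : |∑ k ∈ I, (β k : ℝ)| ≤ 1) (htwo : 2 ≤ ∑ k ∈ I, (β k : ℝ) ^ 2) :
    2 * ∑ k ∈ I, (u k - v) * velocity u β k ≤ -(1 / (2 * n)) := by
  rcases Nat.eq_zero_or_pos n with rfl | hn
  · simp [Finset.eq_empty_of_isEmpty I] at htwo
    norm_num at htwo
  have hn : (0 : ℝ) < n := by exact_mod_cast hn
  have hv := abs_virial_sub_le hinj v I hδ hr ha hI
  have h5 : (∑ k ∈ I, (β k : ℝ)) ^ 2 ≤ 1 := by
    rw [← sq_abs]; exact pow_le_one₀ (abs_nonneg _) hnet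
  have h6 := (abs_le.1 hv).2
  have h7 : n * ∑ k ∈ I, (u k - v) * velocity u β k ≤ -(1 / 4) := by linarith
  rw [← le_div_iff₀' hn] at h7
  calc _ ≤ 2 * (-(1 / 4) / (n : ℝ)) := by gcongr
    _ = _ := by field_simp; norm_num

theorem two_le_sum_sq {β : Fin n → SignType} {I : Finset (Fin n)} {i j : Fin n} (hi : i ∈ I)
    (hj : j ∈ I) (hij : i ≠ j) (hβi : β i ≠ 0) (hβj : β j ≠ 0) :
    (2 : ℝ) ≤ ∑ k ∈ I, (β k : ℝ) ^ 2 := by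
  have hsub : ({i, j} : Finset (Fin n)) ⊆ I := by
    intro k hk
    rcases Finset.mem_insert.1 hk with rfl | hk
    · exact hi
    · rw [Finset.mem_singleton.1 hk]; exact hj
  calc (2 : ℝ) = ∑ k ∈ {i, j}, (β k : ℝ) ^ 2 := by
        rw [Finset.sum_pair hij, sq, sq, coe_mul_self hβi, coe_mul_self hβj]
        norm_num
    _ ≤ _ := Finset.sum_le_sum_of_subset_of_nonneg hsub fun _ _ _ => sq_nonneg _

namespace Evolution

/-- The net charge of the particles at a point is at most one. -/
theorem abs_net_le_one (E : Evolution T x b) {τ : ℝ} (hτ : τ ∈ Icc 0 T) (z : ℝ) :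
    |∑ k with x τ k = z, (b τ k : ℤ)| ≤ 1 :=
  abs_sum_le_one fun k hk l hl hkl => by
    by_contra! h
    refine E.inj τ hτ k l hkl h.1 h.2 ?_
    rw [(Finset.mem_filter.1 hk).2, (Finset.mem_filter.1 hl).2]

/-- An evolution which is close to `(x, b)` shortly before a collision is close to `(x, b)` modulo
relabeling shortly after the collision. -/
theorem exists_stability_collision (E : Evolution T x b) {τ : ℝ} (hτ : τ ∈ Ioo 0 T) {ε d : ℝ}
    (hε : 0 < ε) (hd : 0 < d) : ∃ s ∈ Ioo (τ - d) τ, ∃ t ∈ Ioo τ (τ + d), 0 ≤ s ∧ t ≤ T ∧ ∃ η > 0,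
      ∀ (y : ℝ → Fin n → ℝ) (c : ℝ → Fin n → SignType), Evolution T y c → c s = b s →
      (∀ k, |y s k - x s k| ≤ η) →
      ∃ σ : Equiv.Perm (Fin n), ∀ k, c t (σ k) = b τ k ∧ |y t (σ k) - x τ k| ≤ ε := by
  have hτ' : τ ∈ Ioc 0 T := ⟨hτ.1, hτ.2.le⟩
  rcases Nat.eq_zero_or_pos n with rfl | hn
  · obtain ⟨s, hs⟩ := exists_between (max_lt hτ.1 (by linarith : τ - d < τ))
    obtain ⟨t, ht⟩ := exists_between (lt_min hτ.2 (by linarith : τ < τ + d))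
    exact ⟨s, ⟨(le_max_right _ _).trans_lt hs.1, hs.2⟩, t, ⟨ht.1, ht.2.trans_le (min_le_right _ _)⟩,
      ((le_max_left _ _).trans_lt hs.1).le, (ht.2.trans_le (min_le_left _ _)).le, 1, one_pos,
      fun _ _ _ _ _ => ⟨1, fun k => k.elim0⟩⟩
  have hn0 : (0 : ℝ) < n := by exact_mod_cast hn
  have hn1 : (1 : ℝ) ≤ n := by exact_mod_cast hn
  obtain ⟨ρ, hρ, hsep⟩ := exists_separation (x τ)
  obtain ⟨β, hβ, -, hβsum⟩ := E.charge_left τ hτ'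
  obtain ⟨p, hp, hpβ⟩ := exists_constant_left hτ.1 hβ
  -- The radius is at most `ε` and small enough that the outside contributes at most `1 / 4` to `n`
  -- times the virial.
  set r : ℝ := min ε (ρ / (8 * n ^ 2)) with hr
  have hr0 : 0 < r := lt_min hε (by positivity)
  have hrρ : r ≤ ρ / 4 := (min_le_right _ _).trans (by
    refine div_le_div_of_nonneg_left hρ.le (by norm_num) ?_
    nlinarith)
  have hrδ : (n : ℝ) ^ 2 * r / (ρ / 2) ≤ 1 / 4 := by
    rw [div_le_iff₀ (by positivity)]
    calc (n : ℝ) ^ 2 * r ≤ n ^ 2 * (ρ / (8 * n ^ 2)) := by gcongr; exact min_le_right _ _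
      _ = 1 / 4 * (ρ / 2) := by field_simp; norm_num
  set C : ℝ := 2 * ((n ^ 2 + n + n ^ 2 * r / (ρ / 2)) / n) with hC
  have hC0 : 0 ≤ C := by positivity
  -- From `s ≥ τ - h / 2` to `t = τ + h` less than `2 * h` elapses, so a second moment growing at
  -- the rate `C + 1` gains at most `r ^ 2 / 2`.
  set h : ℝ := min (r ^ 2 / (4 * (C + 1))) (min (d / 2) (T - τ)) with hh
  have hh0 : 0 < h := lt_min (by positivity) (lt_min (by positivity) (by linarith [hτ.2]))
  have hhr : (C + 1) * (2 * h) ≤ r ^ 2 / 2 := by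
    have : h ≤ r ^ 2 / (4 * (C + 1)) := min_le_left _ _
    rw [le_div_iff₀ (by positivity)] at this
    linarith
  have hhd : h ≤ d / 2 := (min_le_right _ _).trans (min_le_left _ _)
  have hhT : h ≤ T - τ := (min_le_right _ _).trans (min_le_right _ _)
  -- Particles within `2 * a` of the collision point have a second moment below `r ^ 2 / 2`, which
  -- keeps the cluster within radius `r`, and below `h / (4 * n)`, which contraction uses up within
  -- time `h`.
  obtain ⟨a, ha0, har⟩ : ∃ a > 0, n * (2 * a) ^ 2 < min (r ^ 2 / 2) (h / (4 * n)) := by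
    have h1 : Tendsto (fun a : ℝ => n * (2 * a) ^ 2) (𝓝[>] 0) (𝓝 0) := by
      have : Continuous fun a : ℝ => n * (2 * a) ^ 2 := by fun_prop
      simpa using (this.tendsto 0).mono_left (nhdsWithin_le_nhds (s := Ioi 0))
    obtain ⟨a, ha, ha'⟩ := ((h1.eventually (gt_mem_nhds (lt_min (by positivity)
      (by positivity) : (0 : ℝ) < min (r ^ 2 / 2) (h / (4 * n))))).and self_mem_nhdsWithin).exists
    exact ⟨a, ha', ha⟩
  obtain ⟨t₀, ht₀, hclose⟩ := E.eventually_close_left hτ' ha0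
  set s : ℝ := max (max t₀ p) (τ - h / 2) with hs
  have hsτ : s < τ := max_lt (max_lt ht₀.2 hp.2) (by linarith)
  have hst₀ : t₀ ≤ s := (le_max_left _ _).trans (le_max_left _ _)
  have hps : p ≤ s := (le_max_right _ _).trans (le_max_left _ _)
  have hhs : τ - h / 2 ≤ s := le_max_right _ _
  have hs0 : 0 ≤ s := ht₀.1.trans hst₀
  set t : ℝ := τ + h with ht
  have htT : t ≤ T := by linarith
  refine ⟨s, ⟨by linarith, hsτ⟩, t, ⟨by linarith, by linarith⟩, hs0, htT, a, ha0, ?_⟩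
  intro y c F hcs hys
  have hbs : b s = β := hpβ s ⟨hps, hsτ⟩
  set I : Fin n → Finset (Fin n) := fun i => Finset.univ.filter fun k => x τ k = x τ i with hI
  have hImem : ∀ i k, k ∈ I i ↔ x τ k = x τ i := fun i k => by simp [hI]
  have hVs : ∀ i, ∑ k ∈ I i, (y s k - x τ i) ^ 2 < min (r ^ 2 / 2) (h / (4 * n)) := by
    intro i
    refine lt_of_le_of_lt ?_ har
    calc _ ≤ ∑ _k ∈ I i, (2 * a) ^ 2 := Finset.sum_le_sum fun k hk => by
          rw [← sq_abs]
          have h1 := hys k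
          have h2 := (hclose s ⟨hst₀, hsτ.le⟩ k).le
          rw [(hImem i k).1 hk] at h2
          have : |y s k - x τ i| ≤ 2 * a := by
            rw [abs_le] at *; exact ⟨by linarith, by linarith⟩
          gcongr
      _ = (I i).card * (2 * a) ^ 2 := by simp
      _ ≤ _ := by
        have := (I i).card_le_univ
        rw [Fintype.card_fin] at this
        gcongr
  have hnet₀ : ∀ i, ∑ k ∈ I i, (b s k : ℤ) = ∑ k ∈ I i, (b τ k : ℤ) := by
    intro i
    have := hβsum (x τ i)
    rw [Finset.sum_sub_distrib, sub_eq_zero] at this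
    rw [hbs, this]
  have hrad : ∀ q ∈ Icc s t, (∀ i, ∑ k ∈ I i, (y q k - x τ i) ^ 2 ≤
      r ^ 2 / 2 + (C + 1) * (q - s)) → ∀ k, |y q k - x τ k| ≤ r := by
    intro q hq hV k
    have h1 : (y q k - x τ k) ^ 2 ≤ ∑ l ∈ I k, (y q l - x τ k) ^ 2 :=
      Finset.single_le_sum (f := fun l => (y q l - x τ k) ^ 2) (fun _ _ => sq_nonneg _)
        ((hImem k k).2 rfl)
    have h2 : (C + 1) * (q - s) ≤ (C + 1) * (2 * h) := by
      gcongr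
      linarith [hq.2]
    exact abs_le_of_sq_le_sq (by linarith [hV k]) hr0.le
  have hdist : ∀ q, (∀ k, |y q k - x τ k| ≤ r) → ∀ i, ∀ k ∈ I i, ∀ l ∉ I i, c q l ≠ 0 →
      ρ / 2 ≤ |y q k - y q l| := by
    intro q hq i k hk l hl _
    rw [hImem] at hk hl
    exact half_le_abs_sub hsep (fun k => (hq k).trans hrρ) (by rw [hk]; exact fun h => hl h.symm)
  -- The clusters stay small and hence apart from each other. Charges can then cancel only within a
  -- cluster, so its net charge is preserved.
  have hmain : ∀ q ∈ Icc s t,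
      (∀ i, ∑ k ∈ I i, (y q k - x τ i) ^ 2 ≤ r ^ 2 / 2 + (C + 1) * (q - s)) ∧
      ∀ i, ∑ k ∈ I i, (c q k : ℤ) = ∑ k ∈ I i, (b τ k : ℤ) := by
    refine continuous_induction ⟨fun i => ?_, fun i => ?_⟩ ?_ ?_
    · rw [sub_self, mul_zero, add_zero]
      exact ((hVs i).trans_le (min_le_left _ _)).le
    · rw [hcs, hnet₀]
    · intro q hq hP
      have hq' : q ∈ Ioc 0 T := ⟨hs0.trans_lt hq.1, hq.2.trans htT⟩
      have hV : ∀ i, ∑ k ∈ I i, (y q k - x τ i) ^ 2 ≤ r ^ 2 / 2 + (C + 1) * (q - s) := by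
        intro i
        refine le_of_tendsto_of_tendsto (b := 𝓝[<] q)
          (f := fun q => ∑ k ∈ I i, (y q k - x τ i) ^ 2)
          (g := fun q => r ^ 2 / 2 + (C + 1) * (q - s)) ?_ ?_ ?_
        · exact tendsto_finsetSum _ fun k _ => ((F.tendsto_left hq' k).sub_const _).pow 2
        · exact ((by fun_prop : Continuous fun q => r ^ 2 / 2 + (C + 1) * (q - s)).tendsto
            q).mono_left nhdsWithin_le_nhds
        · filter_upwards [Ico_mem_nhdsLT hq.1] with u hu
          exact (hP u hu).1 i
      refine ⟨hV, fun i => ?_⟩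
      have hyr := hrad q ⟨hq.1.le, hq.2⟩ hV
      obtain ⟨γ, g1, -, g3⟩ := F.charge_left q hq'
      obtain ⟨u, hu, hu'⟩ := (g1.and (show ∀ᶠ u in 𝓝[<] q, u ∈ Ico s q from
        Ico_mem_nhdsLT hq.1)).exists
      rw [← (hP u hu').2 i, hu]
      have := sum_saturated g3 (I i) fun k hk l hl => by
        rw [hImem] at *
        by_contra hne
        have h1 := half_le_abs_sub hsep (fun k => (hyr k).trans hrρ) (k := l) (l := k)
          (by rw [hk]; exact hne)
        rw [hl, sub_self, abs_zero] at h1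
        linarith
      rwa [Finset.sum_sub_distrib, sub_eq_zero] at this
    · intro q hq hP
      have hq' : q ∈ Ico 0 T := ⟨hs0.trans hq.1, hq.2.trans_le htT⟩
      obtain ⟨hV, hnet⟩ := hP q ⟨hq.1, le_rfl⟩
      have hyr := hrad q ⟨hq.1, hq.2.le⟩ hV
      have hev : ∀ i, ∀ᶠ u in 𝓝[>] q,
          0 ≤ r ^ 2 / 2 + (C + 1) * (u - s) - ∑ k ∈ I i, (y u k - x τ i) ^ 2 := by
        intro i
        have hder := abs_two_mul_virial_le (F.inj q ⟨hq'.1, hq'.2.le⟩) (v := x τ i) (I := I i)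
          (r := r) (δ := ρ / 2) (by positivity) hr0.le
          (fun k hk => by rw [← (hImem i k).1 hk]; exact hyr k) (hdist q hyr i)
        have hB := ((((hasDerivAt_id q).sub_const s).const_mul (C + 1)).const_add
          (r ^ 2 / 2)).hasDerivWithinAt (s := Ici q)
        refine eventually_nonneg_right (hB.sub (F.hasDerivWithinAt_sum_sq (I i) (x τ i) hq')) ?_ ?_
        · exact sub_nonneg.2 (hV i)
        · intro _
          have := (abs_le.1 hder).2
          linarith
      filter_upwards [F.charge_right q hq', eventually_all.2 hev] with u hu hu'
      exact ⟨fun i => sub_nonneg.1 (hu' i), by rwa [hu]⟩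
  have htmem : t ∈ Icc s t := ⟨by linarith, le_rfl⟩
  have hyt := hrad t htmem (hmain t htmem).1
  -- Two charges left in a cluster at `t` were charged since `s`. The second moment would have
  -- decreased at the rate `1 / (2 * n)` for a time at least `h` and become negative.
  have hinj : ∀ i j, i ≠ j → c t i ≠ 0 → c t j ≠ 0 → x τ i ≠ x τ j := by
    intro i j hij hi hj he
    have hle := sub_le_of_deriv_right_le (f := fun q => ∑ k ∈ I i, (y q k - x τ i) ^ 2)
      (f' := fun q => 2 * ∑ k ∈ I i, (y q k - x τ i) * velocity (y q) (c q) k)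
      (C := -(1 / (2 * n))) htmem.1
      ((F.continuousOn_sum_sq (I i) (x τ i)).mono (Icc_subset_Icc hs0 htT))
      (fun q hq => F.hasDerivWithinAt_sum_sq _ _ ⟨hs0.trans hq.1, hq.2.trans_le htT⟩)
      (fun q hq => by
        have hqI : q ∈ Icc s t := ⟨hq.1, hq.2.le⟩
        obtain ⟨hV, hnet⟩ := hmain q hqI
        have hyr := hrad q hqI hV
        refine two_mul_virial_le (F.inj q ⟨hs0.trans hq.1, hq.2.le.trans htT⟩) (r := r)
          (δ := ρ / 2) (by positivity) hr0.le
          (fun k hk => by rw [← (hImem i k).1 hk]; exact hyr k) (hdist q hyr i) hrδ ?_ ?_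
        · have h1 := E.abs_net_le_one ⟨hτ.1.le, hτ.2.le⟩ (x τ i)
          rw [← hnet i] at h1
          have : ((|∑ k ∈ I i, (c q k : ℤ)| : ℤ) : ℝ) ≤ 1 := by exact_mod_cast h1
          simpa using this
        · refine two_le_sum_sq ((hImem i i).2 rfl) ((hImem i j).2 he.symm) hij ?_ ?_
          · rwa [F.charge_ne_zero (hs0.trans hq.1) hq.2.le htT hi]
          · rwa [F.charge_ne_zero (hs0.trans hq.1) hq.2.le htT hj])
    have h1 := (hVs i).trans_le (min_le_right _ _)
    have h2 : 0 ≤ ∑ k ∈ I i, (y t k - x τ i) ^ 2 := Finset.sum_nonneg fun _ _ => sq_nonneg _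
    have h3 : 1 / (2 * (n : ℝ)) * h ≤ 1 / (2 * n) * (t - s) := by
      gcongr
      linarith
    have h4 : 1 / (2 * (n : ℝ)) * h = 2 * (h / (4 * n)) := by field_simp; norm_num
    have h5 : 0 < h / (4 * n) := by positivity
    linarith
  obtain ⟨σ, hσ⟩ := AnnihilatingParticles.exists_matches (z := x τ) (c := b τ) (c' := c t)
    (E.inj τ ⟨hτ.1.le, hτ.2.le⟩) hinj (fun z => by
      by_cases hz : ∃ i, x τ i = z
      · obtain ⟨i, rfl⟩ := hz
        exact ((hmain t htmem).2 i).symm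
      · push Not at hz
        rw [Finset.filter_false_of_mem fun k _ => hz k]
        simp)
  refine ⟨σ, fun k => ⟨(hσ k).2, ?_⟩⟩
  rw [← (hσ k).1]
  exact (hyt (σ k)).trans (min_le_left _ _)

/-! ### Convergence for convergent initial positions -/

/-- `(y, c)` is close to `(x, b)` modulo relabeling. -/
def _root_.AnnihilatingParticles.CloseModRelabeling (ε : ℝ) (x : Fin n → ℝ) (b : Fin n → SignType)
    (y : Fin n → ℝ) (c : Fin n → SignType) : Prop :=
  ∃ σ : Equiv.Perm (Fin n), ∀ i, c (σ i) = b i ∧ |y (σ i) - x i| < ε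

variable {ym : ℕ → ℝ → Fin n → ℝ} {cm : ℕ → ℝ → Fin n → SignType}

theorem eventually_close_of_constant (E : Evolution T x b) (F : ∀ m, Evolution T (ym m) (cm m))
    {s t : ℝ} (hs : 0 ≤ s) (hst : s ≤ t) (ht : t ≤ T) (hb : ∀ r ∈ Icc s t, b r = b s)
    (h : ∀ ε > 0, ∀ᶠ m in atTop, CloseModRelabeling ε (x s) (b s) (ym m s) (cm m s)) {ε : ℝ}
    (hε : 0 < ε) :
    ∀ᶠ m in atTop, ∀ r ∈ Icc s t, CloseModRelabeling ε (x r) (b r) (ym m r) (cm m r) := by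
  obtain ⟨K, hK, η₀, hη₀, hstab⟩ := E.exists_stability hs ht hb
  filter_upwards [h (min η₀ (ε / (2 * K))) (lt_min hη₀ (by positivity))] with m hm r hr
  obtain ⟨σ, hσ⟩ := hm
  have := hstab _ _ ((F m).relabel σ) s ⟨le_rfl, hst⟩ (min η₀ (ε / (2 * K)))
    ⟨(lt_min hη₀ (by positivity)).le, min_le_left _ _⟩ (funext fun k => (hσ k).1)
    (fun k => (hσ k).2.le) r hr
  refine ⟨σ, fun k => ⟨?_, ?_⟩⟩
  · rw [hb r hr, ← this.1]
  · refine (this.2 k).trans_lt ?_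
    calc K * min η₀ (ε / (2 * K)) ≤ K * (ε / (2 * K)) := by gcongr; exact min_le_right _ _
      _ = ε / 2 := by field_simp
      _ < ε := by linarith

/-- Collision stability carries closeness from some `s < τ` to some `t' > τ`, with `x τ` as the
reference; right continuity replaces it by `x t'`, and stability with constant charges leads on to
`t`. -/
theorem eventually_close_of_collision (E : Evolution T x b) (F : ∀ m, Evolution T (ym m) (cm m))
    {p τ t : ℝ} (hp : 0 ≤ p) (hpτ : p < τ) (hτt : τ < t) (ht : t ≤ T)
    (hb : ∀ r ∈ Icc τ t, b r = b τ)
    (h : ∀ s ∈ Ioo p τ, ∀ ε > 0, ∀ᶠ m in atTop,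
      CloseModRelabeling ε (x s) (b s) (ym m s) (cm m s)) {ε : ℝ} (hε : 0 < ε) :
    ∀ᶠ m in atTop, CloseModRelabeling ε (x t) (b t) (ym m t) (cm m t) := by
  have hτ : τ ∈ Ioo 0 T := ⟨hp.trans_lt hpτ, hτt.trans_le ht⟩
  obtain ⟨K, hK, η₀, hη₀, hstab⟩ := E.exists_stability hτ.1.le ht hb
  set η := min η₀ (ε / (2 * K)) with hη
  have hη0 : 0 < η := lt_min hη₀ (by positivity)
  have hnear : ∀ᶠ r in 𝓝[>] τ, ∀ k, |x r k - x τ k| < η / 2 := by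
    rw [eventually_all]
    intro k
    have := ((E.tendsto_right ⟨hτ.1.le, hτ.2⟩ k).sub_const (x τ k)).abs
    rw [sub_self, abs_zero] at this
    exact this.eventually (gt_mem_nhds (by positivity))
  obtain ⟨u, hu, hux⟩ := mem_nhdsGT_iff_exists_Ioo_subset.1 hnear
  have hu : τ < u := hu
  obtain ⟨s, hs, t', ht', -, -, η', hη', hcol⟩ := E.exists_stability_collision hτ
    (ε := η / 2) (d := min (u - τ) (min (t - τ) (τ - p))) (by positivity)
    (lt_min (by linarith) (lt_min (by linarith) (by linarith)))
  have h1 : min (u - τ) (min (t - τ) (τ - p)) ≤ u - τ := min_le_left _ _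
  have h2 : min (u - τ) (min (t - τ) (τ - p)) ≤ t - τ := (min_le_right _ _).trans (min_le_left _ _)
  have h3 : min (u - τ) (min (t - τ) (τ - p)) ≤ τ - p := (min_le_right _ _).trans (min_le_right _ _)
  filter_upwards [h s ⟨by linarith [hs.1], hs.2⟩ η' hη'] with m hm
  obtain ⟨σ, hσ⟩ := hm
  obtain ⟨ρ, hρ⟩ := hcol _ _ ((F m).relabel σ) (funext fun k => (hσ k).1) fun k => (hσ k).2.le
  have := hstab _ _ (((F m).relabel σ).relabel ρ) t' ⟨ht'.1.le, by linarith [ht'.2]⟩ η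
    ⟨hη0.le, min_le_left _ _⟩ (funext fun k => (hρ k).1) (fun k => by
      have e1 := (hρ k).2
      have e2 := hux ⟨ht'.1, by linarith [ht'.2]⟩ k
      rw [abs_le] at *
      rw [abs_lt] at e2
      exact ⟨by linarith, by linarith⟩) t ⟨by linarith [ht'.2], le_rfl⟩
  refine ⟨ρ.trans σ, fun k => ⟨?_, ?_⟩⟩
  · rw [hb t ⟨hτt.le, le_rfl⟩, ← this.1]
    rfl
  · refine (this.2 k).trans_lt ?_
    calc K * η ≤ K * (ε / (2 * K)) := by gcongr; exact min_le_right _ _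
      _ = ε / 2 := by field_simp
      _ < ε := by linarith

theorem not_isJumpTime_of_constant {p τ : ℝ} {β : Fin n → SignType} (hβ : ∀ s ∈ Ico p τ, b s = β)
    {s : ℝ} (hs : s ∈ Ioo p τ) : ¬ IsJumpTime b s := by
  refine not_not.2 ?_
  filter_upwards [Ico_mem_nhdsLT hs.1] with r hr
  rw [hβ r ⟨hr.1, hr.2.trans hs.2⟩, hβ s ⟨hs.1.le, hs.2⟩]

/-- The continuous induction runs over a statement that is void at jump times: there the charges of
the perturbed solution may have jumped earlier or may jump later. -/
theorem eventually_close (E : Evolution T x b) (F : ∀ m, Evolution T (ym m) (cm m))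
    (hb : ∀ m, cm m 0 = b 0) (hx : Tendsto (fun m => ym m 0) atTop (𝓝 (x 0))) {t : ℝ}
    (ht : t ∈ Icc 0 T) (hJ : 0 < t → ¬ IsJumpTime b t) : ∀ ε > 0, ∀ᶠ m in atTop,
      CloseModRelabeling ε (x t) (b t) (ym m t) (cm m t) := by
  refine continuous_induction (P := fun t => (0 < t → ¬ IsJumpTime b t) → ∀ ε > 0,
    ∀ᶠ m in atTop, CloseModRelabeling ε (x t) (b t) (ym m t) (cm m t)) ?_ ?_ ?_ t ht hJ
  · intro _ ε hε
    filter_upwards [(Metric.tendsto_nhds.1 hx) ε hε] with m hm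
    refine ⟨1, fun k => ⟨by rw [hb]; rfl, ?_⟩⟩
    exact ((dist_pi_lt_iff hε).1 hm k)
  · intro t ht hP hJ ε hε
    obtain ⟨p, hp, hpb⟩ := exists_constant_left ht.1 (not_not.1 (hJ ht.1))
    obtain ⟨s, hs⟩ := exists_between hp.2
    have hpb' : ∀ r ∈ Icc p t, b r = b t := fun r hr => by
      rcases hr.2.eq_or_lt with h | h
      · rw [h]
      · exact hpb r ⟨hr.1, h⟩
    have := E.eventually_close_of_constant F (hp.1.trans hs.1.le) hs.2.le ht.2
      (fun r hr => by rw [hpb' r ⟨hs.1.le.trans hr.1, hr.2⟩, hpb' s ⟨hs.1.le, hs.2.le⟩])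
      (hP s ⟨hp.1.trans hs.1.le, hs.2⟩ fun _ => not_isJumpTime_of_constant hpb hs) hε
    exact this.mono fun m hm => hm t ⟨hs.2.le, le_rfl⟩
  · intro t ht hP
    obtain ⟨q, hq, hqb⟩ := E.exists_constant_right ht
    by_cases hJ : 0 < t → ¬ IsJumpTime b t
    · filter_upwards [Ioo_mem_nhdsGT hq.1] with r hr _ ε hε
      have := E.eventually_close_of_constant F ht.1 hr.1.le (hr.2.le.trans hq.2)
        (fun u hu => hqb u ⟨hu.1, hu.2.trans_lt hr.2⟩) (hP t ⟨ht.1, le_rfl⟩ hJ) hε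
      exact this.mono fun m hm => hm r ⟨hr.1.le, le_rfl⟩
    · push Not at hJ
      obtain ⟨β, hβ, -, -⟩ := E.charge_left t ⟨hJ.1, ht.2.le⟩
      obtain ⟨p, hp, hpb⟩ := exists_constant_left hJ.1 hβ
      filter_upwards [Ioo_mem_nhdsGT hq.1] with r hr _ ε hε
      exact E.eventually_close_of_collision F hp.1 hp.2 hr.1 (hr.2.le.trans hq.2)
        (fun u hu => hqb u ⟨hu.1, hu.2.trans_lt hr.2⟩)
        (fun s hs => hP s ⟨hp.1.trans hs.1.le, hs.2.le⟩ fun _ => not_isJumpTime_of_constant hpb hs)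
        hε

/-- Away from the jump times, solutions depend continuously on the initial positions, modulo
relabeling. -/
theorem eventually_forall_close (E : Evolution T x b) (F : ∀ m, Evolution T (ym m) (cm m))
    (hb : ∀ m, cm m 0 = b 0) (hx : Tendsto (fun m => ym m 0) atTop (𝓝 (x 0))) {K : Set ℝ}
    (hK : IsCompact K) (hKS : K ⊆ Icc 0 T \ (E.jumpTimes : Set ℝ)) {ε : ℝ} (hε : 0 < ε) :
    ∀ᶠ m in atTop, ∀ t ∈ K, CloseModRelabeling ε (x t) (b t) (ym m t) (cm m t) := by
  refine hK.induction_on (p := fun U => ∀ᶠ m in atTop, ∀ t ∈ U,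
    CloseModRelabeling ε (x t) (b t) (ym m t) (cm m t)) (by simp)
    (fun U V hUV h => h.mono fun m hm t ht => hm t (hUV ht))
    (fun U V hU hV => (hU.and hV).mono fun m hm t ht => ht.elim (hm.1 t) (hm.2 t)) ?_
  intro t ht
  obtain ⟨htI, htS⟩ := hKS ht
  have hJ : 0 < t → ¬ IsJumpTime b t := fun h0 hJ => htS (E.mem_jumpTimes.2 ⟨⟨h0, htI.2⟩, hJ⟩)
  obtain ⟨p, q, hp, hq, hpt, htq, hpt', htq', hpq⟩ := E.exists_constant htI hJ
  -- Starting strictly before `t`, unless `t = 0`, makes the interval from `s` to `q` a neighborhood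
  -- of `t` in `K`.
  obtain ⟨s, hs0, hsp, hst, hst', hsJ⟩ : ∃ s, 0 ≤ s ∧ p ≤ s ∧ s ≤ t ∧ (0 < t → s < t) ∧
      (0 < s → ¬ IsJumpTime b s) := by
    rcases htI.1.eq_or_lt with h | h
    · exact ⟨t, htI.1, hpt, le_rfl, fun h' => absurd h h'.ne, hJ⟩
    · obtain ⟨s, hs⟩ := exists_between (hpt' h)
      exact ⟨s, hp.trans hs.1.le, hs.1.le, hs.2.le, fun _ => hs.2, fun _ =>
        not_isJumpTime_of_constant (fun r hr => hpq r ⟨hr.1, hr.2.le.trans htq⟩) hs⟩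
  refine ⟨Icc s q, ?_, ?_⟩
  · have h1 : ∀ᶠ r in 𝓝[K] t, s ≤ r := by
      rcases htI.1.eq_or_lt with h | h
      · filter_upwards [self_mem_nhdsWithin] with r hr
        exact hst.trans (h ▸ (hKS hr).1.1)
      · filter_upwards [nhdsWithin_le_nhds (Ioi_mem_nhds (hst' h))] with r hr using le_of_lt hr
    have h2 : ∀ᶠ r in 𝓝[K] t, r ≤ q := by
      rcases htI.2.eq_or_lt with h | h
      · filter_upwards [self_mem_nhdsWithin] with r hr
        exact ((hKS hr).1.2.trans h.ge).trans htq
      · filter_upwards [nhdsWithin_le_nhds (Iio_mem_nhds (htq' h))] with r hr using le_of_lt hr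
    filter_upwards [h1, h2] with r hr hr' using ⟨hr, hr'⟩
  · exact E.eventually_close_of_constant F hs0 (hst.trans htq) hq
      (fun r hr => by rw [hpq r ⟨hsp.trans hr.1, hr.2⟩, hpq s ⟨hsp, hst.trans htq⟩])
      (E.eventually_close F hb hx ⟨hs0, hst.trans htI.2⟩ hsJ) hε

end Evolution

theorem continuous_moments : Continuous (moments : (Fin n → ℝ) → EuclideanSpace ℝ (Fin n)) := by
  unfold moments
  refine (PiLp.continuous_toLp 2 _).comp (continuous_pi fun k => ?_)
  fun_prop

theorem moments_comp_perm (x : Fin n → ℝ) (σ : Equiv.Perm (Fin n)) :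
    moments (fun i => x (σ i)) = moments x := by
  unfold moments
  congr 1
  funext k
  rw [Equiv.sum_comp σ fun i => x i ^ ((k : ℕ) + 1)]

namespace Evolution

variable {ym : ℕ → ℝ → Fin n → ℝ} {cm : ℕ → ℝ → Fin n → SignType}

/-- Solutions depend continuously on the initial positions, in the moment distance. -/
theorem eventually_momentDist_lt (E : Evolution T x b) (F : ∀ m, Evolution T (ym m) (cm m))
    (hT : 0 < T) (hb : ∀ m, cm m 0 = b 0) (hx : Tendsto (fun m => ym m 0) atTop (𝓝 (x 0)))
    {ε : ℝ} (hε : 0 < ε) :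
    ∀ᶠ m in atTop, ∀ t ∈ Icc 0 T, momentDist (ym m t) (x t) < ε := by
  set R : ℝ := ∑ k, x 0 k ^ 2 + 1 + 2 * n * T with hR
  have hR0 : 0 ≤ R := by
    have : 0 ≤ ∑ k, x 0 k ^ 2 := Finset.sum_nonneg fun _ _ => sq_nonneg _
    positivity
  have hRm : ∀ᶠ m in atTop, ∑ k, ym m 0 k ^ 2 + 2 * n * T ≤ R := by
    have h1 : Tendsto (fun m => ∑ k, ym m 0 k ^ 2) atTop (𝓝 (∑ k, x 0 k ^ 2)) :=
      tendsto_finsetSum _ fun k _ => ((tendsto_pi_nhds.1 hx) k).pow 2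
    filter_upwards [h1.eventually (gt_mem_nhds (lt_add_one _))] with m hm
    rw [hR]; linarith
  set C : ℝ := n * (n * (n * (1 + R) ^ n)) with hC
  have hC0 : 0 ≤ C := by positivity
  have hlip : ∀ {y : ℝ → Fin n → ℝ} {c : ℝ → Fin n → SignType}, Evolution T y c →
      ∑ k, y 0 k ^ 2 + 2 * n * T ≤ R → ∀ s ∈ Icc 0 T, ∀ t ∈ Icc 0 T,
      ‖moments (y t) - moments (y s)‖ ≤ C * |t - s| := by
    intro y c G hG s hs t ht
    rcases le_total s t with h | h
    · rw [abs_of_nonneg (sub_nonneg.2 h)]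
      exact G.momentDist_le hG hR0 hs.1 h ht.2
    · rw [norm_sub_rev, abs_sub_comm, abs_of_nonneg (sub_nonneg.2 h)]
      exact G.momentDist_le hG hR0 ht.1 h hs.2
  refine isCompact_Icc.induction_on (p := fun U => ∀ᶠ m in atTop, ∀ t ∈ U ∩ Icc 0 T,
    momentDist (ym m t) (x t) < ε) (by simp)
    (fun U V hUV h => h.mono fun m hm t ht => hm t ⟨hUV ht.1, ht.2⟩)
    (fun U V hU hV => (hU.and hV).mono fun m hm t ht =>
      ht.1.elim (fun h => hm.1 t ⟨h, ht.2⟩) fun h => hm.2 t ⟨h, ht.2⟩) ?_ |>.mono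
    fun m hm t ht => hm t ⟨ht, ht⟩
  intro t₀ ht₀
  -- Closeness is only known at non-jump times, so such a time `s` is chosen within `d` of `t₀`.
  -- Moving between `t` and `s` costs at most `C * (2 * d) ≤ ε / 4` for each of the two solutions,
  -- with `C` uniform in `m`.
  set d : ℝ := ε / (8 * (C + 1)) with hd
  have hd0 : 0 < d := by positivity
  obtain ⟨s, hs, hsJ⟩ : ∃ s ∈ Icc (max 0 (t₀ - d)) (min T (t₀ + d)), s ∉ E.jumpTimes := by
    have hlt : max 0 (t₀ - d) < min T (t₀ + d) :=
      max_lt (lt_min hT (by linarith [ht₀.1])) (lt_min (by linarith [ht₀.2]) (by linarith))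
    exact (Icc_infinite hlt).exists_notMem_finset _
  have hsI : s ∈ Icc 0 T := ⟨(le_max_left _ _).trans hs.1, hs.2.trans (min_le_left _ _)⟩
  have hs1 : t₀ - d ≤ s := (le_max_right _ _).trans hs.1
  have hs2 : s ≤ t₀ + d := hs.2.trans (min_le_right _ _)
  refine ⟨Ioo (t₀ - d) (t₀ + d), nhdsWithin_le_nhds (Ioo_mem_nhds (by linarith) (by linarith)), ?_⟩
  obtain ⟨δ, hδ, hmom⟩ := Metric.continuousAt_iff.1 (continuous_moments.continuousAt (x := x s))
    (ε / 2) (by positivity)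
  filter_upwards [hRm, E.eventually_close F hb hx hsI
    (fun h0 hJ => hsJ (E.mem_jumpTimes.2 ⟨⟨h0, hsI.2⟩, hJ⟩)) δ hδ] with m hm hclose t ht
  obtain ⟨σ, hσ⟩ := hclose
  have h1 : ‖moments (ym m s) - moments (x s)‖ < ε / 2 := by
    rw [← moments_comp_perm (ym m s) σ, ← dist_eq_norm]
    exact hmom ((dist_pi_lt_iff hδ).2 fun k => (hσ k).2)
  have hts : |t - s| ≤ 2 * d := abs_le.2 ⟨by linarith [ht.1.1], by linarith [ht.1.2]⟩
  have h2 := hlip (F m) hm s hsI t ht.2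
  have h3 := hlip E (by rw [hR]; linarith) t ht.2 s hsI
  rw [abs_sub_comm] at h3
  have h4 : C * |t - s| ≤ ε / 4 := by
    calc C * |t - s| ≤ (C + 1) * (2 * d) := by gcongr; linarith
      _ = ε / 4 := by rw [hd]; field_simp; norm_num
  calc momentDist (ym m t) (x t) = ‖(moments (ym m t) - moments (ym m s)) +
        (moments (ym m s) - moments (x s)) + (moments (x s) - moments (x t))‖ := by
        rw [momentDist]; congr 1; abel
    _ ≤ ‖moments (ym m t) - moments (ym m s)‖ + ‖moments (ym m s) - moments (x s)‖ +
        ‖moments (x s) - moments (x t)‖ := norm_add₃_le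
    _ < ε := by linarith

end Evolution

end

/-! ### Existence of evolutions -/

/-- The function that equals `f` before the time `τ`, and from then on follows `g`. -/
noncomputable def concat {α : Type*} (τ : ℝ) (f g : ℝ → α) (t : ℝ) : α :=
  if t < τ then f t else g (t - τ)

section

variable {α : Type*} {τ t : ℝ} {f g : ℝ → α}

theorem concat_of_lt (h : t < τ) : concat τ f g t = f t := if_pos h

theorem concat_of_le (h : τ ≤ t) : concat τ f g t = g (t - τ) := if_neg h.not_gt

theorem concat_of_le_left (h0 : g 0 = f τ) (h : t ≤ τ) : concat τ f g t = f t := by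
  rcases h.lt_or_eq with h | rfl
  · exact concat_of_lt h
  · rw [concat_of_le le_rfl, sub_self, h0]

end

section

variable {n : ℕ} {T τ : ℝ} {x y : ℝ → Fin n → ℝ} {b c : ℝ → Fin n → SignType}

theorem contDiffAt_velocity {x₀ : Fin n → ℝ} {β : Fin n → SignType}
    (hinj : ∀ i j, i ≠ j → β i ≠ 0 → β j ≠ 0 → x₀ i ≠ x₀ j) :
    ContDiffAt ℝ 1 (fun x => velocity x β) x₀ := by
  rw [contDiffAt_pi]
  intro i
  unfold velocity
  refine contDiffAt_const.mul (ContDiffAt.sum fun j hj => ?_)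
  by_cases hi : β i = 0
  · simpa [hi] using contDiffAt_const
  by_cases hj' : β j = 0
  · simpa [hj'] using contDiffAt_const
  refine contDiffAt_const.div ?_
    (sub_ne_zero.2 (hinj i j (Finset.ne_of_mem_erase hj).symm hi hj'))
  exact (contDiffAt_apply ℝ ℝ i x₀).sub (contDiffAt_apply ℝ ℝ j x₀)

theorem exists_evolution_of_injective {x₀ : Fin n → ℝ} {β : Fin n → SignType}
    (hinj : ∀ i j, i ≠ j → β i ≠ 0 → β j ≠ 0 → x₀ i ≠ x₀ j) :
    ∃ ε > 0, ∃ X : ℝ → Fin n → ℝ, Evolution ε X (fun _ => β) ∧ X 0 = x₀ := by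
  obtain ⟨X, hX0, ε, hε, hX⟩ :=
    (contDiffAt_velocity hinj).exists_forall_mem_closedBall_exists_eq_forall_mem_Ioo_hasDerivAt₀ 0
  have hX' : ∀ t ∈ Ioo (-ε) ε, ∀ i, HasDerivAt (fun s => X s i) (velocity (X t) β i) t :=
    fun t ht => hasDerivAt_pi.1 (hX t (by simpa using ht))
  have hc : ContinuousAt X 0 := (hX 0 (by simpa using hε)).continuousAt
  have hev : ∀ᶠ t in 𝓝 (0 : ℝ), ∀ i j, i ≠ j → β i ≠ 0 → β j ≠ 0 → X t i ≠ X t j := by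
    simp only [eventually_all]
    intro i j hij hi hj
    have hi' := ((continuous_apply i).continuousAt (x := X 0)).comp hc
    have hj' := ((continuous_apply j).continuousAt (x := X 0)).comp hc
    refine ((hi'.sub hj').eventually_ne (y := 0) ?_).mono fun t ht => sub_ne_zero.1 ht
    simpa [hX0, sub_eq_zero] using hinj i j hij hi hj
  obtain ⟨δ, hδ, hδ'⟩ := Metric.eventually_nhds_iff.1 hev
  refine ⟨min (ε / 2) (δ / 2), by positivity, X, ⟨?_, ?_, ?_, ?_, ?_⟩, hX0⟩
  · intro i t ht
    refine (hX' t ⟨by linarith [ht.1], ?_⟩ i).continuousAt.continuousWithinAt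
    linarith [ht.2, min_le_left (ε / 2) (δ / 2)]
  · intro t ht i
    refine (hX' t ⟨by linarith [ht.1], ?_⟩ i).hasDerivWithinAt
    linarith [ht.2, min_le_left (ε / 2) (δ / 2)]
  · exact fun _ _ => Eventually.of_forall fun _ => rfl
  · exact fun _ _ => ⟨β, Eventually.of_forall fun _ => rfl, fun _ => Or.inl rfl, by simp⟩
  · intro t ht
    refine hδ' ?_
    rw [Real.dist_eq, sub_zero, abs_of_nonneg ht.1]
    linarith [ht.2, min_le_right (ε / 2) (δ / 2)]

namespace Evolution

/-- Particles charged at `t` were charged at all earlier times, and by the intermediate value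
theorem they cannot exchange their order without meeting. -/
theorem mem_stateSpace (E : Evolution T x b) (h0 : (x 0, b 0) ∈ stateSpace n) {t : ℝ}
    (ht : t ∈ Icc 0 T) : (x t, b t) ∈ stateSpace n := by
  intro i j hij hb
  have hi : b t i ≠ 0 := fun h => hb (by simp [h])
  have hj : b t j ≠ 0 := fun h => hb (by simp [h])
  have hs : ∀ s ∈ Icc 0 t, b s i ≠ 0 ∧ b s j ≠ 0 := fun s hs =>
    ⟨by rwa [E.charge_ne_zero hs.1 hs.2 ht.2 hi], by rwa [E.charge_ne_zero hs.1 hs.2 ht.2 hj]⟩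
  have h00 := hs 0 ⟨le_rfl, ht.1⟩
  have h1 := lt_of_mem_stateSpace h0 hij h00.2 h00.1
  by_contra hcon
  simp only [not_lt] at hcon
  have hcont : ContinuousOn (fun s => x s i - x s j) (Icc 0 t) :=
    ((E.cont i).sub (E.cont j)).mono (Icc_subset_Icc_right ht.2)
  obtain ⟨s, hs', hs0⟩ := intermediate_value_Icc' ht.1 hcont
    (show (0 : ℝ) ∈ Icc (x t i - x t j) (x 0 i - x 0 j) from
      ⟨by linarith, by linarith⟩)
  exact E.inj s ⟨hs'.1, hs'.2.trans ht.2⟩ i j hij.ne' (hs s hs').1 (hs s hs').2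
    (sub_eq_zero.1 hs0)

theorem congr (E : Evolution T x b) (hx : ∀ t ∈ Icc 0 T, y t = x t)
    (hb : ∀ t ∈ Icc 0 T, c t = b t) : Evolution T y c where
  cont i := (E.cont i).congr fun t ht => by simp [hx t ht]
  deriv_right t ht i := by
    have ht' : t ∈ Icc 0 T := ⟨ht.1, ht.2.le⟩
    rw [hx t ht', hb t ht']
    refine (E.deriv_right t ht i).congr_of_eventuallyEq ?_ (by rw [hx t ht'])
    filter_upwards [Ico_mem_nhdsGE ht.2] with s hs
    rw [hx s ⟨ht.1.trans hs.1, hs.2.le⟩]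
  charge_right t ht := by
    rw [hb t ⟨ht.1, ht.2.le⟩]
    filter_upwards [E.charge_right t ht, Ioo_mem_nhdsGT ht.2] with s hs hs'
    rw [hb s ⟨ht.1.trans hs'.1.le, hs'.2.le⟩, hs]
  charge_left t ht := by
    have ht' : t ∈ Icc 0 T := ⟨ht.1.le, ht.2⟩
    obtain ⟨β, h1, h2, h3⟩ := E.charge_left t ht
    rw [hx t ht', hb t ht']
    refine ⟨β, ?_, h2, h3⟩
    filter_upwards [h1, Ioo_mem_nhdsLT ht.1] with s hs hs'
    rw [hb s ⟨hs'.1.le, hs'.2.le.trans ht.2⟩, hs]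
  inj t ht := by
    rw [hx t ht, hb t ht]
    exact E.inj t ht

theorem concat {T' : ℝ} (E : Evolution τ x b) (F : Evolution T' y c)
    (hx : y 0 = x τ) (hb : c 0 = b τ) : Evolution (τ + T') (concat τ x y) (concat τ b c) where
  cont i := by
    have h1 : ContinuousOn (fun t => AnnihilatingParticles.concat τ x y t i) (Icc 0 τ) :=
      (E.cont i).congr fun t ht => by rw [concat_of_le_left hx ht.2]
    have h2 : ContinuousOn (fun t => AnnihilatingParticles.concat τ x y t i) (Icc τ (τ + T')) := by
      have : ContinuousOn (fun t => y (t - τ) i) (Icc τ (τ + T')) :=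
        (F.cont i).comp (f := fun t => t - τ) (by fun_prop) fun t ht =>
          ⟨by linarith [ht.1], by linarith [ht.2]⟩
      exact this.congr fun t ht => by rw [concat_of_le ht.1]
    refine (h1.union_of_isClosed h2 isClosed_Icc isClosed_Icc).mono fun t ht => ?_
    rcases le_total t τ with h | h
    · exact Or.inl ⟨ht.1, h⟩
    · exact Or.inr ⟨h, ht.2⟩
  deriv_right t ht i := by
    rcases lt_or_ge t τ with h | h
    · rw [concat_of_lt h, concat_of_lt h]
      refine (E.deriv_right t ⟨ht.1, h⟩ i).congr_of_eventuallyEq ?_ (by rw [concat_of_lt h])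
      filter_upwards [Ico_mem_nhdsGE h] with s hs
      rw [concat_of_lt hs.2]
    · rw [concat_of_le h, concat_of_le h]
      have := F.deriv_right (t - τ) ⟨by linarith, by linarith [ht.2]⟩ i
      rw [sub_eq_neg_add] at this ⊢
      refine (hasDerivWithinAt_const_add this).congr (fun s hs => ?_) ?_
      · rw [concat_of_le (h.trans hs), sub_eq_neg_add]
      · rw [concat_of_le h, sub_eq_neg_add]
  charge_right t ht := by
    rcases lt_or_ge t τ with h | h
    · rw [concat_of_lt h]
      filter_upwards [E.charge_right t ⟨ht.1, h⟩, Ioo_mem_nhdsGT h] with s hs hs'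
      rw [concat_of_lt hs'.2, hs]
    · rw [concat_of_le h]
      have h1 := F.charge_right (t - τ) ⟨by linarith, by linarith [ht.2]⟩
      have h2 : Tendsto (fun s => s - τ) (𝓝[>] t) (𝓝[>] (t - τ)) :=
        ContinuousWithinAt.tendsto_nhdsWithin (by fun_prop) fun s hs => sub_lt_sub_right hs τ
      filter_upwards [h2.eventually h1, self_mem_nhdsWithin] with s hs hs'
      rw [concat_of_le (h.trans (le_of_lt hs')), hs]
  charge_left t ht := by
    rcases le_or_gt t τ with h | h
    · rw [concat_of_le_left hb h, concat_of_le_left hx h]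
      obtain ⟨β, h1, h2⟩ := E.charge_left t ⟨ht.1, h⟩
      refine ⟨β, ?_, h2⟩
      filter_upwards [h1, self_mem_nhdsWithin] with s hs hs'
      rw [concat_of_lt (lt_of_lt_of_le hs' h), hs]
    · rw [concat_of_le h.le, concat_of_le h.le]
      obtain ⟨β, h1, h2⟩ := F.charge_left (t - τ) ⟨by linarith, by linarith [ht.2]⟩
      refine ⟨β, ?_, h2⟩
      have h2 : Tendsto (fun s => s - τ) (𝓝[<] t) (𝓝[<] (t - τ)) :=
        ContinuousWithinAt.tendsto_nhdsWithin (by fun_prop) fun s hs => sub_lt_sub_right hs τ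
      filter_upwards [h2.eventually h1, Ioo_mem_nhdsLT h] with s hs hs'
      rw [concat_of_le hs'.1.le, hs]
  inj t ht := by
    rcases le_or_gt t τ with h | h
    · rw [concat_of_le_left hb h, concat_of_le_left hx h]
      exact E.inj t ⟨ht.1, h⟩
    · rw [concat_of_le h.le, concat_of_le h.le]
      exact F.inj _ ⟨by linarith, by linarith [ht.2]⟩

/-- Closes an evolution with frozen charges at the first unreached time: the positions take their
left limits and the charges jump to `b'`. -/
theorem concat_limit {X : ℝ → Fin n → ℝ} {β b' : Fin n → SignType} {L : Fin n → ℝ}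
    (hτ : 0 < τ) (hE : ∀ t ∈ Ico 0 τ, Evolution t X (fun _ => β))
    (hL : Tendsto X (𝓝[<] τ) (𝓝 L)) (hb' : ∀ i, b' i = β i ∨ b' i = 0)
    (hsum : ∀ y, ∑ i with L i = y, ((b' i : ℤ) - (β i : ℤ)) = 0)
    (hinj : ∀ i j, i ≠ j → b' i ≠ 0 → b' j ≠ 0 → L i ≠ L j) :
    Evolution τ (AnnihilatingParticles.concat τ X fun _ => L)
      (AnnihilatingParticles.concat τ (fun _ => β) fun _ => b') where
  cont i t ht := by
    rcases ht.2.lt_or_eq with h | rfl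
    · obtain ⟨r, hr, hr'⟩ := exists_between h
      have hc := (hE r ⟨ht.1.trans hr.le, hr'⟩).cont i t ⟨ht.1, hr.le⟩
      have hc' : ContinuousWithinAt (fun t => X t i) (Icc 0 τ) t := by
        refine hc.mono_of_mem_nhdsWithin ?_
        filter_upwards [self_mem_nhdsWithin, nhdsWithin_le_nhds (Iio_mem_nhds hr)] with s hs hs'
        exact ⟨hs.1, le_of_lt hs'⟩
      refine hc'.congr_of_eventuallyEq ?_ (by rw [concat_of_lt h])
      filter_upwards [nhdsWithin_le_nhds (Iio_mem_nhds h)] with s hs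
      rw [concat_of_lt hs]
    · rw [← Ico_insert_right hτ.le, continuousWithinAt_insert_self]
      have h1 : Tendsto (fun s => X s i) (𝓝[Ico 0 t] t) (𝓝 (L i)) :=
        ((continuous_apply i).tendsto L).comp (hL.mono_left (nhdsWithin_mono _ fun s hs => hs.2))
      unfold ContinuousWithinAt
      beta_reduce
      rw [concat_of_le le_rfl]
      refine h1.congr' ?_
      filter_upwards [self_mem_nhdsWithin] with s hs
      rw [concat_of_lt hs.2]
  deriv_right t ht i := by
    rw [concat_of_lt ht.2, concat_of_lt ht.2]
    obtain ⟨r, hr, hr'⟩ := exists_between ht.2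
    refine ((hE r ⟨ht.1.trans hr.le, hr'⟩).deriv_right t ⟨ht.1, hr⟩ i).congr_of_eventuallyEq ?_
      (by rw [concat_of_lt ht.2])
    filter_upwards [Ico_mem_nhdsGE ht.2] with s hs
    rw [concat_of_lt hs.2]
  charge_right t ht := by
    rw [concat_of_lt ht.2]
    filter_upwards [Ioo_mem_nhdsGT ht.2] with s hs
    rw [concat_of_lt hs.2]
  charge_left t ht := by
    refine ⟨β, ?_, ?_⟩
    · filter_upwards [self_mem_nhdsWithin] with s hs
      rw [concat_of_lt (lt_of_lt_of_le hs ht.2)]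
    · rcases ht.2.lt_or_eq with h | rfl
      · rw [concat_of_lt h]
        simp
      · rw [concat_of_le le_rfl, concat_of_le le_rfl]
        exact ⟨hb', hsum⟩
  inj t ht := by
    rcases ht.2.lt_or_eq with h | rfl
    · rw [concat_of_lt h, concat_of_lt h]
      exact (hE t ⟨ht.1, h⟩).inj t ⟨ht.1, le_rfl⟩
    · rw [concat_of_le le_rfl, concat_of_le le_rfl]
      exact hinj

end Evolution

/-! ### Convergence of the positions at a collision -/

theorem not_lt_of_sum_sq_max_eq {u v : Fin n → ℝ} {β : Fin n → SignType} {i : Fin n}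
    (hi : β i ≠ 0) (hneutral : ∀ k, β k = 0 → u k = v k) (hright : ∀ k, i < k → u k = v k)
    (hu : ∀ k, k < i → β k ≠ 0 → u k ≤ u i)
    (h : ∀ z, ∑ k, max (u k - z) 0 ^ 2 = ∑ k, max (v k - z) 0 ^ 2) : ¬ u i < v i := by
  intro hlt
  -- At the threshold `z = u i` the charged particles left of `i` and `i` itself contribute nothing
  -- for `u`, those to the right contribute equally for `u` and `v`, and `v i > u i` makes the sum
  -- for `v` larger.
  refine (h (u i)).not_lt (Finset.sum_lt_sum (fun k _ => ?_) ⟨i, Finset.mem_univ i, ?_⟩)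
  · by_cases hk : β k = 0
    · rw [hneutral k hk]
    rcases lt_trichotomy k i with hki | rfl | hki
    · rw [max_eq_right (by linarith [hu k hki hk] : u k - u i ≤ 0), zero_pow two_ne_zero]
      exact sq_nonneg _
    · rw [sub_self, max_self, zero_pow two_ne_zero]
      exact sq_nonneg _
    · rw [hright k hki]
  · rw [sub_self, max_self, max_eq_left (by linarith : 0 ≤ v i - u i)]
    nlinarith

/-- A configuration with ordered charged particles is determined by the positions of the neutral
particles and by the sums of the truncated squares of the positions. -/
theorem eq_of_sum_sq_max_eq {u v : Fin n → ℝ} {β : Fin n → SignType}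
    (hneutral : ∀ k, β k = 0 → u k = v k)
    (hu : ∀ k l, k < l → β k ≠ 0 → β l ≠ 0 → u k ≤ u l)
    (hv : ∀ k l, k < l → β k ≠ 0 → β l ≠ 0 → v k ≤ v l)
    (h : ∀ z, ∑ k, max (u k - z) 0 ^ 2 = ∑ k, max (v k - z) 0 ^ 2) : u = v := by
  by_contra hne
  have hA : ({k | u k ≠ v k} : Finset (Fin n)).Nonempty := by
    obtain ⟨k, hk⟩ := Function.ne_iff.1 hne
    exact ⟨k, by simpa using hk⟩
  -- The comparison is made at the last label where `u` and `v` differ.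
  obtain ⟨i, hi, hmax⟩ := Finset.exists_max_image _ id hA
  simp only [Finset.mem_filter, Finset.mem_univ, true_and, id] at hi hmax
  have hright : ∀ k, i < k → u k = v k := fun k hk => by
    by_contra hk'
    exact absurd (hmax k hk') hk.not_ge
  have hβ : β i ≠ 0 := fun hβ => hi (hneutral i hβ)
  rcases lt_or_gt_of_ne hi with hlt | hlt
  · exact not_lt_of_sum_sq_max_eq hβ hneutral hright (fun k hk hk' => hu k i hk hk' hβ) h hlt
  · exact not_lt_of_sum_sq_max_eq hβ (fun k hk => (hneutral k hk).symm)
      (fun k hk => (hright k hk).symm) (fun k hk hk' => hv k i hk hk' hβ) (fun z => (h z).symm) hlt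

/-- The derivative is Lipschitz with constant two, so sums of truncated squares are Lipschitz in
time along evolutions. -/
theorem hasDerivAt_max_sq (z u : ℝ) :
    HasDerivAt (fun w => max (w - z) 0 ^ 2) (2 * max (u - z) 0) u := by
  rcases lt_trichotomy u z with h | rfl | h
  · rw [max_eq_right (by linarith), mul_zero]
    refine (hasDerivAt_const u (0 : ℝ)).congr_of_eventuallyEq ?_
    filter_upwards [Iio_mem_nhds h] with w hw
    rw [max_eq_right (by simp only [mem_Iio] at hw; linarith)]
    norm_num
  · rw [sub_self, max_self, mul_zero]
    have : (fun w => max (w - u) 0 ^ 2) =O[𝓝 u] fun w => ‖w - u‖ ^ 2 := by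
      refine Asymptotics.isBigO_of_le _ fun w => ?_
      rw [norm_pow, norm_pow, norm_norm]
      gcongr
      rw [Real.norm_eq_abs, Real.norm_eq_abs, abs_of_nonneg (le_max_right _ _)]
      exact max_le (le_abs_self _) (abs_nonneg _)
    have := (this.hasFDerivAt (𝕜 := ℝ) one_lt_two).hasDerivAt
    simpa using this
  · rw [max_eq_left (by linarith)]
    have h2 : HasDerivAt (fun w => (w - z) ^ 2) (2 * (u - z)) u := by
      simpa using ((hasDerivAt_id u).sub_const z).fun_pow 2
    refine h2.congr_of_eventuallyEq ?_
    filter_upwards [Ioi_mem_nhds h] with w hw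
    rw [max_eq_left (by simp only [mem_Ioi] at hw; linarith)]

end

section

variable {n : ℕ} {T τ : ℝ} {x y : ℝ → Fin n → ℝ} {b c : ℝ → Fin n → SignType}

namespace Evolution

theorem neutral_eq (E : Evolution T x b) {i : Fin n} (hi : b 0 i = 0) {t : ℝ} (ht : t ∈ Icc 0 T) :
    x t i = x 0 i := by
  have := abs_sub_le_of_abs_deriv_right_le ht.1 ((E.cont i).mono (Icc_subset_Icc_right ht.2))
    (fun s hs => E.deriv_right s ⟨hs.1, hs.2.trans_le ht.2⟩ i) (C := 0) fun s hs => by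
      rw [velocity_eq_zero (E.charge_eq_zero le_rfl hs.1 (hs.2.le.trans ht.2) hi), abs_zero]
  rw [zero_mul] at this
  exact sub_eq_zero.1 (abs_nonpos_iff.1 this)

/-- Positions converge as long as no collision is resolved. -/
theorem exists_limit {X : ℝ → Fin n → ℝ} {β : Fin n → SignType} (hτ : 0 < τ)
    (hE : ∀ t ∈ Ico 0 τ, Evolution t X (fun _ => β)) (h0 : (X 0, β) ∈ stateSpace n) :
    ∃ L, Tendsto X (𝓝[<] τ) (𝓝 L) := by
  set R : ℝ := ∑ k, X 0 k ^ 2 + 2 * n * τ with hR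
  have hmem : ∀ᶠ t in 𝓝[<] τ, X t ∈ Set.pi univ fun _ : Fin n => Icc (-(1 + R)) (1 + R) := by
    filter_upwards [Ioo_mem_nhdsLT hτ] with t ht k _
    refine abs_le.1 ((hE t ⟨ht.1.le, ht.2⟩).abs_position_le ?_ ⟨ht.1.le, le_rfl⟩ k)
    rw [hR]
    have := ht.2.le
    gcongr
  have hK : IsCompact (Set.pi univ fun _ : Fin n => Icc (-(1 + R)) (1 + R)) :=
    isCompact_univ_pi fun _ => isCompact_Icc
  have hneutral : ∀ U : Filter ℝ, U.NeBot → U ≤ 𝓝[<] τ → ∀ u, Tendsto X U (𝓝 u) →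
      ∀ k, β k = 0 → u k = X 0 k := by
    intro U _ hU u hu k hk
    refine tendsto_nhds_unique (((continuous_apply k).tendsto u).comp hu)
      (tendsto_const_nhds.congr' ?_)
    filter_upwards [hU (Ioo_mem_nhdsLT hτ)] with t ht
    exact ((hE t ⟨ht.1.le, ht.2⟩).neutral_eq hk ⟨ht.1.le, le_rfl⟩).symm
  have hordered : ∀ U : Filter ℝ, U.NeBot → U ≤ 𝓝[<] τ → ∀ u, Tendsto X U (𝓝 u) →
      ∀ k l, k < l → β k ≠ 0 → β l ≠ 0 → u k ≤ u l := by
    intro U _ hU u hu k l hkl hk hl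
    refine le_of_tendsto_of_tendsto (((continuous_apply k).tendsto u).comp hu)
      (((continuous_apply l).tendsto u).comp hu) ?_
    filter_upwards [hU (Ioo_mem_nhdsLT hτ)] with t ht
    exact (lt_of_mem_stateSpace ((hE t ⟨ht.1.le, ht.2⟩).mem_stateSpace h0 ⟨ht.1.le, le_rfl⟩)
      hkl hk hl).le
  -- A Lipschitz function of time extends continuously to `τ`, so all cluster points of the
  -- positions share its limit.
  have hsum : ∀ z, ∃ ℓ, ∀ U : Filter ℝ, U.NeBot → U ≤ 𝓝[<] τ → ∀ u, Tendsto X U (𝓝 u) →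
      ∑ k, max (u k - z) 0 ^ 2 = ℓ := by
    intro z
    have hlip : LipschitzOnWith (n * 2) (fun t => ∑ k, max (X t k - z) 0 ^ 2) (Ico 0 τ) := by
      refine LipschitzOnWith.of_dist_le_mul fun s hs t ht => ?_
      wlog hst : t ≤ s generalizing s t
      · rw [dist_comm, dist_comm s]
        exact this t ht s hs (le_of_not_ge hst)
      have := (hE s hs).abs_sum_sub_le (hasDerivAt_max_sq z) (L := 2) zero_le_two
        (fun r _ k l => by
          rw [← mul_sub, abs_mul, abs_two]
          refine mul_le_mul_of_nonneg_left ?_ zero_le_two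
          simpa using abs_max_sub_max_le_abs (X r k - z) (X r l - z) 0) ht.1 hst le_rfl
      rw [Real.dist_eq, Real.dist_eq, abs_of_nonneg (sub_nonneg.2 hst)]
      simpa using this
    obtain ⟨g, hg, hgX⟩ := hlip.extend_real
    refine ⟨g τ, fun U _ hU u hu => ?_⟩
    have hc : Continuous fun u : Fin n → ℝ => ∑ k, max (u k - z) 0 ^ 2 := by fun_prop
    refine tendsto_nhds_unique ((hc.tendsto u).comp hu) (Tendsto.congr' ?_
      ((hg.continuous.tendsto τ).mono_left (hU.trans nhdsWithin_le_nhds)))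
    filter_upwards [hU (Ioo_mem_nhdsLT hτ)] with t ht
    exact (hgX ⟨ht.1.le, ht.2⟩).symm
  have hU : ∃ u, MapClusterPt u (𝓝[<] τ) X := by
    obtain ⟨u, -, hu⟩ := hK.exists_mapClusterPt (tendsto_principal.2 hmem)
    exact ⟨u, hu⟩
  obtain ⟨u, hu⟩ := hU
  refine ⟨u, hK.tendsto_nhds_of_unique_mapClusterPt hmem fun v _ hv => ?_⟩
  obtain ⟨U, hU, hUu⟩ := mapClusterPt_iff_ultrafilter.1 hu
  obtain ⟨V, hV, hVv⟩ := mapClusterPt_iff_ultrafilter.1 hv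
  refine eq_of_sum_sq_max_eq (β := β) (fun k hk => ?_) (hordered V V.neBot hV v hVv)
    (hordered U U.neBot hU u hUu) fun z => ?_
  · rw [hneutral V V.neBot hV v hVv k hk, hneutral U U.neBot hU u hUu k hk]
  · obtain ⟨ℓ, hℓ⟩ := hsum z
    rw [hℓ V V.neBot hV v hVv, hℓ U U.neBot hU u hUu]

end Evolution

/-! ### Resolution of collisions and existence up to time `T` -/

/-- The charges after the collision of particles with the charges `β` at the positions `z`. -/
theorem exists_annihilation {z : Fin n → ℝ} {β : Fin n → SignType} {D : ℝ} (hD : 0 < D)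
    (hz : ∀ k l, k < l → β k ≠ 0 → β l ≠ 0 → z k ≤ z l)
    (hsep : ∀ s, s ≠ 0 → Separated z β s D) :
    ∃ b' : Fin n → SignType, (∀ i, b' i = β i ∨ b' i = 0) ∧
      (∀ y, ∑ i with z i = y, ((b' i : ℤ) - (β i : ℤ)) = 0) ∧ (z, b') ∈ stateSpace n := by
  have hnet : ∀ y (s : SignType), s ≠ 0 →
      (s : ℤ) * ∑ i with z i = y ∧ β i ≠ 0, (β i : ℤ) ≤ 1 := by
    intro y s hs
    refine mul_sum_le_one β _ hs (by simp +contextual) ?_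
    intro m hm l hl hml hk hms hls
    simp only [Finset.mem_filter, Finset.mem_univ, true_and] at hm hl hk
    have := hsep s hs m l ⟨hml, hm.2, hl.2, fun k hmk hkl => ?_⟩ hms hls
    · rw [hm.1, hl.1] at this
      linarith
    · by_contra hβk
      have h1 := hz m k hmk hm.2 hβk
      have h2 := hz k l hkl hβk hl.2
      exact hk k ⟨by linarith [hm.1, hl.1], hβk⟩ ⟨hmk, hkl⟩
  have hex : ∀ y, ∃ c : Fin n → SignType, (∀ i, z i = y → c i = β i ∨ c i = 0) ∧
      ∑ i with z i = y, ((c i : ℤ) - (β i : ℤ)) = 0 ∧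
      ∀ i j, z i = y → z j = y → c i ≠ 0 → c j ≠ 0 → i = j := by
    intro y
    -- Separation leaves only `-1`, `0` and `1` for `N`. If `N = 0` all particles at `y` become
    -- neutral; otherwise an arbitrary one with charge `N` survives.
    set N := ∑ i with z i = y, (β i : ℤ) with hN
    have hN' : ∑ i with z i = y ∧ β i ≠ 0, (β i : ℤ) = N := by
      rw [hN, ← Finset.filter_filter]
      refine Finset.sum_filter_of_ne fun i _ hi h => hi (by rw [h]; rfl)
    have h1 : N ≤ 1 := by simpa [hN'] using hnet y 1 (by decide)
    have h2 : -N ≤ 1 := by simpa [hN'] using hnet y (-1) (by decide)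
    by_cases h0 : N = 0
    · refine ⟨fun _ => 0, fun _ _ => Or.inr rfl, ?_, fun _ _ _ _ h => absurd rfl h⟩
      simp [← hN, h0]
    · have hi : ∃ i, z i = y ∧ (β i : ℤ) = N := by
        by_contra hcon
        push Not at hcon
        have hle : ∀ i ∈ Finset.univ.filter (fun i => z i = y), N * (β i : ℤ) ≤ 0 := by
          intro i hi
          have h3 := hcon i (Finset.mem_filter.1 hi).2
          have h4 := abs_le.1 (abs_coe_int_le (β i))
          have : N = 1 ∨ N = -1 := by omega
          rcases this with h | h <;> rw [h] at h3 ⊢ <;> omega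
        have := Finset.sum_nonpos hle
        rw [← Finset.mul_sum, ← hN] at this
        have : 0 < N * N := mul_self_pos.2 h0
        omega
      obtain ⟨i, hi, hβi⟩ := hi
      refine ⟨Pi.single i (β i), fun k _ => ?_, ?_, fun k l _ _ hk hl => ?_⟩
      · by_cases hk : k = i
        · subst hk
          simp
        · simp [hk]
      · rw [Finset.sum_sub_distrib, ← hN, Finset.sum_eq_single i]
        · simp [hβi]
        · intro k _ hk
          simp [hk]
        · simp [hi]
      · by_contra hkl
        by_cases hki : k = i
        · exact hl (Pi.single_eq_of_ne (fun h => hkl (hki.trans h.symm)) _)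
        · exact hk (Pi.single_eq_of_ne hki _)
  choose c hc1 hc2 hc3 using hex
  refine ⟨fun i => c (z i) i, fun i => hc1 _ i rfl, fun y => ?_, ?_⟩
  · rw [← hc2 y]
    refine Finset.sum_congr rfl fun i hi => ?_
    beta_reduce
    rw [(Finset.mem_filter.1 hi).2]
  · intro i j hij hb
    have hi : c (z i) i ≠ 0 := fun h => hb (by simp [h])
    have hj : c (z j) j ≠ 0 := fun h => hb (by simp [h])
    have hβi : β i ≠ 0 := fun h => by
      rcases hc1 _ i rfl with h' | h'
      · exact hi (h'.trans h)
      · exact hi h'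
    have hβj : β j ≠ 0 := fun h => by
      rcases hc1 _ j rfl with h' | h'
      · exact hj (h'.trans h)
      · exact hj h'
    refine (hz j i hij hβj hβi).lt_of_ne fun h => ?_
    rw [show z j = z i from h] at hj
    exact hij.ne' (hc3 (z i) i j rfl h hi hj)

/-- The time `τ` is the supremum of the times reachable with frozen charges. The positions converge
there, and the colliding charges are resolved. -/
theorem exists_evolution_until {x₀ : Fin n → ℝ} {b₀ : Fin n → SignType}
    (h0 : (x₀, b₀) ∈ stateSpace n) (hT : 0 < T) :
    ∃ τ ∈ Ioc 0 T, ∃ (X : ℝ → Fin n → ℝ) (B : ℝ → Fin n → SignType), Evolution τ X B ∧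
      X 0 = x₀ ∧ B 0 = b₀ ∧ (τ = T ∨ B τ ≠ b₀) := by
  set A : Set ℝ := {t | t ∈ Ioc 0 T ∧ ∃ X, Evolution t X (fun _ => b₀) ∧ X 0 = x₀} with hA
  obtain ⟨ε, hε, X₀, hX₀, hX₀'⟩ :=
    exists_evolution_of_injective fun i j hij hi hj => ne_of_mem_stateSpace h0 hij hi hj
  have hεA : min ε T ∈ A :=
    ⟨⟨lt_min hε hT, min_le_right _ _⟩, X₀, hX₀.restrict (min_le_left _ _), hX₀'⟩
  have hbdd : BddAbove A := ⟨T, fun t ht => ht.1.2⟩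
  set τ := sSup A with hτ
  have hτ0 : 0 < τ := (lt_min hε hT).trans_le (le_csSup hbdd hεA)
  have hτT : τ ≤ T := csSup_le ⟨_, hεA⟩ fun t ht => ht.1.2
  have hex : ∀ t ∈ Ico 0 τ, ∃ X, Evolution t X (fun _ => b₀) ∧ X 0 = x₀ := by
    intro t ht
    obtain ⟨s, hs, hts⟩ := exists_lt_of_lt_csSup ⟨_, hεA⟩ ht.2
    obtain ⟨X, hX, hX'⟩ := hs.2
    exact ⟨X, hX.restrict hts.le, hX'⟩
  choose! Y hY hY0 using hex
  -- By uniqueness the evolutions on different intervals agree, so their diagonal `Y s s` is an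
  -- evolution up to every time before `τ`.
  have hYY : ∀ s t, 0 ≤ s → s ≤ t → t < τ → Y s s = Y t s := by
    intro s t hs hst ht
    have := (hY s ⟨hs, hst.trans_lt ht⟩).matches_of_constant
      ((hY t ⟨hs.trans hst, ht⟩).restrict hst) (σ := 1) le_rfl hs le_rfl (fun _ _ => rfl)
      (fun i => ⟨by rw [hY0 s ⟨hs, hst.trans_lt ht⟩, hY0 t ⟨hs.trans hst, ht⟩]; rfl, rfl⟩)
    exact funext fun i => (this i).1.symm
  have hE : ∀ t ∈ Ico 0 τ, Evolution t (fun s => Y s s) (fun _ => b₀) := fun t ht =>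
    (hY t ht).congr (fun s hs => hYY s t hs.1 hs.2 ht.2) fun _ _ => rfl
  have hY00 : Y 0 0 = x₀ := hY0 0 ⟨le_rfl, hτ0⟩
  have hst0 : ((fun s => Y s s) 0, b₀) ∈ stateSpace n := by
    simpa only [hY00] using h0
  obtain ⟨L, hL⟩ := Evolution.exists_limit hτ0 hE hst0
  have hLk : ∀ k, Tendsto (fun s => Y s s k) (𝓝[<] τ) (𝓝 (L k)) := fun k =>
    ((continuous_apply k).tendsto L).comp hL
  have hord : ∀ t ∈ Ioo 0 τ, ∀ s ∈ Icc 0 t, (Y s s, b₀) ∈ stateSpace n := fun t ht s hs =>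
    (hE t ⟨ht.1.le, ht.2⟩).mem_stateSpace hst0 hs
  obtain ⟨ρ, hρ, hρ'⟩ := exists_separation x₀
  have hsep : ∀ s, s ≠ 0 → Separated L b₀ s ρ := by
    intro s hs i j hij hi hj
    refine ge_of_tendsto ((hLk j).sub (hLk i)) ?_
    filter_upwards [Ioo_mem_nhdsLT hτ0] with t ht
    refine (hE t ⟨ht.1.le, ht.2⟩).separated_mono (hord t ht) le_rfl hs hρ.le ?_
      ⟨ht.1.le, le_rfl⟩ i j hij hi hj
    intro k l hkl _ _
    have h1 := lt_of_mem_stateSpace h0 hkl.1 hkl.2.1 hkl.2.2.1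
    simp only [hY00]
    rw [← abs_of_pos (sub_pos.2 h1)]
    exact hρ' l k h1.ne'
  have hz : ∀ k l, k < l → b₀ k ≠ 0 → b₀ l ≠ 0 → L k ≤ L l := by
    intro k l hkl hk hl
    refine le_of_tendsto_of_tendsto (hLk k) (hLk l) ?_
    filter_upwards [Ioo_mem_nhdsLT hτ0] with t ht
    exact (lt_of_mem_stateSpace (hord t ht t ⟨ht.1.le, le_rfl⟩) hkl hk hl).le
  obtain ⟨b', hb1, hb2, hb3⟩ := exists_annihilation hρ hz hsep
  have hE' := Evolution.concat_limit hτ0 hE hL hb1 hb2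
    fun i j hij hi hj => ne_of_mem_stateSpace hb3 hij hi hj
  refine ⟨τ, ⟨hτ0, hτT⟩, _, _, hE', by rw [concat_of_lt hτ0]; exact hY00,
    by rw [concat_of_lt hτ0], ?_⟩
  rw [concat_of_le le_rfl]
  -- If no charge changed at `τ < T`, the evolution could be continued with the same frozen charges,
  -- contrary to the choice of `τ`.
  by_contra! hcon
  obtain ⟨hτT', rfl⟩ := hcon
  replace hτT' := hτT.lt_of_ne hτT'
  obtain ⟨δ, hδ, Z, hZ, hZ'⟩ :=
    exists_evolution_of_injective fun i j hij hi hj => ne_of_mem_stateSpace hb3 hij hi hj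
  have hcc : ∀ β : Fin n → SignType, (concat τ (fun _ => β) fun _ => β) = fun _ => β := by
    intro β
    funext t
    simp [concat]
  rw [hcc] at hE'
  have hE'' := hE'.concat hZ (by rw [hZ', concat_of_le le_rfl]) rfl
  rw [hcc] at hE''
  have hmem : min (τ + δ) T ∈ A := by
    refine ⟨⟨lt_min (by linarith) hT, min_le_right _ _⟩, _, hE''.restrict (min_le_left _ _), ?_⟩
    rw [concat_of_lt hτ0, concat_of_lt hτ0]
    exact hY00
  exact (lt_min (by linarith) hτT').not_ge (le_csSup hbdd hmem)

/-- Every stop before `T` removes charges, so induction on the number of charged particles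
terminates. -/
theorem exists_evolution {x₀ : Fin n → ℝ} {b₀ : Fin n → SignType}
    (h0 : (x₀, b₀) ∈ stateSpace n) (hT : 0 < T) :
    ∃ (X : ℝ → Fin n → ℝ) (B : ℝ → Fin n → SignType), Evolution T X B ∧ X 0 = x₀ ∧ B 0 = b₀ := by
  induction hN : (Finset.univ.filter fun i => b₀ i ≠ 0).card using Nat.strong_induction_on
    generalizing T x₀ b₀ with
  | _ N ih =>
    obtain ⟨τ, hτ, X, B, E, hX, hB, h⟩ := exists_evolution_until h0 hT
    rcases hτ.2.eq_or_lt with rfl | hlt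
    · exact ⟨X, B, E, hX, hB⟩
    have hne : B τ ≠ b₀ := h.resolve_left hlt.ne
    have hmono := E.charge_mono le_rfl hτ.1.le le_rfl
    rw [hB] at hmono
    have hcard : (Finset.univ.filter fun i => B τ i ≠ 0).card < N := by
      rw [← hN]
      refine Finset.card_lt_card (Finset.ssubset_iff_of_subset ?_ |>.2 ?_)
      · intro i hi
        simp only [Finset.mem_filter, Finset.mem_univ, true_and] at hi ⊢
        rwa [← (hmono i).resolve_right hi]
      · obtain ⟨i, hi⟩ := Function.ne_iff.1 hne
        have := (hmono i).resolve_left hi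
        exact ⟨i, by simpa [this] using fun h => hi (this.trans h.symm), by simpa using this⟩
    have hst := E.mem_stateSpace (by rwa [hX, hB]) (t := τ) ⟨hτ.1.le, le_rfl⟩
    obtain ⟨Y, C, F, hY, hC⟩ := ih _ hcard hst (sub_pos.2 hlt) rfl
    have hG := E.concat F hY hC
    rw [add_sub_cancel] at hG
    exact ⟨_, _, hG, by rw [concat_of_lt hτ.1, hX], by rw [concat_of_lt hτ.1, hB]⟩

end

/-! ### The minimal distance between neighbors of equal charge -/

section

variable {n : ℕ} {T : ℝ} {s : SignType}

theorem ofReal_le_minDist {x : Fin n → ℝ} {b : Fin n → SignType} {d : ℝ}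
    (h : Separated x b s d) : ENNReal.ofReal d ≤ minDist s x b :=
  le_iInf₂ fun i j => le_iInf fun hij => ENNReal.ofReal_le_ofReal (h i j hij.1 hij.2.1 hij.2.2)

theorem separated_of_ofReal_le_minDist {x : Fin n → ℝ} {b : Fin n → SignType}
    (hst : (x, b) ∈ stateSpace n) {d : ℝ} (h : ENNReal.ofReal d ≤ minDist s x b) :
    Separated x b s d := by
  intro i j hij hi hj
  have hlt := lt_of_mem_stateSpace hst hij.1 hij.2.1 hij.2.2.1
  refine (ENNReal.ofReal_le_ofReal_iff (sub_nonneg.2 hlt.le)).1 (h.trans ?_)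
  exact iInf₂_le_of_le i j (iInf_le _ ⟨hij, hi, hj⟩)

theorem minDist_pos {x : Fin n → ℝ} {b : Fin n → SignType} (hst : (x, b) ∈ stateSpace n) :
    0 < minDist s x b := by
  obtain ⟨ρ, hρ, hρ'⟩ := exists_separation x
  refine (ENNReal.ofReal_pos.2 hρ).trans_le (ofReal_le_minDist fun i j hij _ _ => ?_)
  have hlt := lt_of_mem_stateSpace hst hij.1 hij.2.1 hij.2.2.1
  rw [← abs_of_pos (sub_pos.2 hlt)]
  exact hρ' j i hlt.ne'

namespace Evolution

variable {x : ℝ → Fin n → ℝ} {b : ℝ → Fin n → SignType}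

theorem rpow_le_minDist (E : Evolution T x b) (hord : ∀ t ∈ Icc 0 T, (x t, b t) ∈ stateSpace n)
    (hs : s ≠ 0) {t : ℝ} (ht : t ∈ Icc 0 T) :
    (ENNReal.ofReal (separationRate n * t) + minDist s (x 0) (b 0) ^ 2) ^ (1 / 2 : ℝ) ≤
      minDist s (x t) (b t) := by
  have hγ : 0 ≤ separationRate n * t := mul_nonneg (separationRate_nonneg n) ht.1
  have key : ∀ d : ℝ, 0 ≤ d → ENNReal.ofReal d ≤ minDist s (x 0) (b 0) →
      ENNReal.ofReal (√(d ^ 2 + separationRate n * t)) ≤ minDist s (x t) (b t) := by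
    intro d hd h
    have h1 := E.separated hord le_rfl hs hd
      (separated_of_ofReal_le_minDist (hord 0 ⟨le_rfl, ht.1.trans ht.2⟩) h) t ht
    rw [sub_zero] at h1
    exact ofReal_le_minDist h1
  -- Without neighbors of this sign at time zero, the bound holds for every finite `d`, so the
  -- distance is infinite at time `t` as well.
  by_cases htop : minDist s (x 0) (b 0) = ∞
  · rw [htop] at key
    suffices h : minDist s (x t) (b t) = ∞ by rw [h]; exact le_top
    refine ENNReal.eq_top_of_forall_nnreal_le fun d => ?_
    refine le_trans ?_ (key d d.2 le_top)
    rw [← ENNReal.ofReal_coe_nnreal]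
    refine ENNReal.ofReal_le_ofReal (Real.le_sqrt_of_sq_le ?_)
    linarith
  · have h1 := key _ ENNReal.toReal_nonneg (ENNReal.ofReal_toReal htop).le
    refine le_of_eq_of_le ?_ h1
    conv_lhs => rw [← ENNReal.ofReal_toReal htop]
    rw [← ENNReal.ofReal_pow ENNReal.toReal_nonneg, ← ENNReal.ofReal_add hγ (by positivity),
      ENNReal.ofReal_rpow_of_nonneg (by positivity) (by norm_num), Real.sqrt_eq_rpow, add_comm]

theorem sqrt_localGap_le (E : Evolution T x b) (hord : ∀ t ∈ Icc 0 T, (x t, b t) ∈ stateSpace n)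
    {t₀ : ℝ} (ht₀ : t₀ ∈ Icc 0 T) {i j : Fin n} (hij : Neighbors (b t₀) i j) {t : ℝ}
    (ht : t ∈ Icc t₀ T)
    (hpos : 0 ≤ localGap (x t₀) (b t₀) i j ^ 2 - 8 * ((Real.log n + 1) / n) * (t - t₀)) :
    √(localGap (x t₀) (b t₀) i j ^ 2 - 8 * ((Real.log n + 1) / n) * (t - t₀)) ≤ x t j - x t i := by
  have hst := hord t₀ ht₀
  have hlt := sub_pos.2 (lt_of_mem_stateSpace hst hij.1 hij.2.1 hij.2.2.1)
  have htop : min (min (minDist 1 (x t₀) (b t₀)) (minDist (-1) (x t₀) (b t₀)))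
      (ENNReal.ofReal (x t₀ j - x t₀ i)) ≠ ∞ :=
    ((min_le_right _ _).trans_lt ENNReal.ofReal_lt_top).ne
  have hle : ENNReal.ofReal (localGap (x t₀) (b t₀) i j) ≤ _ := (ENNReal.ofReal_toReal htop).le
  have hc : 0 < localGap (x t₀) (b t₀) i j := ENNReal.toReal_pos
    (lt_min (lt_min (minDist_pos hst) (minDist_pos hst)) (ENNReal.ofReal_pos.2 hlt)).ne' htop
  refine E.sqrt_le_gap hord ht₀.1 hij hc (fun s hs => ?_) ?_ ht hpos
  · refine separated_of_ofReal_le_minDist hst (hle.trans ((min_le_left _ _).trans ?_))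
    cases s
    · exact absurd rfl hs
    · exact min_le_right _ _
    · exact min_le_left _ _
  · exact (ENNReal.ofReal_le_ofReal_iff hlt.le).1 (hle.trans (min_le_right _ _))

theorem exists_sqrt_lt_of_jump (E : Evolution T x b)
    (hord : ∀ t ∈ Icc 0 T, (x t, b t) ∈ stateSpace n) {τ : ℝ} (hτ : τ ∈ Ioc 0 T) {i₀ : Fin n}
    (hi₀ : jump b i₀ τ ≠ 0) :
    ∃ c : ℝ, 0 < c ∧ ∃ i j : Fin n, x τ i = x τ i₀ ∧ x τ j = x τ i₀ ∧
      chargeBefore b i τ ≠ 0 ∧ chargeBefore b j τ ≠ 0 ∧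
      ∀ᶠ t in 𝓝[<] τ, c * √(τ - t) < x t i - x τ i₀ ∧ x t j - x τ i₀ < -(c * √(τ - t)) := by
  obtain ⟨β, hβ, hβb, hsum⟩ := E.charge_left τ hτ
  simp only [chargeBefore_eq hβ]
  refine E.exists_sqrt_lt hord hτ hβ hβb hsum fun h => hi₀ ?_
  rw [jump, chargeBefore_eq hβ, h, sub_self]

end Evolution

end

end AnnihilatingParticles

/-! ### Proof of the theorem -/

open AnnihilatingParticles in
theorem theorem2p2 (n : ℕ) (hn : 2 ≤ n) (T : ℝ) (hT : 0 < T) :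
    -- the Lipschitz constant, as a function of the moments of the initial positions
    ∃ C : EuclideanSpace ℝ (Fin n) → ℝ, (∀ M, 0 < C M) ∧
    ∀ (x₀ : Fin n → ℝ) (b₀ : Fin n → SignType), (x₀, b₀) ∈ stateSpace n →
      -- existence
      (∃ (x : ℝ → Fin n → ℝ) (b : ℝ → Fin n → SignType), IsSolution T x₀ b₀ x b) ∧
      ∀ (x : ℝ → Fin n → ℝ) (b : ℝ → Fin n → SignType), IsSolution T x₀ b₀ x b →
        ∃ S : Finset ℝ, IsMinimalTimeSet T x₀ b₀ x b S ∧
        -- uniqueness modulo relabeling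
        (∀ (x' : ℝ → Fin n → ℝ) (b' : ℝ → Fin n → SignType), IsSolution T x₀ b₀ x' b' →
          IsMinimalTimeSet T x₀ b₀ x' b' S ∧ EqModRelabeling T S x b x' b') ∧
        -- Lipschitz regularity in the moment distance
        (∀ s t : ℝ, 0 ≤ s → s < t → t ≤ T →
          momentDist (x t) (x s) ≤ C (moments x₀) * |t - s|) ∧
        -- lower bound on the minimal distance between neighbors of equal sign
        (∀ s : SignType, s = 1 ∨ s = -1 → ∀ t ∈ Set.Icc 0 T,
          (ENNReal.ofReal (separationRate n * t) + minDist s (x 0) (b 0) ^ 2) ^ (1 / 2 : ℝ)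
            ≤ minDist s (x t) (b t)) ∧
        -- lower bound on the distance between any two neighbors
        (∀ t₀ ∈ Set.Icc 0 T, ∀ i j : Fin n, Neighbors (b t₀) i j →
          ∀ t ∈ Set.Icc t₀ T,
            0 ≤ localGap (x t₀) (b t₀) i j ^ 2 - 8 * ((Real.log n + 1) / n) * (t - t₀) →
            √(localGap (x t₀) (b t₀) i j ^ 2 - 8 * ((Real.log n + 1) / n) * (t - t₀))
              ≤ x t j - x t i) ∧
        -- upper bound at collision
        (∀ τ ∈ S, ∀ i, ∃ K : ℝ, 0 ≤ K ∧
          ∀ t ∈ Set.Icc 0 τ, |x t i - x τ i| ≤ K * √(τ - t)) ∧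
        -- lower bound at collision
        (∀ τ ∈ S, ∀ y : ℝ, (∃ i, x τ i = y ∧ jump b i τ ≠ 0) →
          ∃ c : ℝ, 0 < c ∧ ∃ i j : Fin n, x τ i = y ∧ x τ j = y ∧
            chargeBefore b i τ ≠ 0 ∧ chargeBefore b j τ ≠ 0 ∧
            ∀ᶠ t in 𝓝[<] τ, c * √(τ - t) < x t i - y ∧ x t j - y < -(c * √(τ - t))) ∧
        -- stability with respect to the initial positions
        (∀ (x₀m : ℕ → Fin n → ℝ) (xm : ℕ → ℝ → Fin n → ℝ) (bm : ℕ → ℝ → Fin n → SignType),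
          (∀ m, (x₀m m, b₀) ∈ stateSpace n) → Tendsto x₀m atTop (𝓝 x₀) →
          (∀ m, IsSolution T (x₀m m) b₀ (xm m) (bm m)) →
          (∀ ε > 0, ∀ᶠ m in atTop, ∀ t ∈ Set.Icc 0 T, momentDist (xm m t) (x t) < ε) ∧
          ∀ K : Set ℝ, IsCompact K → K ⊆ Set.Icc 0 T \ (S : Set ℝ) →
            ∀ ε > 0, ∀ᶠ m in atTop, ∀ t ∈ K, ∃ σ : Equiv.Perm (Fin n), ∀ i,
              bm m t (σ i) = b t i ∧ |xm m t (σ i) - x t i| < ε) := by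
  -- The index `1` belongs to the second moment `(1 / 2) * ∑ x ^ 2`, which exists as `n ≥ 2`. The
  -- absolute value keeps `R` nonnegative for vectors that are not moments of a configuration.
  set R : EuclideanSpace ℝ (Fin n) → ℝ := fun M => 2 * |M ⟨1, hn⟩| + 2 * n * T with hR
  have hR0 : ∀ M, 0 ≤ R M := fun M => by positivity
  refine ⟨fun M => n * (n * (n * (1 + R M) ^ n)) + 1, fun M => ?_, fun x₀ b₀ h0 => ⟨?_, ?_⟩⟩
  · have := hR0 M
    positivity
  · obtain ⟨x, b, E, rfl, rfl⟩ := exists_evolution h0 hT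
    exact ⟨x, b, E.jumpTimes, E.isSolutionWith fun t ht => E.mem_stateSpace h0 ht⟩
  intro x b h
  have hE : ∀ {x₀ x b}, IsSolution T x₀ b₀ x b → Evolution T x b ∧ x 0 = x₀ ∧ b 0 = b₀ :=
    fun ⟨S, hS⟩ => ⟨hS.evolution, hS.initial_position, hS.initial_charge⟩
  obtain ⟨E, hx0, hb0⟩ := hE h
  have hord : ∀ t ∈ Icc 0 T, (x t, b t) ∈ stateSpace n := fun t ht =>
    E.mem_stateSpace (by rwa [hx0, hb0]) ht
  refine ⟨E.jumpTimes, isMinimalTimeSet_jumpTimes h E, fun x' b' h' => ?_, ?_, ?_, ?_, ?_, ?_, ?_⟩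
  · obtain ⟨F, hx0', hb0'⟩ := hE h'
    have hx := hx0.trans hx0'.symm
    have hb := hb0.trans hb0'.symm
    refine ⟨?_, E.eqModRelabeling F hx hb⟩
    rw [E.jumpTimes_eq F hx hb]
    exact isMinimalTimeSet_jumpTimes h' F
  · intro s t hs hst ht
    have hsum : ∑ k, x 0 k ^ 2 + 2 * n * T ≤ R (moments x₀) := by
      have h2 : ∑ k, x 0 k ^ 2 = 2 * moments x₀ ⟨1, hn⟩ := by
        simp only [moments, hx0]
        norm_num
        ring
      rw [hR, h2]
      have := le_abs_self (moments x₀ ⟨1, hn⟩)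
      linarith
    refine (E.momentDist_le hsum (hR0 _) hs hst.le ht).trans ?_
    rw [abs_of_pos (sub_pos.2 hst)]
    have := sub_pos.2 hst
    gcongr
    linarith
  · rintro s hs t ht
    refine E.rpow_le_minDist hord ?_ ht
    rcases hs with rfl | rfl <;> decide
  · exact fun t₀ ht₀ i j hij t ht hpos => E.sqrt_localGap_le hord ht₀ hij ht hpos
  · exact fun τ hτ i => E.exists_abs_sub_le_sqrt (E.mem_jumpTimes.1 hτ).1 i
  · rintro τ hτ y ⟨i, rfl, hi⟩
    exact E.exists_sqrt_lt_of_jump hord (E.mem_jumpTimes.1 hτ).1 hi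
  · intro x₀m xm bm _ hlim hm
    have F := fun m => (hE (hm m)).1
    have hb : ∀ m, bm m 0 = b 0 := fun m => (hE (hm m)).2.2.trans hb0.symm
    have hx : Tendsto (fun m => xm m 0) atTop (𝓝 (x 0)) := by
      simpa only [(hE (hm _)).2.1, hx0] using hlim
    exact ⟨fun ε hε => E.eventually_momentDist_lt F hT hb hx hε,
      fun K hK hKS ε hε => E.eventually_forall_close F hb hx hK hKS hε⟩
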